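/- **Symbols.** For $\alpha\in\mathbb C$ let $\mathcal P^{\alpha,0}$ be the set of smooth $f:\mathbb R\to\mathbb C$ with (closed) support in $]0,+\infty[$ having an asymptotic expansion $f(\xi)\sim\sum_{j\ge0}c_j\,\xi^{\alpha-j}$ as $\xi\to+\infty$, i.e. $|\partial_\xi^\gamma(f-\sum_{j\le N}c_j\xi^{\alpha-j})|\le C_{N,\gamma}(1+\xi)^{\mathrm{Re}\,\alpha-N-1-\gamma}$ for $\xi\ge1$ and all $N,\gamma$; if $c_0\neq0$, $f$ has order $\alpha$. Let $\mathcal P^{*,0}$ be the linear span of the $\mathcal P^{\alpha,0}$, and let the real order of $f$ be $\inf\{\lambda\in\mathbb R:\ \xi^{-\lambda}f(\xi)\to0\}\in[-\infty,+\infty]$. Let $\widetilde{\mathcal A}$ be the (non-unital) subalgebra of $\mathcal P^{*,0}$ generated by the $f\in\mathcal P^{*,0}$ vanishing on $[1,+\infty[$ and the $f\in\mathcal P^{*,0}$ equal on $[1,+\infty[$ to $(\xi+v)^{-s}$ for some $v\ge0$, $s\in\mathbb C$; let $\mathcal N\subset\widetilde{\mathcal A}$ be the ideal of functions vanishing on $[1,+\infty[$,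 and $\sigma_s^v$ the class modulo $\mathcal N$ of any $f\in\widetilde{\mathcal A}$ with $f(\xi)=(\xi+v)^{-s}$ for $\xi\ge1$. **Regularisations.** Let $W\subset\mathbb C$ be open with $0\in W$. A *simple holomorphic family* of order $\alpha$ on $W$ ($\alpha:W\to\mathbb C$ holomorphic) is a family $(f(z))_{z\in W}$ of positively supported smooth functions, holomorphic in $z$ as a $C^\infty(\mathbb R)$-valued map, with $f(z)\in\mathcal P^{\alpha(z),0}$, with expansion coefficients $c_j(z)$ holomorphic on $W$, and such that for every $N\in\mathbb N$ and compact $K\subset W$ there is $J$ with $|\partial_z^k\partial_\xi^b(f(z)-\sum_{j<J}c_j(z)\xi^{\alpha(z)-j})|\le C_{k,b}\,\xi^{-N-b}$ for all $k,b$, $z\in K$, $\xi\ge1$. A *regularisation* $\mathcal R$ is a linear map $f\mapsto(f(z))_{z\in W}$ on $\widetilde{\mathcal A}$ such that: $f(0)=f$; each $f(z)$ is a finite sum of simple holomorphic families with orders satisfying $\mathrm{Re}\,\alpha_i'<0$ on $W$; if $f$ has order $a$, then $f(z)$ is a simple holomorphic family of some order $\alpha(z)$ with $\alpha(0)=a$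 and $\mathrm{Re}\,\alpha'<0$ on $W$; for each $t\in\mathbb R$ there is $z\in W$ such that $f(z)$ has real order $<-1$ for every $f\in\widetilde{\mathcal A}$ of real order $t$; and if $f\in\mathcal N$ then $f(z)$ vanishes on $[1,+\infty[$ for all $z\in W$. **Renormalised values.** Put $\varepsilon=1$ in the strict case and $\varepsilon=-1$ in the weak case, and $a\bullet b=\varepsilon ab$. For a pure tensor $w=a_1\otimes\cdots\otimes a_n$ and a composition $I=(i_1,\dots,i_k)$ of $n$, let $I[w]$ be the tensor of length $k$ of the $\bullet$-products of the consecutive blocks of $w$ of lengths $i_1,\dots,i_k$, and put $\log w=\sum_I\frac{(-1)^{n-k}}{i_1\cdots i_k}I[w]$, $\exp w=\sum_I\frac1{i_1!\cdots i_k!}I[w]$. Let $\widetilde{\mathcal R}(f_1\otimes\cdots\otimes f_k)(z)=f_1(z)\otimes\cdots\otimes f_k(z)$. The cut-off nested sum of $f_1\otimes\cdots\otimes f_k$ is the constant term, as $N\to\infty$, of the asymptotic expansion along the functions $N^a(\log N)^l$ ($a\in\mathbb C$, $l\in\mathbb N$) of $\sum f_1(n_1)\cdots f_k(n_k)$ over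 $0<n_k<\cdots<n_1\le N$ (strict case), resp. $0<n_k\le\cdots\le n_1\le N$ (weak case). Let $\Psi^{\mathcal R}(w)(z)$ be the cut-off nested sum of $(\exp\circ\widetilde{\mathcal R}\circ\log)(w)(z)$. With $\pi$ the projection of functions meromorphic at $0$ onto their pole part in $z^{-1}\mathbb C[z^{-1}]$, define $\Psi_\pm(\emptyset)=1$ and, for nonempty $w$, $B(w)=\Psi^{\mathcal R}(w)+\sum\Psi_-(w')\Psi^{\mathcal R}(w'')$ (sum over all cuts $w=w'\otimes w''$ into nonempty tensors), $\Psi_-(w)=-\pi B(w)$, $\Psi_+(w)=(1-\pi)B(w)$. For $v\ge0$ and $s_1,\dots,s_k\in\mathbb C$ let $\zeta^{\mathcal R}(s_1,\dots,s_k;v)$ (strict case) and $\bar\zeta^{\mathcal R}(s_1,\dots,s_k;v)$ (weak case) be $\Psi_+(\sigma_{s_1}^v\otimes\cdots\otimes\sigma_{s_k}^v)(0)$. Extend $\zeta^{\mathcal R}(\cdot;v)$ and $\bar\zeta^{\mathcal R}(\cdot;v)$ linearly to the vector space $\mathcal W$ freely spanned by finite sequences of complex numbers. **Stuffle product.** For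 $\varepsilon=\pm1$ let $\star_\varepsilon$ be the bilinear product on $\mathcal W$ with the empty sequence as unit and $$(a,u)\star_\varepsilon(b,w)=\big(a,\,u\star_\varepsilon(b,w)\big)+\big(b,\,(a,u)\star_\varepsilon w\big)+\varepsilon\,\big(a+b,\,u\star_\varepsilon w\big)$$ for $a,b\in\mathbb C$ and sequences $u,w$; equivalently, the sum over all quasi-shuffles, those of type $r$ having sign $\varepsilon^r$. **Theorem.** Let $W$, $\mathcal R$ be as above and $v\ge0$. 0. The renormalised values are well defined: for all $s_1,\dots,s_k\in\mathbb C$ and all representatives $f_i\in\widetilde{\mathcal A}$ of $\sigma_{s_i}^v$, in the strict and in the weak case, the cut-off nested sums that define $\Psi^{\mathcal R}(f_1\otimes\cdots\otimes f_k)(z)$ exist for all $z\ne0$ close to $0$, $\Psi^{\mathcal R}(f_1\otimes\cdots\otimes f_k)$ is meromorphic at $0$, and $\Psi_+(f_1\otimes\cdots\otimes f_k)(0)$ does not depend on the choice of the $f_i$. 1. For all $u,u'\in\mathcal W$, $$\bar\zeta^{\mathcal R}(u\star_{-1}u';v)=\bar\zeta^{\mathcal R}(u;v)\,\bar\zeta^{\mathcal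 R}(u';v),\qquad \zeta^{\mathcal R}(u\star_{1}u';v)=\zeta^{\mathcal R}(u;v)\,\zeta^{\mathcal R}(u';v).$$ 2. If $s_1,\dots,s_k\in\mathbb C$ satisfy $\mathrm{Re}(s_1+\cdots+s_m)>m$ for every $m\in\{1,\dots,k\}$, the following nested sums converge absolutely and $$\bar\zeta^{\mathcal R}(s_1,\dots,s_k;v)=\sum_{0<n_k\le\cdots\le n_1}\prod_{i=1}^k(n_i+v)^{-s_i},\qquad \zeta^{\mathcal R}(s_1,\dots,s_k;v)=\sum_{0<n_k<\cdots<n_1}\prod_{i=1}^k(n_i+v)^{-s_i};$$ in particular these values do not depend on $\mathcal R$. -/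

import Mathlib

open Filter Topology
open scoped ContDiff Polynomial

noncomputable section

namespace HurwitzRenorm

/-! ### Positively supported classical symbols on the real line -/

/-- The asymptotic expansion `f(ξ) ∼ ∑ⱼ cⱼ ξ ^ (α - j)` as `ξ → +∞`, with all derivatives. -/
def HasExpansion (α : ℂ) (c : ℕ → ℂ) (f : ℝ → ℂ) : Prop :=
  ∀ N γ : ℕ, ∃ C : ℝ, ∀ ξ : ℝ, 1 ≤ ξ →
    ‖iteratedDeriv γ (fun x : ℝ => f x - ∑ j ∈ Finset.range (N + 1), c j * (x : ℂ) ^ (α - j)) ξ‖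
      ≤ C * (1 + ξ) ^ (α.re - N - 1 - γ)

/-- `f` is smooth and its (closed) support lies in `]0, +∞[`. -/
def IsPosSupported (f : ℝ → ℂ) : Prop :=
  ContDiff ℝ ∞ f ∧ tsupport f ⊆ Set.Ioi 0

/-- `f ∈ 𝒫^{α,0}`: a positively supported classical symbol, with an expansion in the powers
`ξ ^ (α - j)`. -/
def IsPosSymbol (α : ℂ) (f : ℝ → ℂ) : Prop :=
  IsPosSupported f ∧ ∃ c : ℕ → ℂ, HasExpansion α c f

/-- `f ∈ 𝒫^{α,0}` and `α` is the order of `f`: the leading coefficient does not vanish. -/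
def HasOrder (f : ℝ → ℂ) (α : ℂ) : Prop :=
  IsPosSupported f ∧ ∃ c : ℕ → ℂ, HasExpansion α c f ∧ c 0 ≠ 0

/-- `𝒫^{*,0}`, the linear span of all the `𝒫^{α,0}`. -/
def posSymbols : Submodule ℂ (ℝ → ℂ) :=
  Submodule.span ℂ {f | ∃ α : ℂ, IsPosSymbol α f}

/-- The real order of a positively supported symbol (`⊥` if it decays faster than any power). -/
def realOrder (f : ℝ → ℂ) : EReal :=
  sInf {x : EReal | ∃ l : ℝ, x = (l : EReal) ∧
    Tendsto (fun ξ : ℝ => ((ξ ^ (-l) : ℝ) : ℂ) * f ξ) atTop (𝓝 0)}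

/-- The condition `f(ξ) = (ξ + v) ^ (-s)` for `ξ ≥ 1`. -/
def IsHurwitzSymbol (v : ℝ) (s : ℂ) (f : ℝ → ℂ) : Prop :=
  ∀ ξ : ℝ, 1 ≤ ξ → f ξ = ((ξ + v : ℝ) : ℂ) ^ (-s)

/-- The (non-unital) subalgebra of `𝒫^{*,0}` generated by the elements of `𝒫^{*,0}` vanishing
outside `]0, 1[` and by the elements equal to some `(ξ + v) ^ (-s)`, `v ≥ 0`, on `[1, +∞[`. -/
def hurwitzAlgebra : NonUnitalSubalgebra ℂ (ℝ → ℂ) :=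
  NonUnitalAlgebra.adjoin ℂ
    ({f | f ∈ posSymbols ∧ ∀ ξ : ℝ, 1 ≤ ξ → f ξ = 0} ∪
      {f | f ∈ posSymbols ∧ ∃ (v : ℝ) (s : ℂ), 0 ≤ v ∧ IsHurwitzSymbol v s f})

/-! ### Holomorphic families and holomorphic regularisations -/

/-- A simple holomorphic family, parametrised by `z ∈ W`, of positively supported classical
symbols, of holomorphic order `α`. The fields `continuous_deriv` and `holomorphic` say that
`z ↦ f z` is holomorphic as a map into `C^∞(ℝ)`; the last clause is the estimate, locally uniform
in `z`, of all the derivatives in `z` and in `ξ` of the remainders of the expansion. -/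
structure IsSimpleHolFamily (W : Set ℂ) (α : ℂ → ℂ) (f : ℂ → ℝ → ℂ) : Prop where
  order_holomorphic : DifferentiableOn ℂ α W
  posSupported : ∀ z ∈ W, IsPosSupported (f z)
  continuous_deriv : ∀ b : ℕ,
    ContinuousOn (fun p : ℂ × ℝ => iteratedDeriv b (f p.1) p.2) (W ×ˢ Set.univ)
  holomorphic : ∀ (b : ℕ) (ξ : ℝ), DifferentiableOn ℂ (fun z => iteratedDeriv b (f z) ξ) W
  expansion : ∃ c : ℕ → ℂ → ℂ,
    (∀ j, DifferentiableOn ℂ (c j) W) ∧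
    (∀ z ∈ W, HasExpansion (α z) (fun j => c j z) (f z)) ∧
    ∀ (N : ℕ) (K : Set ℂ), IsCompact K → K ⊆ W → ∃ J : ℕ, ∀ k b : ℕ, ∃ C : ℝ,
      ∀ z ∈ K, ∀ ξ : ℝ, 1 ≤ ξ →
        ‖iteratedDeriv k (fun y : ℂ => iteratedDeriv b (fun x : ℝ =>
            f y x - ∑ j ∈ Finset.range J, c j y * (x : ℂ) ^ (α y - j)) ξ) z‖
          ≤ C * ξ ^ (-(N : ℝ) - b)

/-- A holomorphic regularisation procedure `f ↦ (f(z))_{z ∈ W}` on the algebra `hurwitzAlgebra`,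
satisfying the order condition and respecting the ideal of the functions that vanish outside
`]0, 1[`. -/
structure Regularisation (W : Set ℂ) where
  /-- The map `f ↦ (z ↦ f(z))`; its values are only used for `z ∈ W`. -/
  toFun : hurwitzAlgebra →ₗ[ℂ] (ℂ → ℝ → ℂ)
  map_zero : ∀ f : hurwitzAlgebra, toFun f 0 = (f : ℝ → ℂ)
  holomorphic : ∀ f : hurwitzAlgebra, ∃ (n : ℕ) (α : Fin n → ℂ → ℂ) (g : Fin n → ℂ → ℝ → ℂ),
    (∀ i, IsSimpleHolFamily W (α i) (g i) ∧ ∀ z ∈ W, (deriv (α i) z).re < 0) ∧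
    ∀ z ∈ W, toFun f z = ∑ i, g i z
  /-- A symbol of order `a` is perturbed into a simple family of order `α(z)`, `α(0) = a`. -/
  simple : ∀ (f : hurwitzAlgebra) (a : ℂ), HasOrder f a → ∃ α : ℂ → ℂ,
    IsSimpleHolFamily W α (toFun f) ∧ α 0 = a ∧ ∀ z ∈ W, (deriv α z).re < 0
  order_lt : ∀ t : ℝ, ∃ z ∈ W, ∀ f : hurwitzAlgebra,
    realOrder f = (t : EReal) → realOrder (toFun f z) < (-1 : EReal)
  map_ideal : ∀ f : hurwitzAlgebra, (∀ ξ : ℝ, 1 ≤ ξ → (f : ℝ → ℂ) ξ = 0) →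
    ∀ z ∈ W, ∀ ξ : ℝ, 1 ≤ ξ → toFun f z ξ = 0

/-! ### Stuffle product and Hoffman isomorphism -/

/-- The two versions of nested sums: strict or weak inequalities. -/
inductive Nesting
  | strict
  | weak

/-- The product `•` is `sign` times the ordinary product. -/
def Nesting.sign : Nesting → ℂ
  | .strict => 1
  | .weak => -1

/-- The stuffle (quasi-shuffle) product of two words of complex numbers, where merging two letters
means adding them, with a factor `ε` for each merging. -/
def stuffleWord (ε : ℂ) : List ℂ → List ℂ → (List ℂ →₀ ℂ)
  | [], w => Finsupp.single w 1
  | a :: u, [] => Finsupp.single (a :: u) 1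
  | a :: u, b :: w =>
      Finsupp.mapDomain (List.cons a) (stuffleWord ε u (b :: w))
        + Finsupp.mapDomain (List.cons b) (stuffleWord ε (a :: u) w)
        + ε • Finsupp.mapDomain (List.cons (a + b)) (stuffleWord ε u w)
termination_by u w => u.length + w.length

/-- The bilinear extension of the stuffle product to the free vector space `𝒲` on the words. -/
def stuffle (ε : ℂ) (P Q : List ℂ →₀ ℂ) : List ℂ →₀ ℂ :=
  P.sum fun u x => Q.sum fun w y => (x * y) • stuffleWord ε u w

/-- The product `a₁ • a₂ • ⋯ • aᵢ` of a nonempty list, where `a • b = ε a b`. -/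
def bulletProd {X : Type*} [Mul X] [Zero X] [SMul ℂ X] (ε : ℂ) : List X → X
  | [] => 0
  | [a] => a
  | a :: b :: l => ε • (a * bulletProd ε (b :: l))

/-- `I[w]`: the word whose letters are the `•`-products of the blocks of `w` cut along `I`. -/
def contract {X : Type*} [Mul X] [Zero X] [SMul ℂ X] (ε : ℂ) (w : List X)
    (I : Composition w.length) : List X :=
  (w.splitWrtComposition I).map (bulletProd ε)

/-- Hoffman's logarithm of the pure tensor `w`, as a formal linear combination of pure tensors. -/
def hoffmanLog {X : Type*} [Mul X] [Zero X] [SMul ℂ X] (ε : ℂ) (w : List X) : List X →₀ ℂ :=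
  ∑ I : Composition w.length,
    Finsupp.single (contract ε w I) ((-1) ^ (w.length - I.length) / (I.blocks.prod : ℂ))

/-- Hoffman's exponential of the pure tensor `w`, as a formal linear combination of pure
tensors. -/
def hoffmanExp {X : Type*} [Mul X] [Zero X] [SMul ℂ X] (ε : ℂ) (w : List X) : List X →₀ ℂ :=
  ∑ I : Composition w.length,
    Finsupp.single (contract ε w I) (1 / ((I.blocks.map Nat.factorial).prod : ℂ))

/-! ### Cut-off nested sums -/

/-- `c` is the constant term of an asymptotic expansion of `g(N)` as `N → ∞` along the functions
`N ^ a * (log N) ^ l`. -/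
def HasFinitePart (g : ℕ → ℂ) (c : ℂ) : Prop :=
  ∃ (E : Finset (ℂ × ℕ)) (b : ℂ × ℕ → ℂ), ((0, 0) : ℂ × ℕ) ∉ E ∧
    Tendsto (fun N : ℕ =>
      g N - c - ∑ p ∈ E, b p * ((N : ℂ) ^ p.1 * ((Real.log N : ℝ) : ℂ) ^ p.2)) atTop (𝓝 0)

open Classical in
/-- The finite part of `g(N)` as `N → ∞`. -/
def finitePart (g : ℕ → ℂ) : ℂ :=
  if h : ∃ c, HasFinitePart g c then h.choose else 0

/-- The bound on the next summation variable: `n₂ < n₁` or `n₂ ≤ n₁`. -/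
def Nesting.innerBound : Nesting → ℕ → ℕ
  | .strict, n => n - 1
  | .weak, n => n

/-- The truncated nested sum `∑ f₁(n₁) ⋯ f_k(n_k)` over `N ≥ n₁ > ⋯ > n_k > 0`, respectively
`N ≥ n₁ ≥ ⋯ ≥ n_k > 0`. -/
def truncSum (κ : Nesting) : List (ℝ → ℂ) → ℕ → ℂ
  | [], _ => 1
  | f :: w, N => ∑ n ∈ Finset.Icc 1 N, f (n : ℝ) * truncSum κ w (κ.innerBound n)

/-- The cut-off nested sum of the pure tensor `w`. -/
def cutoffSum (κ : Nesting) (w : List (ℝ → ℂ)) : ℂ :=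
  finitePart (truncSum κ w)

variable {W : Set ℂ}

/-- The regularisation `exp ∘ R̃ ∘ log` of the pure tensor `w`, evaluated at `z`, where
`R̃(f₁ ⊗ ⋯ ⊗ f_k)(z) = f₁(z) ⊗ ⋯ ⊗ f_k(z)`. -/
def regTensor (R : Regularisation W) (κ : Nesting) (w : List hurwitzAlgebra) (z : ℂ) :
    List (ℝ → ℂ) →₀ ℂ :=
  Finsupp.linearCombination ℂ (hoffmanExp κ.sign)
    (Finsupp.mapDomain (List.map fun f => R.toFun f z) (hoffmanLog κ.sign w))

/-- The map `Ψ^R(w)`, `z ↦` cut-off nested sum of `(exp ∘ R̃ ∘ log)(w)(z)`. -/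
def regSum (R : Regularisation W) (κ : Nesting) (w : List hurwitzAlgebra) (z : ℂ) : ℂ :=
  Finsupp.linearCombination ℂ (cutoffSum κ) (regTensor R κ w z)

/-! ### Birkhoff factorisation with minimal subtraction at `z = 0` -/

/-- `f(z) = p(1/z) + g(z)` near `0`, with `p ∈ Xℂ[X]` and `g` holomorphic at `0`. -/
def IsLaurentSplit (f : ℂ → ℂ) (p : ℂ[X]) (g : ℂ → ℂ) : Prop :=
  p.coeff 0 = 0 ∧ AnalyticAt ℂ g 0 ∧ ∀ᶠ z in 𝓝[≠] (0 : ℂ), f z = p.eval z⁻¹ + g z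

open Classical in
/-- The pole part at `0`, an element of `z⁻¹ ℂ[z⁻¹]`, of a function meromorphic at `0`. -/
def polePart (f : ℂ → ℂ) : ℂ → ℂ :=
  if h : ∃ p : ℂ[X], ∃ g : ℂ → ℂ, IsLaurentSplit f p g then fun z => h.choose.eval z⁻¹ else 0

/-- The component `Φ₋` of the Birkhoff factorisation, for the deconcatenation coproduct:
`Φ₋(w) = -π (Φ(w) + ∑ Φ₋(w') Φ(w''))`, the sum being over the proper cuts `w = w' w''`. -/
def birkhoffMinus {X : Type*} (Φ : List X → ℂ → ℂ) : List X → ℂ → ℂ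
  | [] => 1
  | a :: w => -polePart (fun z => Φ (a :: w) z +
      ∑ i : Fin w.length,
        birkhoffMinus Φ ((a :: w).take (i + 1)) z * Φ ((a :: w).drop (i + 1)) z)
termination_by w => w.length
decreasing_by simp

/-- `Φ(w) + ∑ Φ₋(w') Φ(w'')`, the sum being over the proper cuts `w = w' w''`. -/
def birkhoffPrep {X : Type*} (Φ : List X → ℂ → ℂ) (w : List X) (z : ℂ) : ℂ :=
  Φ w z + ∑ i : Fin (w.length - 1),
    birkhoffMinus Φ (w.take (i + 1)) z * Φ (w.drop (i + 1)) z

/-- The component `Φ₊ = (1 - π) (Φ(w) + ∑ Φ₋(w') Φ(w''))` of the Birkhoff factorisation. -/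
def birkhoffPlus {X : Type*} (Φ : List X → ℂ → ℂ) : List X → ℂ → ℂ
  | [] => 1
  | a :: w => birkhoffPrep Φ (a :: w) - polePart (birkhoffPrep Φ (a :: w))

/-! ### Renormalised values -/

/-- The renormalised nested sum of the pure tensor `w`: the value at `z = 0` of (the holomorphic
extension of) `Ψ^R₊(w)`. -/
def renormSum (R : Regularisation W) (κ : Nesting) (w : List hurwitzAlgebra) : ℂ :=
  limUnder (𝓝[≠] (0 : ℂ)) (birkhoffPlus (regSum R κ) w)

open Classical in
/-- A representative in `hurwitzAlgebra` of the class `σ_s^v` of the functions equal to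
`(ξ + v) ^ (-s)` for `ξ ≥ 1`. -/
def hurwitzRep (v : ℝ) (s : ℂ) : hurwitzAlgebra :=
  if h : ∃ f : hurwitzAlgebra, IsHurwitzSymbol v s f then h.choose else 0

/-- The renormalised Hurwitz multiple zeta value at `(s₁, …, s_k; v)`: `ζ^R` for strict
inequalities, `ζ̄^R` for weak ones. -/
def renormZeta (R : Regularisation W) (κ : Nesting) (v : ℝ) (s : List ℂ) : ℂ :=
  renormSum R κ (s.map (hurwitzRep v))

/-- The linear extension of the renormalised Hurwitz multiple zeta values to `𝒲`. -/
def renormZetaLin (R : Regularisation W) (κ : Nesting) (v : ℝ) : (List ℂ →₀ ℂ) →ₗ[ℂ] ℂ :=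
  Finsupp.linearCombination ℂ (renormZeta R κ v)

end HurwitzRenorm

end

/-! The regularised nested sums form a character of the stuffle algebra with values in germs of
meromorphic functions. Birkhoff factorisation turns such a character into a holomorphic one, whose
value at `z = 0` is again a character. In the domain of convergence there is nothing to subtract.

Algebra. Hoffman's logarithm carries the quasi-shuffle product to the shuffle product, and his
exponential carries it back (`psiL_log_qsh`, `psiL_exp_qshL`). Regularising letter by letter is not
multiplicative, but shuffling never multiplies letters, so `R̃` respects shuffles. Truncated nested
sums are characters of the quasi-shuffle algebra (`truncSum_mul`). Hence the truncated sums of `exp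
∘ R̃ ∘ log` are multiplicative for every `N` and `z` (`regTruncSum_mul`). Hoffman's theorem itself
is proved by cutting off head blocks. A block of `k = i + j` letters of a shuffle takes `i` letters
from one word and `j` from the other in `binom(k, i)` ways, and `binom(k, i) / k! = 1 / (i! j!)`.
Composing two block maps amounts to substituting their power series, so `exp` and `log` are mutually
inverse.

Analysis. A cut-off sum is in general not multiplicative, because `N ^ a * N ^ (-a)` creates a
constant term. Here all sequences expand in terms `c(z) n ^ β(z)` with `c` meromorphic and `Re β'(0)
< 0`. This condition survives products and integer shifts, and it makes `β(z) ≠ 0` for `z ≠ 0` close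
to `0`. So powers never combine into constants and constant terms multiply (`Good.mul`). Partial
sums of such sequences are again of this form up to a meromorphic constant
(`Expandable.exists_good_partialSum`): expand `(n + 1) ^ (β + 1) - n ^ (β + 1)`, telescope, and
divide by `β + 1`, which is where poles at `0` arise. Uniqueness of finite parts
(`HasFinitePart.unique`) identifies these constants with the cut-off sums and transfers the product
formula to them (`regSum_mul`).

Birkhoff factorisation. The defects of multiplicativity of `Φ₊` and `Φ₋` agree by induction on
length, so they lie both among holomorphic germs and among pole parts, and vanish (`birkhoff_mul`).

Classes. The regularisation is linear and preserves the ideal of functions vanishing on `[1, +∞[`,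
so everything depends only on tails and is homogeneous in each letter (`homogeneous_renormSum`).
This gives independence of representatives, and it allows the product of the classes of `s` and `t`
to be replaced by the class of `s + t`.

Convergence. If all prefix sums of the numbers `1 - Re sᵢ` are negative, the same holds after a
small perturbation and after merging letters. All sums then converge uniformly near `z = 0`
(`exists_tendsto_famSum`), the factorisation is trivial (`birkhoffPlus_eq_self`), and at `z = 0` the
identity `exp ∘ log = id` gives back the original nested sum. -/

noncomputable section

namespace HurwitzRenorm

/-! ### Words, quasi-shuffles and Hoffman's maps -/

section Words

variable {X X' : Type*}

/-- Prepend the letter `a` to all words of a formal linear combination. -/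
def consL (a : X) : (List X →₀ ℂ) →ₗ[ℂ] (List X →₀ ℂ) :=
  Finsupp.lmapDomain ℂ ℂ (List.cons a)

@[simp]
theorem consL_single (a : X) (w : List X) (x : ℂ) :
    consL a (Finsupp.single w x) = Finsupp.single (a :: w) x := by
  simp [consL]

/-- The quasi-shuffle of two words, with a factor `t` for each merging of letters. -/
def qsh (op : X → X → X) (t : ℂ) : List X → List X → (List X →₀ ℂ)
  | [], w => Finsupp.single w 1
  | a :: u, [] => Finsupp.single (a :: u) 1
  | a :: u, b :: w =>
      consL a (qsh op t u (b :: w)) + consL b (qsh op t (a :: u) w)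
        + t • consL (op a b) (qsh op t u w)
termination_by u w => u.length + w.length

theorem qsh_nil_left (op : X → X → X) (t : ℂ) (w : List X) :
    qsh op t [] w = Finsupp.single w 1 := by rw [qsh]

theorem qsh_nil_right (op : X → X → X) (t : ℂ) (w : List X) :
    qsh op t w [] = Finsupp.single w 1 := by cases w <;> rw [qsh]

theorem qsh_cons_cons (op : X → X → X) (t : ℂ) (a b : X) (u w : List X) :
    qsh op t (a :: u) (b :: w) =
      consL a (qsh op t u (b :: w)) + consL b (qsh op t (a :: u) w)
        + t • consL (op a b) (qsh op t u w) := by rw [qsh]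

/-- The bilinear extension of the quasi-shuffle product. -/
def qshL (op : X → X → X) (t : ℂ) :
    (List X →₀ ℂ) →ₗ[ℂ] (List X →₀ ℂ) →ₗ[ℂ] (List X →₀ ℂ) :=
  Finsupp.linearCombination ℂ fun u => Finsupp.linearCombination ℂ (qsh op t u)

@[simp]
theorem qshL_single (op : X → X → X) (t : ℂ) (u w : List X) (x y : ℂ) :
    qshL op t (Finsupp.single u x) (Finsupp.single w y) = (x * y) • qsh op t u w := by
  simp [qshL, smul_smul]

theorem qshL_nil_left (op : X → X → X) (t : ℂ) (p : List X →₀ ℂ) :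
    qshL op t (Finsupp.single [] 1) p = p := by
  induction p using Finsupp.induction_linear with
  | zero => simp
  | add p q hp hq => rw [map_add, hp, hq]
  | single w x => simp [qsh_nil_left]

theorem qshL_nil_right (op : X → X → X) (t : ℂ) (p : List X →₀ ℂ) :
    qshL op t p (Finsupp.single [] 1) = p := by
  induction p using Finsupp.induction_linear with
  | zero => simp
  | add p q hp hq => rw [map_add, LinearMap.add_apply, hp, hq]
  | single w x => simp [qsh_nil_right]

theorem qshL_cons_cons (op : X → X → X) (t : ℂ) (a b : X) (p q : List X →₀ ℂ) :
    qshL op t (consL a p) (consL b q) =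
      consL a (qshL op t p (consL b q)) + consL b (qshL op t (consL a p) q)
        + t • consL (op a b) (qshL op t p q) := by
  induction p using Finsupp.induction_linear with
  | zero => simp
  | add p p' hp hp' => simp only [map_add, LinearMap.add_apply, hp, hp', smul_add]; abel
  | single u x =>
    induction q using Finsupp.induction_linear with
    | zero => simp
    | add q q' hq hq' => simp only [map_add, hq, hq', smul_add]; abel
    | single w y =>
      simp only [consL_single, qshL_single, qsh_cons_cons, map_smul, smul_add]
      rw [smul_comm t]

/-- `psi op c w` is the sum over all ways of cutting `w` into blocks of the words of the block
products, the coefficient being the product of the numbers `c i`, for `i` a block length. -/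
def psi (op : X → X → X) (c : ℕ → ℂ) : List X → (List X →₀ ℂ)
  | [] => Finsupp.single [] 1
  | a :: w => ∑ k ∈ Finset.range (w.length + 1),
      c (k + 1) • consL ((w.take k).foldl op a) (psi op c (w.drop k))
termination_by w => w.length
decreasing_by simp

/-- The linear extension of `psi`. -/
def psiL (op : X → X → X) (c : ℕ → ℂ) : (List X →₀ ℂ) →ₗ[ℂ] (List X →₀ ℂ) :=
  Finsupp.linearCombination ℂ (psi op c)

theorem psi_nil (op : X → X → X) (c : ℕ → ℂ) : psi op c [] = Finsupp.single [] 1 := by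
  rw [psi]

theorem psi_cons (op : X → X → X) (c : ℕ → ℂ) (a : X) (w : List X) :
    psi op c (a :: w) = ∑ k ∈ Finset.range (w.length + 1),
      c (k + 1) • consL ((w.take k).foldl op a) (psi op c (w.drop k)) := by
  rw [psi]

@[simp]
theorem psiL_single (op : X → X → X) (c : ℕ → ℂ) (w : List X) (x : ℂ) :
    psiL op c (Finsupp.single w x) = x • psi op c w := by
  simp [psiL]

/-- Apply a map to all the letters of a linear combination of words. -/
def mapL (φ : X → X') : (List X →₀ ℂ) →ₗ[ℂ] (List X' →₀ ℂ) :=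
  Finsupp.lmapDomain ℂ ℂ (List.map φ)

@[simp]
theorem mapL_single (φ : X → X') (w : List X) (x : ℂ) :
    mapL φ (Finsupp.single w x) = Finsupp.single (w.map φ) x := by
  simp [mapL]

theorem mapL_consL (φ : X → X') (a : X) (p : List X →₀ ℂ) :
    mapL φ (consL a p) = consL (φ a) (mapL φ p) := by
  induction p using Finsupp.induction_linear with
  | zero => simp
  | add p q hp hq => simp only [map_add, hp, hq]
  | single w x => simp

theorem mapL_injective {φ : X → X'} (hφ : Function.Injective φ) :
    Function.Injective (mapL φ) :=
  Finsupp.mapDomain_injective (List.map_injective_iff.2 hφ)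

theorem map_foldl_op {op : X → X → X} {op' : X' → X' → X'} {φ : X → X'}
    (hφ : ∀ a b, φ (op a b) = op' (φ a) (φ b)) (a : X) (w : List X) :
    φ (w.foldl op a) = (w.map φ).foldl op' (φ a) := by
  induction w generalizing a with
  | nil => rfl
  | cons b w ih => simp [ih, hφ]

theorem mapL_psi {op : X → X → X} {op' : X' → X' → X'} {φ : X → X'}
    (hφ : ∀ a b, φ (op a b) = op' (φ a) (φ b)) (c : ℕ → ℂ) (w : List X) :
    mapL φ (psi op c w) = psi op' c (w.map φ) := by
  induction hn : w.length using Nat.strong_induction_on generalizing w with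
  | _ n ih =>
    cases w with
    | nil => simp [psi_nil]
    | cons a w =>
      rw [psi_cons, List.map_cons, psi_cons, map_sum, List.length_map]
      refine Finset.sum_congr rfl fun k _ => ?_
      rw [map_smul, mapL_consL, map_foldl_op hφ, ih _ _ (w.drop k) rfl, List.map_take,
        List.map_drop]
      simp only [List.length_cons] at hn
      simp; omega

theorem mapL_psiL {op : X → X → X} {op' : X' → X' → X'} {φ : X → X'}
    (hφ : ∀ a b, φ (op a b) = op' (φ a) (φ b)) (c : ℕ → ℂ) (p : List X →₀ ℂ) :
    mapL φ (psiL op c p) = psiL op' c (mapL φ p) := by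
  induction p using Finsupp.induction_linear with
  | zero => simp
  | add p q hp hq => simp only [map_add, hp, hq]
  | single w x => simp [mapL_psi hφ]

/-- Letters are multiplied only when they are merged. For `t = 0` this never happens, so an
arbitrary map of letters respects the shuffle product; this is how a non-multiplicative
regularisation gets through. -/
theorem mapL_qsh {op : X → X → X} {op' : X' → X' → X'} {φ : X → X'} {t : ℂ}
    (hφ : t = 0 ∨ ∀ a b, φ (op a b) = op' (φ a) (φ b)) (u w : List X) :
    mapL φ (qsh op t u w) = qsh op' t (u.map φ) (w.map φ) := by
  induction u, w using qsh.induct with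
  | case1 w => simp [qsh_nil_left]
  | case2 a u => simp [qsh_nil_right]
  | case3 a u b w h1 h2 h3 =>
    rw [qsh_cons_cons, List.map_cons, List.map_cons, qsh_cons_cons]
    simp only [List.map_cons] at h1 h2
    rcases hφ with rfl | hφ
    · simp [mapL_consL, h1, h2]
    · simp [mapL_consL, h1, h2, h3, hφ]

theorem mapL_qshL {op : X → X → X} {op' : X' → X' → X'} {φ : X → X'} {t : ℂ}
    (hφ : t = 0 ∨ ∀ a b, φ (op a b) = op' (φ a) (φ b)) (p q : List X →₀ ℂ) :
    mapL φ (qshL op t p q) = qshL op' t (mapL φ p) (mapL φ q) := by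
  induction p using Finsupp.induction_linear with
  | zero => simp
  | add p p' hp hp' => simp only [map_add, LinearMap.add_apply, hp, hp']
  | single u x =>
    induction q using Finsupp.induction_linear with
    | zero => simp
    | add q q' hq hq' => simp only [map_add, hq, hq']
    | single w y => simp [mapL_qsh hφ]

/-- The word `y` arises from `w` by repeatedly merging adjacent letters. -/
inductive Coarse (op : X → X → X) : List X → List X → Prop
  | nil : Coarse op [] []
  | cons (a : X) {w y : List X} : Coarse op w y → Coarse op (a :: w) (a :: y)
  | merge (a b : X) {w y : List X} : Coarse op (op a b :: w) y → Coarse op (a :: b :: w) y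

/-- Induction on `k`, merging the next letter into the head each time. When `k` exceeds the length
of `w`, `take` and `drop` saturate and the claim persists. -/
theorem Coarse.block (op : X → X → X) (k : ℕ) (a : X) (w y : List X)
    (h : Coarse op (w.drop k) y) : Coarse op (a :: w) ((w.take k).foldl op a :: y) := by
  induction k generalizing a w with
  | zero => exact .cons _ (by simpa using h)
  | succ k ih =>
    cases w with
    | nil => exact .cons _ (by simpa using h)
    | cons b w => exact .merge _ _ (by simpa using ih (op a b) w (by simpa using h))

theorem mem_support_consL {a : X} {p : List X →₀ ℂ} {y : List X}
    (h : y ∈ (consL a p).support) : ∃ w ∈ p.support, y = a :: w := by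
  classical
  have := Finsupp.mapDomain_support h
  simp only [Finset.mem_image] at this
  obtain ⟨w, hw, rfl⟩ := this
  exact ⟨w, hw, rfl⟩

theorem coarse_of_mem_support_psi {op : X → X → X} {c : ℕ → ℂ} {w y : List X}
    (h : y ∈ (psi op c w).support) : Coarse op w y := by
  classical
  induction hn : w.length using Nat.strong_induction_on generalizing w y with
  | _ n ih =>
    cases w with
    | nil =>
      rw [psi_nil] at h
      have := Finsupp.support_single_subset h
      simp only [Finset.mem_singleton] at this
      rw [this]; exact .nil
    | cons a w =>
      rw [psi_cons] at h
      obtain ⟨k, -, hk⟩ := Finset.mem_biUnion.1 (Finsupp.support_finsetSum h)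
      obtain ⟨y', hy', rfl⟩ := mem_support_consL (Finsupp.support_smul hk)
      refine Coarse.block op k a w y' (ih _ ?_ hy' rfl)
      simp only [List.length_cons] at hn
      simp; omega

theorem Coarse.length_le {op : X → X → X} {w y : List X} (h : Coarse op w y) :
    y.length ≤ w.length := by
  induction h with
  | nil => simp
  | cons a h ih => simpa using ih
  | merge a b h ih => simp at *; omega

theorem Coarse.forall {op : X → X → X} {P : X → Prop} (hP : ∀ a b, P a → P b → P (op a b))
    {w y : List X} (h : Coarse op w y) (hw : ∀ a ∈ w, P a) : ∀ a ∈ y, P a := by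
  induction h with
  | nil => exact hw
  | cons a h ih =>
    simp only [List.mem_cons, forall_eq_or_imp] at hw ⊢
    exact ⟨hw.1, ih hw.2⟩
  | merge a b h ih =>
    simp only [List.mem_cons, forall_eq_or_imp] at hw ih
    exact ih ⟨hP _ _ hw.1 hw.2.1, hw.2.2⟩

/-- Splitting off the first block `k + 1` leaves a composition of `n - k`. This gives sums over
compositions the recursion that defines `psi`. -/
theorem sum_composition_succ {V : Type*} [AddCommMonoid V] (n : ℕ) (F : List ℕ → V) :
    ∑ I : Composition (n + 1), F I.blocks =
      ∑ k ∈ Finset.range (n + 1), ∑ J : Composition (n - k), F ((k + 1) :: J.blocks) := by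
  rw [Finset.sum_range, ← Fintype.sum_sigma']
  symm
  refine Fintype.sum_bijective (fun p : (k : Fin (n + 1)) × Composition (n - k) =>
      (⟨(p.1 + 1) :: p.2.blocks, ?_, ?_⟩ : Composition (n + 1))) ⟨?_, ?_⟩ _ _ ?_
  · intro i hi
    rcases List.mem_cons.1 hi with rfl | hi
    · omega
    · exact p.2.blocks_pos hi
  · have := p.2.blocks_sum
    have := p.1.2
    simp only [List.sum_cons]; omega
  · rintro ⟨k, J⟩ ⟨k', J'⟩ h
    simp only [Composition.mk.injEq, List.cons.injEq, add_left_inj] at h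
    obtain rfl := Fin.ext h.1
    rw [Composition.ext h.2]
  · rintro ⟨blocks, hpos, hsum⟩
    cases blocks with
    | nil => simp at hsum
    | cons i l =>
      have hi : 0 < i := hpos (by simp)
      simp only [List.sum_cons] at hsum
      refine ⟨⟨⟨i - 1, by omega⟩, ⟨l, fun h => hpos (by simp [h]), by simp; omega⟩⟩, ?_⟩
      refine Composition.ext ?_
      change (i - 1 + 1) :: l = i :: l
      rw [Nat.sub_add_cancel hi]
  · intro p; rfl

theorem psi_eq_sum {op : X → X → X} {B : List X → X} (hB : ∀ a w, B (a :: w) = w.foldl op a)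
    (c : ℕ → ℂ) (w : List X) :
    psi op c w = ∑ I : Composition w.length,
      Finsupp.single ((w.splitWrtComposition I).map B) ((I.blocks.map c).prod) := by
  have key : ∀ n (w : List X), w.length = n → psi op c w = ∑ I : Composition n,
      Finsupp.single ((w.splitWrtCompositionAux I.blocks).map B) ((I.blocks.map c).prod) := by
    intro n
    induction n using Nat.strong_induction_on with
    | _ n ih =>
      intro w hw
      cases w with
      | nil =>
        obtain rfl : n = 0 := by simpa using hw.symm
        have h0 : ∀ I : Composition 0, I.blocks = [] := by
          intro I
          rcases h : I.blocks with _ | ⟨i, l⟩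
          · rfl
          · have h1 := I.blocks_sum
            have h2 : 0 < i := I.blocks_pos (by simp [h])
            simp only [h, List.sum_cons] at h1
            omega
        simp [psi_nil, h0, List.splitWrtCompositionAux, composition_card]
      | cons a w =>
        obtain rfl : n = w.length + 1 := by simpa using hw.symm
        rw [psi_cons, sum_composition_succ w.length fun l =>
          Finsupp.single (((a :: w).splitWrtCompositionAux l).map B) ((l.map c).prod)]
        refine Finset.sum_congr rfl fun k hk => ?_
        rw [ih (w.length - k) (by omega) (w.drop k) (by simp), map_sum, Finset.smul_sum]
        refine Finset.sum_congr rfl fun J _ => ?_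
        rw [consL_single, Finsupp.smul_single, List.splitWrtCompositionAux_cons]
        simp [hB]
  exact key _ w rfl

end Words

/-! ### Hoffman's exponential and logarithm as block maps. -/

section Hoffman

variable {X : Type*} [NonUnitalCommRing X] [Module ℂ X] [IsScalarTower ℂ X X]
  [SMulCommClass ℂ X X]

/-- The product `a • b = ε a b`. -/
def bullet (ε : ℂ) (a b : X) : X := ε • (a * b)

theorem bullet_assoc (ε : ℂ) (a b c : X) :
    bullet ε (bullet ε a b) c = bullet ε a (bullet ε b c) := by
  simp only [bullet, smul_mul_assoc, mul_smul_comm, mul_assoc]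

/-- One side nests to the right, the other to the left; `•` is associative. -/
theorem bulletProd_cons (ε : ℂ) (a : X) (w : List X) :
    bulletProd ε (a :: w) = w.foldl (bullet ε) a := by
  have h : ∀ (w : List X) (a b : X),
      w.foldl (bullet ε) (bullet ε a b) = bullet ε a (w.foldl (bullet ε) b) := by
    intro w
    induction w with
    | nil => intro a b; rfl
    | cons c w ih => intro a b; rw [List.foldl_cons, bullet_assoc, ih, List.foldl_cons]
  induction w generalizing a with
  | nil => rfl
  | cons b w ih => rw [bulletProd, ih, List.foldl_cons, h]; rfl

/-- The coefficients of `exp t - 1`. -/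
def expCoeff (i : ℕ) : ℂ := 1 / (i.factorial : ℂ)

/-- The coefficients of `log (1 + t)`. -/
def logCoeff (i : ℕ) : ℂ := (-1) ^ (i - 1) / (i : ℂ)

theorem hoffmanExp_eq_psi (ε : ℂ) (w : List X) :
    hoffmanExp ε w = psi (bullet ε) expCoeff w := by
  rw [psi_eq_sum (bulletProd_cons ε)]
  refine Finset.sum_congr rfl fun I _ => ?_
  rw [contract]
  congr 1
  induction I.blocks with
  | nil => simp
  | cons i l ih =>
    simp only [List.map_cons, List.prod_cons]
    rw [← ih, expCoeff]
    push_cast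
    ring

/-- The exponent `n - k` is the sum of `i - 1` over the blocks `i`, so the sign factors over the
blocks. Positivity of the blocks keeps the natural subtractions exact. -/
theorem hoffmanLog_eq_psi (ε : ℂ) (w : List X) :
    hoffmanLog ε w = psi (bullet ε) logCoeff w := by
  rw [psi_eq_sum (bulletProd_cons ε)]
  refine Finset.sum_congr rfl fun I _ => ?_
  rw [contract]
  congr 1
  have h : ∀ l : List ℕ, (∀ i ∈ l, 0 < i) →
      l.length ≤ l.sum ∧
        ((-1) ^ (l.sum - l.length) / (l.prod : ℂ) : ℂ) = (l.map logCoeff).prod := by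
    intro l
    induction l with
    | nil => simp
    | cons i l ih =>
      intro hl
      simp only [List.mem_cons, forall_eq_or_imp] at hl
      obtain ⟨h1, h2⟩ := ih hl.2
      refine ⟨by simp; omega, ?_⟩
      simp only [List.map_cons, List.prod_cons, List.sum_cons, List.length_cons]
      rw [← h2, logCoeff, show i + l.sum - (l.length + 1) = (i - 1) + (l.sum - l.length) by omega,
        pow_add]
      push_cast
      ring
  have := (h I.blocks fun i hi => I.blocks_pos hi).2
  rw [I.blocks_sum] at this
  exact this

end Hoffman

/-! ### Hoffman's isomorphism over a commutative monoid of letters -/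

/-- Only nonzero terms of `F` matter, and `hF` places them in both index regions. The bounds can
therefore be chosen generously. -/
theorem sum_antidiagonal_eq_sum_product {V : Type*} [AddCommMonoid V] (F : ℕ → ℕ → V)
    (n a b : ℕ) (hF : ∀ i j, ¬(i < a ∧ j < b ∧ i + j < n) → F i j = 0) :
    ∑ k ∈ Finset.range n, ∑ ij ∈ Finset.HasAntidiagonal.antidiagonal k, F ij.1 ij.2 =
      ∑ i ∈ Finset.range a, ∑ j ∈ Finset.range b, F i j := by
  classical
  rw [← Finset.sum_product', Finset.sum_sigma']
  refine Finset.sum_bij_ne_zero (fun p _ _ => p.2) ?_ ?_ ?_ fun _ _ _ => rfl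
  · intro p hp h
    by_contra hc
    simp only [Finset.mem_product, Finset.mem_range] at hc
    exact h (hF _ _ fun h' => hc ⟨h'.1, h'.2.1⟩)
  · rintro ⟨k, ij⟩ hp _ ⟨k', ij'⟩ hp' _ rfl
    simp only [Finset.mem_sigma, Finset.HasAntidiagonal.mem_antidiagonal] at hp hp'
    rw [← hp.2, ← hp'.2]
  · intro ij _ h
    refine ⟨⟨ij.1 + ij.2, ij⟩, ?_, h, rfl⟩
    simp only [Finset.mem_sigma, Finset.mem_range, Finset.HasAntidiagonal.mem_antidiagonal,
      and_true]
    by_contra hc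
    exact h (hF _ _ fun h' => hc h'.2.2)

/-- The two edges and the interior of the box will carry the three terms of the quasi-shuffle
recursion: a head block taken from the first word, from the second, or from both. -/
theorem sum_antidiagonal_eq_sum_box {V : Type*} [AddCommGroup V] (F : ℕ → ℕ → V) (a b : ℕ)
    (hF : ∀ i j, a < i ∨ b < j → F i j = 0) :
    ∑ k ∈ Finset.range (a + b), ∑ ij ∈ Finset.HasAntidiagonal.antidiagonal (k + 1), F ij.1 ij.2 =
      ∑ i ∈ Finset.range a, F (i + 1) 0 + ∑ j ∈ Finset.range b, F 0 (j + 1) +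
        ∑ i ∈ Finset.range a, ∑ j ∈ Finset.range b, F (i + 1) (j + 1) := by
  have h1 := sum_antidiagonal_eq_sum_product F (a + b + 1) (a + 1) (b + 1)
    fun i j h => hF i j (by omega)
  rw [Finset.sum_range_succ', Finset.sum_range_succ'] at h1
  simp only [Finset.sum_range_succ' _ b, Finset.sum_add_distrib] at h1
  simp only [Finset.HasAntidiagonal.antidiagonal_zero, Finset.sum_singleton] at h1
  rw [← add_assoc] at h1
  rw [add_right_cancel h1]
  abel

/-! ### Head blocks of words over a commutative monoid. -/

section Heads

variable {Y : Type*} [CommMonoid Y] {V : Type*} [AddCommGroup V]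

/-- Cut off the first `k` letters of a word and apply `G` to their product and to the rest. -/
def hd : ℕ → (Y → List Y → V) → List Y → V
  | 0, G, w => G 1 w
  | _ + 1, _, [] => 0
  | k + 1, G, a :: w => hd k (fun x => G (a * x)) w

theorem hd_eq (k : ℕ) (G : Y → List Y → V) (w : List Y) :
    hd k G w = if k ≤ w.length then G (w.take k).prod (w.drop k) else 0 := by
  induction k generalizing G w with
  | zero => simp [hd]
  | succ k ih =>
    cases w with
    | nil => simp [hd]
    | cons a w => simp [hd, ih]

theorem hd_of_length_lt {k : ℕ} {w : List Y} (h : w.length < k) (G : Y → List Y → V) :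
    hd k G w = 0 := by
  rw [hd_eq, if_neg (by omega)]

theorem hd_congr {k : ℕ} {w : List Y} {G G' : Y → List Y → V}
    (h : ∀ x u, u.length + k = w.length → G x u = G' x u) : hd k G w = hd k G' w := by
  rw [hd_eq, hd_eq]
  split_ifs with hk
  · exact h _ _ (by simp; omega)
  · rfl

theorem hd_hd (n m : ℕ) (G : Y → List Y → V) (w : List Y) :
    hd n (fun x u => hd m (fun y u' => G (x * y) u') u) w = hd (n + m) G w := by
  induction n generalizing G w with
  | zero => simp [hd]
  | succ n ih =>
    rw [show n + 1 + m = (n + m) + 1 by omega]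
    cases w with
    | nil => simp [hd]
    | cons a w =>
      simp only [hd, ← ih]
      simp only [mul_assoc]

theorem hd_sum {ι : Type*} (s : Finset ι) (k : ℕ) (G : ι → Y → List Y → V) (w : List Y) :
    hd k (fun x u => ∑ i ∈ s, G i x u) w = ∑ i ∈ s, hd k (G i) w := by
  simp only [hd_eq]
  split_ifs <;> simp

variable [Module ℂ V]

theorem hd_smul (k : ℕ) (c : ℂ) (G : Y → List Y → V) (w : List Y) :
    hd k (fun x u => c • G x u) w = c • hd k G w := by
  simp only [hd_eq]
  split_ifs <;> simp

theorem map_hd {V' : Type*} [AddCommGroup V'] [Module ℂ V'] (T : V →ₗ[ℂ] V') (k : ℕ)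
    (G : Y → List Y → V) (w : List Y) : T (hd k G w) = hd k (fun x u => T (G x u)) w := by
  simp only [hd_eq]
  split_ifs <;> simp

/-- The linear extension of `hd`. -/
def hdL (k : ℕ) (G : Y → (List Y →₀ ℂ) →ₗ[ℂ] V) : (List Y →₀ ℂ) →ₗ[ℂ] V :=
  Finsupp.linearCombination ℂ (hd k fun x u => G x (Finsupp.single u 1))

@[simp]
theorem hdL_single (k : ℕ) (G : Y → (List Y →₀ ℂ) →ₗ[ℂ] V) (w : List Y) :
    hdL k G (Finsupp.single w 1) = hd k (fun x u => G x (Finsupp.single u 1)) w := by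
  simp [hdL]

theorem hdL_zero (G : Y → (List Y →₀ ℂ) →ₗ[ℂ] V) (p : List Y →₀ ℂ) : hdL 0 G p = G 1 p := by
  induction p using Finsupp.induction_linear with
  | zero => simp
  | add p q hp hq => simp only [map_add, hp, hq]
  | single w x =>
    rw [← mul_one x, ← smul_eq_mul, ← Finsupp.smul_single, map_smul, map_smul, hdL_single]
    rfl

theorem hdL_succ_consL (k : ℕ) (G : Y → (List Y →₀ ℂ) →ₗ[ℂ] V) (a : Y) (p : List Y →₀ ℂ) :
    hdL (k + 1) G (consL a p) = hdL k (fun x => G (a * x)) p := by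
  induction p using Finsupp.induction_linear with
  | zero => simp
  | add p q hp hq => simp only [map_add, hp, hq]
  | single w x =>
    rw [← mul_one x, ← smul_eq_mul, ← Finsupp.smul_single, map_smul, map_smul, consL_single,
      map_smul, hdL_single, hdL_single]
    rfl

theorem foldl_mul (a : Y) (w : List Y) : w.foldl (· * ·) a = a * w.prod := by
  induction w generalizing a with
  | nil => simp
  | cons b w ih => simp [ih, mul_assoc]

/-- Heads longer than the word vanish, so any bound on the length may serve as the number of
summands. A bound common to several words is what makes the formula extend to linear combinations.
-/
theorem psi_eq_hd (c : ℕ → ℂ) (w : List Y) (n : ℕ) (hn : w.length ≤ n) :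
    psi (· * ·) c w = (if w = [] then Finsupp.single [] 1 else 0) +
      ∑ k ∈ Finset.range n, c (k + 1) •
        hd (k + 1) (fun x u => consL x (psi (· * ·) c u)) w := by
  cases w with
  | nil =>
    simp [psi_nil, hd]
  | cons a w =>
    rw [psi_cons, if_neg (by simp), zero_add]
    refine Finset.sum_subset_zero_on_sdiff (by simpa using hn) ?_ ?_
    · intro k hk
      simp only [Finset.mem_sdiff, Finset.mem_range] at hk
      rw [hd_of_length_lt (by simp; omega), smul_zero]
    · intro k hk
      rw [hd_eq, if_pos (by simpa using hk), foldl_mul]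
      simp

theorem psiL_eq_hdL (c : ℕ → ℂ) (p : List Y →₀ ℂ) (n : ℕ) (hn : ∀ w ∈ p.support, w.length ≤ n) :
    psiL (· * ·) c p = Finsupp.single [] (p []) +
      ∑ k ∈ Finset.range n, c (k + 1) •
        hdL (k + 1) (fun x => (consL x).comp (psiL (· * ·) c)) p := by
  classical
  have : ∀ (T : (List Y →₀ ℂ) →ₗ[ℂ] (List Y →₀ ℂ)), T p = p.sum fun w x => x • T (.single w 1) := by
    intro T
    conv_lhs => rw [← p.sum_single]
    rw [map_finsuppSum]
    refine Finsupp.sum_congr fun w _ => ?_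
    rw [← map_smul, Finsupp.smul_single, smul_eq_mul, mul_one]
  rw [this (psiL (· * ·) c)]
  simp only [this (hdL _ _)]
  have h2 : Finsupp.single [] (p []) =
      p.sum fun w x => x • (if w = [] then Finsupp.single ([] : List Y) (1 : ℂ) else 0) := by
    rw [Finsupp.sum, Finset.sum_eq_single []]
    · simp
    · intro w _ hw; simp [hw]
    · intro h
      simp at h
      simp [h]
  rw [h2]
  simp only [Finsupp.sum]
  simp only [Finset.smul_sum]
  rw [Finset.sum_comm, ← Finset.sum_add_distrib]
  refine Finset.sum_congr rfl fun w hw => ?_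
  rw [psiL_single, one_smul, psi_eq_hd c w n (hn w hw), smul_add, Finset.smul_sum]
  congr 1
  refine Finset.sum_congr rfl fun k _ => ?_
  rw [smul_comm, hdL_single]
  simp

/-- Cutting off the head of a shuffle product. -/
theorem hdL_shuffle (k : ℕ) (G : Y → (List Y →₀ ℂ) →ₗ[ℂ] V) (u w : List Y) :
    hdL k G (qsh (· * ·) 0 u w) = ∑ ij ∈ Finset.HasAntidiagonal.antidiagonal k, k.choose ij.1 •
      hd ij.1 (fun x u' => hd ij.2 (fun y w' => G (x * y) (qsh (· * ·) 0 u' w')) w) u := by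
  induction k generalizing G u w with
  | zero => simp [hdL_zero, hd]
  | succ k ih =>
    -- Pascal's rule: the first letter of the head comes from `u` or from `w`. Commutativity of the
    -- letters makes the head product independent of the interleaving.
    rw [Finset.sum_antidiagonal_choose_succ_nsmul (fun i j =>
      hd i (fun x u' => hd j (fun y w' => G (x * y) (qsh (· * ·) 0 u' w')) w) u) k]
    have hsymm : ∀ i j, i + j = k → k.choose j = k.choose i := by
      rintro i j rfl
      exact Nat.choose_symm_add.symm
    cases u with
    | nil =>
      cases w with
      | nil => simp [qsh_nil_left, hd, hd_eq]
      | cons b w =>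
        rw [qsh_nil_left, ← consL_single, hdL_succ_consL, ← qsh_nil_left (· * ·) 0, ih]
        simp only [hd, smul_zero, Finset.sum_const_zero, add_zero]
        refine Finset.sum_congr rfl fun ij _ => ?_
        simp only [mul_left_comm b]
    | cons a u =>
      cases w with
      | nil =>
        rw [qsh_nil_right, ← consL_single, hdL_succ_consL, ← qsh_nil_right (· * ·) 0, ih]
        simp only [hd, mul_assoc]
        have hz : ∀ ij : ℕ × ℕ, hd ij.1 (fun (_ : Y) (_ : List Y) => (0 : V)) (a :: u) = 0 := by
          intro ij
          rw [hd_eq]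
          simp
        simp only [hz, smul_zero, Finset.sum_const_zero, zero_add]
        refine Finset.sum_congr rfl fun ij hij => ?_
        rw [hsymm _ _ (Finset.HasAntidiagonal.mem_antidiagonal.1 hij)]
      | cons b w =>
        rw [qsh_cons_cons, zero_smul, add_zero, map_add, hdL_succ_consL, hdL_succ_consL, ih, ih,
          add_comm]
        congr 1
        · refine Finset.sum_congr rfl fun ij _ => ?_
          simp only [hd, mul_left_comm b]
        · refine Finset.sum_congr rfl fun ij hij => ?_
          rw [hsymm _ _ (Finset.HasAntidiagonal.mem_antidiagonal.1 hij)]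
          simp only [hd, mul_assoc]


end Heads

theorem length_of_mem_support_qsh {X : Type*} {op : X → X → X} {t : ℂ} {u w y : List X}
    (h : y ∈ (qsh op t u w).support) :
    y.length ≤ u.length + w.length ∧ u.length ≤ y.length ∧ w.length ≤ y.length := by
  classical
  induction u, w using qsh.induct generalizing y with
  | case1 w =>
    rw [qsh_nil_left] at h
    simp only [Finset.mem_singleton.1 (Finsupp.support_single_subset h)]
    simp
  | case2 a u =>
    rw [qsh_nil_right] at h
    simp only [Finset.mem_singleton.1 (Finsupp.support_single_subset h)]
    simp
  | case3 a u b w h1 h2 h3 =>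
    rw [qsh_cons_cons] at h
    rcases Finset.mem_union.1 (Finsupp.support_add h) with h | h
    · rcases Finset.mem_union.1 (Finsupp.support_add h) with h | h
      · obtain ⟨y', hy', rfl⟩ := mem_support_consL h
        have := h1 hy'
        simp only [List.length_cons] at this ⊢
        omega
      · obtain ⟨y', hy', rfl⟩ := mem_support_consL h
        have := h2 hy'
        simp only [List.length_cons] at this ⊢
        omega
    · obtain ⟨y', hy', rfl⟩ := mem_support_consL (Finsupp.support_smul h)
      have := h3 hy'
      simp only [List.length_cons] at this ⊢
      omega

/-! ### Multiplicativity of Hoffman's exponential. -/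

section Isomorphism

variable {Y : Type*} [CommMonoid Y]

/-- This identity singles out the exponential: the coefficient of a merged block absorbs the number
of interleavings of its two parts. -/
theorem expCoeff_mul_choose {i j k : ℕ} (h : i + j = k) :
    expCoeff k * (k.choose i : ℂ) = expCoeff i * expCoeff j := by
  subst h
  have h1 : ((i + j).choose i : ℂ) * i.factorial * j.factorial = (i + j).factorial := by
    rw [Nat.choose_symm_add]
    exact_mod_cast Nat.add_choose_mul_factorial_mul_factorial i j
  have h2 : (i.factorial : ℂ) ≠ 0 := by exact_mod_cast i.factorial_ne_zero
  have h3 : (j.factorial : ℂ) ≠ 0 := by exact_mod_cast j.factorial_ne_zero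
  have h4 : ((i + j).factorial : ℂ) ≠ 0 := by exact_mod_cast (i + j).factorial_ne_zero
  rw [expCoeff, expCoeff, expCoeff]
  field_simp
  linear_combination h1

/-- Hoffman's exponential maps the shuffle product to the quasi-shuffle product. -/
theorem psi_exp_qsh_zero_monoid (u w : List Y) :
    psiL (· * ·) expCoeff (qsh (· * ·) 0 u w) =
      qshL (· * ·) 1 (psi (· * ·) expCoeff u) (psi (· * ·) expCoeff w) := by
  induction hn : u.length + w.length using Nat.strong_induction_on generalizing u w with
  | _ n ih =>
    rcases eq_or_ne u [] with rfl | hu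
    · simp [qsh_nil_left, psi_nil, qshL_nil_left]
    rcases eq_or_ne w [] with rfl | hw
    · simp [qsh_nil_right, psi_nil, qshL_nil_right]
    have h0 : qsh (· * ·) 0 u w [] = 0 := by
      by_contra h
      have := (length_of_mem_support_qsh (Finsupp.mem_support_iff.2 h)).2.1
      simp at this
      exact hu this
    rw [psiL_eq_hdL _ _ (u.length + w.length) fun y hy => (length_of_mem_support_qsh hy).1, h0,
      Finsupp.single_zero, zero_add]
    -- `F i j` collects the words whose head block is made of `i` letters of `u` and `j` letters of
    -- `w`.
    set F : ℕ → ℕ → (List Y →₀ ℂ) := fun i j => (expCoeff i * expCoeff j) •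
      hd i (fun x u' => hd j (fun y w' => consL (x * y)
        (qshL (· * ·) 1 (psi (· * ·) expCoeff u') (psi (· * ·) expCoeff w'))) w) u with hF
    have hl : ∀ k ∈ Finset.range (u.length + w.length), expCoeff (k + 1) •
        hdL (k + 1) (fun x => (consL x).comp (psiL (· * ·) expCoeff)) (qsh (· * ·) 0 u w) =
        ∑ ij ∈ Finset.HasAntidiagonal.antidiagonal (k + 1), F ij.1 ij.2 := by
      intro k _
      rw [hdL_shuffle, Finset.smul_sum]
      refine Finset.sum_congr rfl fun ij hij => ?_
      have hij := Finset.HasAntidiagonal.mem_antidiagonal.1 hij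
      simp only [hF]
      rw [← expCoeff_mul_choose hij, ← Nat.cast_smul_eq_nsmul ℂ, smul_smul]
      congr 1
      refine hd_congr fun x u' hu' => hd_congr fun y w' hw' => ?_
      rw [LinearMap.comp_apply, ih _ _ u' w' rfl]
      omega
    rw [Finset.sum_congr rfl hl, sum_antidiagonal_eq_sum_box]
    · have hu' := psi_eq_hd expCoeff u u.length le_rfl
      have hw' := psi_eq_hd expCoeff w w.length le_rfl
      rw [if_neg hu, zero_add] at hu'
      rw [if_neg hw, zero_add] at hw'
      -- On the edges of the box one word contributes no letter to the head block; its factor must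
      -- then be `1`.
      have e0 : expCoeff 0 = 1 := by simp [expCoeff]
      have hr : ∀ i j, qshL (· * ·) 1
          (hd (i + 1) (fun x u' => consL x (psi (· * ·) expCoeff u')) u)
          (hd (j + 1) (fun y w' => consL y (psi (· * ·) expCoeff w')) w) =
          hd (i + 1) (fun x u' => consL x (qshL (· * ·) 1 (psi (· * ·) expCoeff u')
            (hd (j + 1) (fun y w' => consL y (psi (· * ·) expCoeff w')) w))) u +
          hd (j + 1) (fun y w' => consL y (qshL (· * ·) 1
            (hd (i + 1) (fun x u' => consL x (psi (· * ·) expCoeff u')) u)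
            (psi (· * ·) expCoeff w'))) w +
          hd (i + 1) (fun x u' => hd (j + 1) (fun y w' => consL (x * y)
            (qshL (· * ·) 1 (psi (· * ·) expCoeff u') (psi (· * ·) expCoeff w'))) w) u := by
        intro i j
        simp only [hd_eq]
        split_ifs <;> simp [qshL_cons_cons]
      conv_rhs => rw [hu', hw']
      simp only [map_sum, LinearMap.sum_apply, map_smul, LinearMap.smul_apply, hr, smul_add,
        Finset.smul_sum, Finset.sum_add_distrib]
      congr 1
      · congr 1
        · conv_rhs => rw [Finset.sum_comm]
          refine Finset.sum_congr rfl fun i _ => ?_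
          rw [hF]
          simp only [hd, e0, mul_one]
          conv_lhs => rw [hw']
          simp only [map_sum, map_smul, hd_sum, hd_smul, Finset.smul_sum]
          refine Finset.sum_congr rfl fun j _ => ?_
          rw [smul_comm]
        · refine Finset.sum_congr rfl fun j _ => ?_
          rw [hF]
          simp only [hd, e0, one_mul]
          conv_lhs => rw [hu']
          simp only [map_sum, map_smul, LinearMap.sum_apply, LinearMap.smul_apply, hd_sum, hd_smul,
            Finset.smul_sum]
      · rw [Finset.sum_comm]
        refine Finset.sum_congr rfl fun j _ => Finset.sum_congr rfl fun i _ => ?_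
        rw [hF, smul_smul, mul_comm (expCoeff (j + 1))]
    · intro i j hij
      rw [hF]
      rcases hij with h | h
      · simp only [hd_of_length_lt h, smul_zero]
      · simp only [hd_of_length_lt h]
        rw [hd_eq]
        simp

end Isomorphism

/-! ### Composition of block maps and substitution of power series. -/

section Composition

variable {Y : Type*} [CommMonoid Y]

open PowerSeries in
theorem coeff_pow_of_lt {g : PowerSeries ℂ} (h0 : constantCoeff g = 0) {m n : ℕ} (h : m < n) :
    coeff m (g ^ n) = 0 :=
  PowerSeries.X_pow_dvd_iff.1 (pow_dvd_pow_of_dvd (PowerSeries.X_dvd_iff.2 h0) n) m h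

/-- The head consists of `k` consecutive blocks of total length `n`. Summing the products of their
coefficients over all such lengths gives the coefficient of `X ^ n` in `g ^ k`. -/
theorem hdL_psi {V : Type*} [AddCommGroup V] [Module ℂ V] {g : PowerSeries ℂ}
    (h0 : PowerSeries.constantCoeff g = 0) {c : ℕ → ℂ}
    (hc : ∀ i, c (i + 1) = PowerSeries.coeff (i + 1) g) (k : ℕ)
    (G : Y → (List Y →₀ ℂ) →ₗ[ℂ] V) (w : List Y) (N : ℕ) (hN : w.length < N) :
    hdL k G (psi (· * ·) c w) = ∑ n ∈ Finset.range N,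
      PowerSeries.coeff n (g ^ k) • hd n (fun x u => G x (psi (· * ·) c u)) w := by
  induction k generalizing G w with
  | zero =>
    rw [hdL_zero, Finset.sum_eq_single 0]
    · simp [hd]
    · intro n _ hn
      simp [PowerSeries.coeff_one, hn]
    · intro h
      simp at h
      omega
  | succ k ih =>
    rcases eq_or_ne w [] with rfl | hw
    · rw [psi_nil, hdL_single, hd, Finset.sum_eq_zero]
      intro n _
      rcases n with _ | n
      · rw [coeff_pow_of_lt h0 (Nat.succ_pos k), zero_smul]
      · rw [hd, smul_zero]
    · rw [psi_eq_hd c w N hN.le, if_neg hw, zero_add, map_sum]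
      have h1 : ∀ i, hdL (k + 1) G
          (c (i + 1) • hd (i + 1) (fun x u => consL x (psi (· * ·) c u)) w) =
          ∑ m ∈ Finset.range N, (PowerSeries.coeff (i + 1) g * PowerSeries.coeff m (g ^ k)) •
            hd (i + 1 + m) (fun x u => G x (psi (· * ·) c u)) w := by
        intro i
        rw [map_smul, map_hd, hc]
        simp only [hdL_succ_consL]
        rw [hd_congr (G' := fun x u => ∑ m ∈ Finset.range N, PowerSeries.coeff m (g ^ k) •
            hd m (fun y u' => G (x * y) (psi (· * ·) c u')) u) fun x u hu =>
              ih (fun y => G (x * y)) u (by omega), hd_sum, Finset.smul_sum]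
        refine Finset.sum_congr rfl fun m _ => ?_
        rw [hd_smul, smul_smul, hd_hd _ _ (fun x u => G x (psi (· * ·) c u))]
      rw [Finset.sum_congr rfl fun i _ => h1 i]
      -- The range `N + 1` includes the index `i = 0`, whose term vanishes because `g` has no
      -- constant term.
      have h2 := sum_antidiagonal_eq_sum_product (fun i m =>
        (PowerSeries.coeff i g * PowerSeries.coeff m (g ^ k)) •
            hd (i + m) (fun x u => G x (psi (· * ·) c u)) w) N (N + 1) N ?_
      · rw [Finset.sum_range_succ' _ N] at h2
        simp only [PowerSeries.coeff_zero_eq_constantCoeff_apply, h0, zero_mul, zero_smul,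
          Finset.sum_const_zero, add_zero] at h2
        rw [← h2]
        refine Finset.sum_congr rfl fun n _ => ?_
        rw [pow_succ', PowerSeries.coeff_mul, Finset.sum_smul]
        refine Finset.sum_congr rfl fun ij hij => ?_
        rw [Finset.HasAntidiagonal.mem_antidiagonal.1 hij]
      · intro i j h
        rw [hd_of_length_lt (by omega), smul_zero]

/-- Merging `k` blocks with weight `f k` replaces the block series by `∑ f k * g ^ k`. If this
series is `X`, only heads of one letter survive, and the tail is handled by induction. Truncated
sums suffice in `hf`, since `g ^ k` has no terms below degree `k`. -/
theorem psi_comp_eq_single {g : PowerSeries ℂ} (h0 : PowerSeries.constantCoeff g = 0)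
    {c f : ℕ → ℂ} (hc : ∀ i, c (i + 1) = PowerSeries.coeff (i + 1) g)
    (hf : ∀ N n, 0 < n → n ≤ N → ∑ k ∈ Finset.range N,
      f (k + 1) * PowerSeries.coeff n (g ^ (k + 1)) = if n = 1 then 1 else 0) (w : List Y) :
    psiL (· * ·) f (psi (· * ·) c w) = Finsupp.single w 1 := by
  induction hn : w.length using Nat.strong_induction_on generalizing w with
  | _ n ih =>
    cases w with
    | nil => simp [psi_nil]
    | cons a w =>
      have hnil : psi (· * ·) c (a :: w) [] = 0 := by
        by_contra h
        generalize hy : ([] : List Y) = y at h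
        have : ∀ {v y : List Y}, Coarse (· * ·) v y → v ≠ [] → y ≠ [] := by
          intro v y h
          induction h with
          | nil => simp
          | cons => simp
          | merge a b h ih => intro _; exact ih (by simp)
        exact this (coarse_of_mem_support_psi (Finsupp.mem_support_iff.2 h)) (by simp) hy.symm
      rw [psiL_eq_hdL f _ n fun y hy => hn ▸ (coarse_of_mem_support_psi hy).length_le, hnil,
        Finsupp.single_zero, zero_add]
      have h1 : ∀ k ∈ Finset.range n, f (k + 1) • hdL (k + 1)
          (fun x => (consL x).comp (psiL (· * ·) f)) (psi (· * ·) c (a :: w)) =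
          ∑ m ∈ Finset.range (n + 1), (f (k + 1) * PowerSeries.coeff m (g ^ (k + 1))) •
            hd m (fun x u => consL x (psiL (· * ·) f (psi (· * ·) c u))) (a :: w) := by
        intro k _
        rw [hdL_psi h0 hc _ _ _ (n + 1) (by omega), Finset.smul_sum]
        refine Finset.sum_congr rfl fun m _ => ?_
        rw [smul_smul]
        rfl
      rw [Finset.sum_congr rfl h1, Finset.sum_comm]
      simp only [← Finset.sum_smul]
      simp only [List.length_cons] at hn
      rw [Finset.sum_eq_single 1]
      · rw [hf n 1 one_pos (by omega), if_pos rfl, one_smul, hd, hd, ih _ (by omega) w rfl]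
        simp
      · intro m hm hm1
        rcases Nat.eq_zero_or_pos m with rfl | hm0
        · rw [Finset.sum_eq_zero, zero_smul]
          intro k _
          rw [coeff_pow_of_lt h0 (Nat.succ_pos k), mul_zero]
        · rw [hf n m hm0 (by simp at hm; omega), if_neg hm1, zero_smul]
      · intro h
        simp at h
        omega

/-- Since `E' = 1 + E`, the derivative of the truncated logarithm of `1 + E` is a finite geometric
sum, equal to `1 - (-E) ^ N`, and `E ^ N` starts in degree `N`. -/
theorem sum_logCoeff_mul_coeff (N n : ℕ) (hn : 0 < n) (hnN : n ≤ N) :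
    ∑ k ∈ Finset.range N, logCoeff (k + 1) *
      PowerSeries.coeff n ((PowerSeries.exp ℂ - 1) ^ (k + 1)) = if n = 1 then 1 else 0 := by
  set E : PowerSeries ℂ := PowerSeries.exp ℂ - 1 with hE
  have hE0 : PowerSeries.constantCoeff E = 0 := by simp [hE]
  have hdE : PowerSeries.derivative ℂ E = 1 + E := by
    rw [hE, map_sub, PowerSeries.derivative_exp, PowerSeries.derivative_one]; ring
  set P : PowerSeries ℂ := ∑ k ∈ Finset.range N, logCoeff (k + 1) • E ^ (k + 1) with hP
  have hcoef : ∑ k ∈ Finset.range N, logCoeff (k + 1) * PowerSeries.coeff n (E ^ (k + 1)) =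
      PowerSeries.coeff n P := by
    rw [hP, map_sum]; rfl
  have hdP : PowerSeries.derivative ℂ P = 1 - (-E) ^ N := by
    rw [← geom_sum_mul_neg, sub_neg_eq_add, hP, map_sum, Finset.sum_mul]
    refine Finset.sum_congr rfl fun k _ => ?_
    rw [Derivation.map_smul, PowerSeries.derivative_pow, hdE, neg_pow E, logCoeff]
    have : ((k : ℂ) + 1) ≠ 0 := by exact_mod_cast k.succ_ne_zero
    rw [PowerSeries.smul_eq_C_mul]
    simp only [Nat.add_sub_cancel]
    have h2 : PowerSeries.C ((-1) ^ k / ((k + 1 : ℕ) : ℂ)) * (((k + 1 : ℕ) : PowerSeries ℂ)) =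
        (-1) ^ k := by
      rw [← map_natCast (PowerSeries.C (R := ℂ)), ← map_mul]
      push_cast
      rw [div_mul_cancel₀ _ this]
      simp
    linear_combination E ^ k * (1 + E) * h2
  obtain ⟨m, rfl⟩ : ∃ m, n = m + 1 := ⟨n - 1, by omega⟩
  have := congrArg (PowerSeries.coeff m) hdP
  rw [PowerSeries.coeff_derivative, map_sub, coeff_pow_of_lt (by simp [hE0]) (by omega),
    PowerSeries.coeff_one, sub_zero] at this
  have hm : ((m : ℂ) + 1) ≠ 0 := by exact_mod_cast m.succ_ne_zero
  rw [hcoef, eq_div_of_mul_eq hm this]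
  rcases Nat.eq_zero_or_pos m with rfl | h
  · simp
  · rw [if_neg (by omega), if_neg (by omega), zero_div]

/-- Below degree `N`, the truncated exponential `P` of `log (1 + X)` satisfies `(1 + X) P' = 1 + P`.
The resulting recursion has `P₁ = 1` and multiplies by `1 - m` in passing from degree `m` to `m + 1`
for `m ≥ 1`, so everything after degree `1` is killed at `m = 1`. -/
theorem sum_expCoeff_mul_coeff (N n : ℕ) (hn : 0 < n) (hnN : n ≤ N) :
    ∑ k ∈ Finset.range N, expCoeff (k + 1) *
      PowerSeries.coeff n ((PowerSeries.log ℂ) ^ (k + 1)) = if n = 1 then 1 else 0 := by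
  set E : PowerSeries ℂ := PowerSeries.log ℂ with hE
  have hE0 : PowerSeries.constantCoeff E = 0 := by simp [hE]
  have hdE : (1 + PowerSeries.X) * PowerSeries.derivative ℂ E = 1 := by
    rw [hE, PowerSeries.deriv_log]
    ext m
    rw [add_mul, one_mul, map_add, PowerSeries.coeff_mk, PowerSeries.coeff_one]
    rcases m with _ | m
    · simp
    · rw [PowerSeries.coeff_succ_X_mul, PowerSeries.coeff_mk]
      simp [pow_succ]
  set P : PowerSeries ℂ := ∑ k ∈ Finset.range N, expCoeff (k + 1) • E ^ (k + 1) with hP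
  have hcoef : ∀ n, ∑ k ∈ Finset.range N, expCoeff (k + 1) * PowerSeries.coeff n (E ^ (k + 1)) =
      PowerSeries.coeff n P := by
    intro n
    rw [hP, map_sum]; rfl
  have hdP : (1 + PowerSeries.X) * PowerSeries.derivative ℂ P = 1 + P - expCoeff N • E ^ N := by
    have h1 : 1 + P - expCoeff N • E ^ N = ∑ k ∈ Finset.range N, expCoeff k • E ^ k := by
      have h2 := Finset.sum_range_succ (fun k => expCoeff k • E ^ k) N
      rw [Finset.sum_range_succ'] at h2
      rw [sub_eq_iff_eq_add, ← h2, hP, add_comm]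
      simp [expCoeff]
    rw [h1, hP, map_sum, Finset.mul_sum]
    refine Finset.sum_congr rfl fun k _ => ?_
    rw [Derivation.map_smul, PowerSeries.derivative_pow]
    simp only [Nat.add_sub_cancel]
    have h2 : expCoeff k = expCoeff (k + 1) * ((k + 1 : ℕ) : ℂ) := by
      have h3 : ((k : ℂ) + 1) ≠ 0 := by exact_mod_cast k.succ_ne_zero
      rw [expCoeff, expCoeff, Nat.factorial_succ]
      push_cast
      field_simp
    rw [h2, PowerSeries.smul_eq_C_mul, PowerSeries.smul_eq_C_mul, map_mul, map_natCast]
    linear_combination (PowerSeries.C (expCoeff (k + 1)) * ((k + 1 : ℕ) : PowerSeries ℂ) * E ^ k) *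
      hdE
  have hrec : ∀ m, m < N → PowerSeries.coeff (m + 1) P * (m + 1) =
      (if m = 0 then 1 else 0) + (1 - m) * PowerSeries.coeff m P := by
    intro m hm
    have := congrArg (PowerSeries.coeff m) hdP
    rw [add_mul, one_mul, map_sub, map_add, map_add, map_smul, coeff_pow_of_lt hE0 hm,
      PowerSeries.coeff_one, smul_zero, sub_zero, PowerSeries.coeff_derivative] at this
    rcases m with _ | m
    · simpa using this
    · rw [PowerSeries.coeff_succ_X_mul, PowerSeries.coeff_derivative] at this
      push_cast at this ⊢
      linear_combination this
  have hP0 : PowerSeries.coeff 0 P = 0 := by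
    simp [hP, hE0]
  rw [hcoef]
  clear hcoef hdP
  induction n, hn using Nat.le_induction with
  | base =>
    have := hrec 0 (by omega)
    simpa [hP0] using this
  | succ m hm ih =>
    have := hrec m (by omega)
    rw [ih (by omega), if_neg (by omega)] at this
    have hm' : ((m : ℂ) + 1) ≠ 0 := by exact_mod_cast m.succ_ne_zero
    rw [eq_div_of_mul_eq hm' this]
    rcases eq_or_ne m 1 with rfl | h1
    · simp
    · rw [if_neg h1, if_neg (by omega)]; simp

theorem psi_log_exp_monoid (w : List Y) :
    psiL (· * ·) logCoeff (psi (· * ·) expCoeff w) = Finsupp.single w 1 :=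
  psi_comp_eq_single (g := PowerSeries.exp ℂ - 1) (by simp)
    (fun i => by simp [expCoeff, PowerSeries.coeff_exp, PowerSeries.coeff_one])
    sum_logCoeff_mul_coeff w

theorem psi_exp_log_monoid (w : List Y) :
    psiL (· * ·) expCoeff (psi (· * ·) logCoeff w) = Finsupp.single w 1 :=
  psi_comp_eq_single (g := PowerSeries.log ℂ) (by simp)
    (fun i => by simp [logCoeff, PowerSeries.coeff_log, pow_succ])
    sum_expCoeff_mul_coeff w

end Composition

/-! ### From monoids to algebras with the product `•`. -/

section Transfer

variable {X : Type*} [NonUnitalCommRing X] [Module ℂ X] [IsScalarTower ℂ X X]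
  [SMulCommClass ℂ X X]

/-- The embedding of `(X, •)` into a commutative monoid. -/
def toMonoid (ε : ℂ) (x : X) : WithOne X := ((ε • x : X) : WithOne X)

/-- Both sides are `ε ^ 2 • (a * b)`, which is why the embedding rescales by `ε`. The adjoined unit
serves as the product of an empty head. -/
theorem toMonoid_bullet (ε : ℂ) (a b : X) :
    toMonoid ε (bullet ε a b) = toMonoid ε a * toMonoid ε b := by
  rw [toMonoid, toMonoid, toMonoid, ← WithOne.coe_mul, bullet, smul_mul_smul_comm, smul_smul]

omit [IsScalarTower ℂ X X] [SMulCommClass ℂ X X] in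
theorem toMonoid_injective {ε : ℂ} (hε : ε ≠ 0) : Function.Injective (toMonoid (X := X) ε) :=
  fun _ _ h => smul_right_injective X hε (WithOne.coe_injective h)

variable {ε : ℂ} (hε : ε ≠ 0)
include hε

theorem psi_exp_log (w : List X) :
    psiL (bullet ε) expCoeff (psi (bullet ε) logCoeff w) = Finsupp.single w 1 := by
  apply mapL_injective (toMonoid_injective hε)
  rw [mapL_psiL (toMonoid_bullet ε), mapL_psi (toMonoid_bullet ε), mapL_single]
  exact psi_exp_log_monoid _

theorem psi_log_exp (w : List X) :
    psiL (bullet ε) logCoeff (psi (bullet ε) expCoeff w) = Finsupp.single w 1 := by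
  apply mapL_injective (toMonoid_injective hε)
  rw [mapL_psiL (toMonoid_bullet ε), mapL_psi (toMonoid_bullet ε), mapL_single]
  exact psi_log_exp_monoid _

/-- Hoffman's exponential maps the shuffle product to the quasi-shuffle product. -/
theorem psiL_exp_qshL (p q : List X →₀ ℂ) :
    psiL (bullet ε) expCoeff (qshL (bullet ε) 0 p q) =
      qshL (bullet ε) 1 (psiL (bullet ε) expCoeff p) (psiL (bullet ε) expCoeff q) := by
  induction p using Finsupp.induction_linear with
  | zero => simp
  | add p p' hp hp' => simp only [map_add, LinearMap.add_apply, hp, hp']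
  | single u x =>
    induction q using Finsupp.induction_linear with
    | zero => simp
    | add q q' hq hq' => simp only [map_add, hq, hq']
    | single w y =>
      simp only [qshL_single, psiL_single, map_smul, LinearMap.smul_apply, smul_smul]
      rw [mul_comm x y]
      congr 1
      apply mapL_injective (toMonoid_injective hε)
      rw [mapL_psiL (toMonoid_bullet ε), mapL_qsh (Or.inl rfl),
        mapL_qshL (Or.inr (toMonoid_bullet ε)), mapL_psi (toMonoid_bullet ε),
        mapL_psi (toMonoid_bullet ε)]
      exact psi_exp_qsh_zero_monoid _ _

/-- Hoffman's logarithm maps the quasi-shuffle product to the shuffle product. -/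
theorem psiL_log_qsh (u w : List X) :
    psiL (bullet ε) logCoeff (qsh (bullet ε) 1 u w) =
      qshL (bullet ε) 0 (psi (bullet ε) logCoeff u) (psi (bullet ε) logCoeff w) := by
  have h1 : ∀ p : List X →₀ ℂ,
      psiL (bullet ε) logCoeff (psiL (bullet ε) expCoeff p) = p := by
    intro p
    induction p using Finsupp.induction_linear with
    | zero => simp
    | add p q hp hq => simp only [map_add, hp, hq]
    | single w x => rw [psiL_single, map_smul, psi_log_exp hε]; simp
  have h2 : qsh (bullet ε) 1 u w =
      qshL (bullet ε) 1 (Finsupp.single u 1) (Finsupp.single w 1) := by simp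
  -- Writing `u` and `w` as exponentials of their logarithms reduces the claim to the
  -- multiplicativity of `exp`.
  rw [h2, ← psi_exp_log hε u, ← psi_exp_log hε w, ← psiL_exp_qshL hε, h1]

end Transfer

/-! ### Deconcatenation -/

section Cuts

variable {X V : Type*} [AddCommGroup V]

/-- The sum of `G w' w''` over all cuts `w = w' w''`. -/
def cutSum (G : List X → List X → V) (w : List X) : V :=
  ∑ i ∈ Finset.range (w.length + 1), G (w.take i) (w.drop i)

@[simp]
theorem cutSum_nil (G : List X → List X → V) : cutSum G [] = G [] [] := by
  simp [cutSum]

theorem cutSum_cons (G : List X → List X → V) (a : X) (w : List X) :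
    cutSum G (a :: w) = G [] (a :: w) + cutSum (fun u v => G (a :: u) v) w := by
  rw [cutSum, List.length_cons, Finset.sum_range_succ', add_comm]
  rfl

theorem cutSum_add (G G' : List X → List X → V) (w : List X) :
    cutSum (fun u v => G u v + G' u v) w = cutSum G w + cutSum G' w := by
  simp [cutSum, Finset.sum_add_distrib]

variable [Module ℂ V]

theorem cutSum_smul (c : ℂ) (G : List X → List X → V) (w : List X) :
    cutSum (fun u v => c • G u v) w = c • cutSum G w := by
  simp [cutSum, Finset.smul_sum]

/-- The linear extension of a map defined on words. -/
def ev (ρ : List X → V) : (List X →₀ ℂ) →ₗ[ℂ] V := Finsupp.linearCombination ℂ ρ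

@[simp]
theorem ev_single (ρ : List X → V) (w : List X) (x : ℂ) :
    ev ρ (Finsupp.single w x) = x • ρ w := by
  simp [ev]

theorem ev_consL (ρ : List X → V) (a : X) (p : List X →₀ ℂ) :
    ev ρ (consL a p) = ev (fun w => ρ (a :: w)) p := by
  induction p using Finsupp.induction_linear with
  | zero => simp
  | add p q hp hq => simp only [map_add, hp, hq]
  | single w x => simp

theorem ev_mapL {X' : Type*} (ρ : List X' → V) (φ : X → X') (p : List X →₀ ℂ) :
    ev ρ (mapL φ p) = ev (fun w => ρ (w.map φ)) p := by
  induction p using Finsupp.induction_linear with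
  | zero => simp
  | add p q hp hq => simp only [map_add, hp, hq]
  | single w x => simp

theorem ev_eq_sum (ρ : List X → V) (p : List X →₀ ℂ) :
    ev ρ p = ∑ w ∈ p.support, p w • ρ w := rfl

theorem ev_add_fun (ρ ρ' : List X → V) (p : List X →₀ ℂ) :
    ev (fun w => ρ w + ρ' w) p = ev ρ p + ev ρ' p := by
  simp [ev_eq_sum, Finset.sum_add_distrib]

/-- The bilinear extension of a map defined on pairs of words. -/
def ev₂ (G : List X → List X → V) (p q : List X →₀ ℂ) : V := ev (fun y => ev (G y) q) p

theorem ev₂_consL (G : List X → List X → V) (a : X) (p q : List X →₀ ℂ) :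
    ev₂ G (consL a p) q = ev₂ (fun y => G (a :: y)) p q := by
  rw [ev₂, ev_consL]; rfl

theorem ev_cutSum_consL (G : List X → List X → V) (a : X) (p : List X →₀ ℂ) :
    ev (cutSum G) (consL a p) =
      ev (G []) (consL a p) + ev (cutSum fun y => G (a :: y)) p := by
  simp only [ev_consL, cutSum_cons, ev_add_fun]

/-- Deconcatenation is compatible with the quasi-shuffle product. -/
theorem ev_cutSum_qsh (op : X → X → X) (t : ℂ) (u w : List X) (G : List X → List X → V) :
    ev (cutSum G) (qsh op t u w) = cutSum (fun u₁ u₂ => cutSum (fun w₁ w₂ =>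
      ev₂ G (qsh op t u₁ w₁) (qsh op t u₂ w₂)) w) u := by
  induction u, w using qsh.induct generalizing G with
  | case1 w => simp [qsh_nil_left, ev₂]
  | case2 a u => simp [qsh_nil_right, ev₂]
  | case3 a u b w h1 h2 h3 =>
    have hl : ev (cutSum G) (qsh op t (a :: u) (b :: w)) =
        ev (G []) (qsh op t (a :: u) (b :: w)) +
          (ev (cutSum fun y => G (a :: y)) (qsh op t u (b :: w)) +
            ev (cutSum fun y => G (b :: y)) (qsh op t (a :: u) w) +
            t • ev (cutSum fun y => G (op a b :: y)) (qsh op t u w)) := by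
      simp only [qsh_cons_cons, map_add, map_smul, ev_cutSum_consL, smul_add]
      abel
    rw [hl, h1, h2, h3]
    have e : ∀ (u₁ w₁ : List X) (q : List X →₀ ℂ), ev₂ G (qsh op t (a :: u₁) (b :: w₁)) q =
        ev₂ (fun y => G (a :: y)) (qsh op t u₁ (b :: w₁)) q +
          ev₂ (fun y => G (b :: y)) (qsh op t (a :: u₁) w₁) q +
          t • ev₂ (fun y => G (op a b :: y)) (qsh op t u₁ w₁) q := by
      intro u₁ w₁ q
      simp only [← ev₂_consL, qsh_cons_cons]
      simp [ev₂]
    simp only [cutSum_cons _ a, cutSum_cons _ b, e, cutSum_add, cutSum_smul, qsh_nil_left,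
      qsh_nil_right]
    simp only [ev₂, ev_single, one_smul]
    abel

end Cuts

/-! ### Truncated nested sums are characters -/

theorem truncSum_cons_zero (κ : Nesting) (f : ℝ → ℂ) (w : List (ℝ → ℂ)) :
    truncSum κ (f :: w) 0 = 0 := by
  simp [truncSum]

theorem truncSum_cons_succ (κ : Nesting) (f : ℝ → ℂ) (w : List (ℝ → ℂ)) (N : ℕ) :
    truncSum κ (f :: w) (N + 1) = truncSum κ (f :: w) N +
      f ((N + 1 : ℕ) : ℝ) * truncSum κ w (κ.innerBound (N + 1)) := by
  rw [truncSum, Finset.sum_Icc_succ_top (by omega), truncSum]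

/-- The increment of a product in `N` obeys a discrete Leibniz rule corrected by the product of the
two increments. The correction is added when the other factor is taken at `N` (strict) and
subtracted when it is taken at `N + 1` (weak); this is the sign of `•`. -/
theorem truncSum_mul (κ : Nesting) (u w : List (ℝ → ℂ)) (N : ℕ) :
    ev (fun y => truncSum κ y N) (qsh (bullet κ.sign) 1 u w) =
      truncSum κ u N * truncSum κ w N := by
  induction u, w using qsh.induct generalizing N with
  | case1 w => simp [qsh_nil_left, truncSum]
  | case2 a u => simp [qsh_nil_right, truncSum]
  | case3 a u b w h1 h2 h3 =>
    induction N with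
    | zero =>
      simp only [qsh_cons_cons, map_add, map_smul, ev_consL, truncSum_cons_zero]
      simp [ev_eq_sum]
    | succ N ih =>
      have hc : ∀ (c : ℝ → ℂ) (p : List (ℝ → ℂ) →₀ ℂ),
          ev (fun y => truncSum κ y (N + 1)) (consL c p) =
          ev (fun y => truncSum κ y N) (consL c p) + c ((N + 1 : ℕ) : ℝ) *
            ev (fun y => truncSum κ y (κ.innerBound (N + 1))) p := by
        intro c p
        simp only [ev_consL, truncSum_cons_succ, ev_add_fun]
        congr 1
        simp only [ev_eq_sum, Finset.mul_sum, smul_eq_mul]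
        exact Finset.sum_congr rfl fun _ _ => by ring
      have hl : ev (fun y => truncSum κ y (N + 1)) (qsh (bullet κ.sign) 1 (a :: u) (b :: w)) =
          ev (fun y => truncSum κ y N) (qsh (bullet κ.sign) 1 (a :: u) (b :: w)) +
          (a ((N + 1 : ℕ) : ℝ) * (truncSum κ u (κ.innerBound (N + 1)) *
            truncSum κ (b :: w) (κ.innerBound (N + 1))) +
          b ((N + 1 : ℕ) : ℝ) * (truncSum κ (a :: u) (κ.innerBound (N + 1)) *
            truncSum κ w (κ.innerBound (N + 1))) +
          κ.sign * (a ((N + 1 : ℕ) : ℝ) * b ((N + 1 : ℕ) : ℝ)) *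
            (truncSum κ u (κ.innerBound (N + 1)) * truncSum κ w (κ.innerBound (N + 1)))) := by
        rw [← h1, ← h2, ← h3, qsh_cons_cons]
        simp only [map_add, hc, one_smul]
        have : bullet κ.sign a b ((N + 1 : ℕ) : ℝ) =
          κ.sign * (a ((N + 1 : ℕ) : ℝ) * b ((N + 1 : ℕ) : ℝ)) := rfl
        rw [this]
        ring
      rw [hl, ih]
      cases κ with
      | strict =>
        simp only [truncSum_cons_succ, Nesting.sign, Nesting.innerBound, Nat.add_sub_cancel]
        ring
      | weak =>
        simp only [truncSum_cons_succ, Nesting.sign, Nesting.innerBound]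
        ring

/-! ### Birkhoff factorisation of characters -/

/-- The defect of multiplicativity of `Φp` on `(u, w)` equals that of `Φm`, once `Φm` is known to be
multiplicative on shorter pairs. This common defect lies in `Ap` and in `Am`, so it vanishes. Both
multiplicativities must be proved together for the induction to run. -/
theorem birkhoff_mul {X K : Type*} [CommRing K] [Module ℂ K] [IsScalarTower ℂ K K]
    [SMulCommClass ℂ K K] {Ap Am : Submodule ℂ K} (hAp : ∀ a ∈ Ap, ∀ b ∈ Ap, a * b ∈ Ap)
    (hAm : ∀ a ∈ Am, ∀ b ∈ Am, a * b ∈ Am) (hdisj : ∀ a ∈ Ap, a ∈ Am → a = 0)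
    {Φ Φm Φp : List X → K} (h1 : Φ [] = 1) (hm1 : Φm [] = 1)
    (hcut : ∀ w, Φp w = cutSum (fun u v => Φm u * Φ v) w) (hp : ∀ w, Φp w ∈ Ap)
    (hm : ∀ w, w ≠ [] → Φm w ∈ Am) {op : X → X → X} {t : ℂ}
    (hΦ : ∀ u w, ev Φ (qsh op t u w) = Φ u * Φ w) (u w : List X) :
    ev Φp (qsh op t u w) = Φp u * Φp w := by
  have hp1 : Φp [] = 1 := by simp [hcut, h1, hm1]
  suffices h : ev Φp (qsh op t u w) = Φp u * Φp w ∧ ev Φm (qsh op t u w) = Φm u * Φm w from h.1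
  induction hn : u.length + w.length using Nat.strong_induction_on generalizing u w with
  | _ n ih =>
    rcases eq_or_ne u [] with rfl | hu
    · simp [qsh_nil_left, hp1, hm1]
    rcases eq_or_ne w [] with rfl | hw
    · simp [qsh_nil_right, hp1, hm1]
    have hfac : ∀ p q, ev₂ (fun u v => Φm u * Φ v) p q = ev Φm p * ev Φ q := by
      intro p q
      simp only [ev₂, ev_eq_sum, Finset.sum_mul, Finset.mul_sum, Finset.smul_sum, smul_mul_assoc,
        mul_smul_comm]
      rw [Finset.sum_comm]
      exact Finset.sum_congr rfl fun _ _ => Finset.sum_congr rfl fun _ _ => smul_comm _ _ _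
    have hev : ev Φp (qsh op t u w) = cutSum (fun u₁ u₂ => cutSum (fun w₁ w₂ =>
        ev Φm (qsh op t u₁ w₁) * (Φ u₂ * Φ w₂)) w) u := by
      have : Φp = cutSum (fun u v => Φm u * Φ v) := funext hcut
      rw [this, ev_cutSum_qsh]
      simp only [hfac, hΦ]
    have hprod : Φp u * Φp w = cutSum (fun u₁ u₂ => cutSum (fun w₁ w₂ =>
        (Φm u₁ * Φm w₁) * (Φ u₂ * Φ w₂)) w) u := by
      simp only [hcut, cutSum, Finset.sum_mul, Finset.mul_sum]
      rw [Finset.sum_comm]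
      refine Finset.sum_congr rfl fun i _ => Finset.sum_congr rfl fun j _ => by ring
    have hdiff : ev Φp (qsh op t u w) - Φp u * Φp w =
        ev Φm (qsh op t u w) - Φm u * Φm w := by
      rw [hev, hprod]
      simp only [cutSum, ← Finset.sum_sub_distrib]
      -- By induction all pairs of prefixes cancel except the full pair `(u, w)`, where the
      -- right-hand factor is `Φ [] * Φ [] = 1`.
      rw [Finset.sum_eq_single u.length]
      · rw [Finset.sum_eq_single w.length]
        · simp [h1]
        · intro j hj hj'
          rw [(ih _ ?_ _ _ rfl).2, sub_self]
          simp at hj ⊢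
          omega
        · simp
      · intro i hi hi'
        refine Finset.sum_eq_zero fun j hj => ?_
        rw [(ih _ ?_ _ _ rfl).2, sub_self]
        simp at hi hj ⊢
        omega
      · simp
    have hmem : ev Φm (qsh op t u w) ∈ Am := by
      rw [ev_eq_sum]
      refine Submodule.sum_mem _ fun y hy => Submodule.smul_mem _ _ (hm _ ?_)
      rintro rfl
      have := (length_of_mem_support_qsh hy).2.1
      simp at this
      exact hu this
    have hmem' : ev Φp (qsh op t u w) ∈ Ap :=
      Submodule.sum_mem _ fun y _ => Submodule.smul_mem _ _ (hp _)
    have h0 := hdisj _ (Submodule.sub_mem _ hmem' (hAp _ (hp u) _ (hp w)))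
      (hdiff ▸ Submodule.sub_mem _ hmem (hAm _ (hm u hu) _ (hm w hw)))
    exact ⟨sub_eq_zero.1 h0, sub_eq_zero.1 (hdiff ▸ h0)⟩

/-! ### Pole parts -/

/-- Induction on the order of the pole: `dslope` divides `h - h 0` by `z`, which lowers the order by
one and leaves the monomial `h 0 / z ^ (n + 1)`. -/
theorem exists_isLaurentSplit {f : ℂ → ℂ} (hf : MeromorphicAt f 0) :
    ∃ p : ℂ[X], ∃ g : ℂ → ℂ, IsLaurentSplit f p g := by
  obtain ⟨n, hn⟩ := hf
  have key : ∀ (n : ℕ) (h : ℂ → ℂ), AnalyticAt ℂ h 0 →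
      ∃ p : ℂ[X], ∃ g : ℂ → ℂ, IsLaurentSplit (fun z => (z ^ n)⁻¹ * h z) p g := by
    intro n
    induction n with
    | zero =>
      intro h hh
      exact ⟨0, h, by simp, hh, Eventually.of_forall fun z => by simp⟩
    | succ n ih =>
      intro h hh
      obtain ⟨q, hq⟩ := hh
      have hd : AnalyticAt ℂ (dslope h 0) 0 := ⟨_, hq.has_fpower_series_dslope_fslope⟩
      obtain ⟨p, g, h0, hg, hpg⟩ := ih _ hd
      refine ⟨p + Polynomial.C (h 0) * Polynomial.X ^ (n + 1), g, by simp [h0], hg, ?_⟩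
      filter_upwards [hpg, self_mem_nhdsWithin] with z hz hz0
      have hz0 : z ≠ 0 := hz0
      have h1 : h z = h 0 + z * dslope h 0 z := by
        have := sub_smul_dslope h 0 z
        simp only [sub_zero, smul_eq_mul] at this
        rw [this]; ring
      rw [Polynomial.eval_add, add_right_comm, ← hz, h1, Polynomial.eval_mul, Polynomial.eval_pow,
        Polynomial.eval_X, Polynomial.eval_C]
      rw [inv_pow]
      field_simp
      ring
  obtain ⟨p, g, h0, hg, hpg⟩ := key n _ hn
  refine ⟨p, g, h0, hg, ?_⟩
  filter_upwards [hpg, self_mem_nhdsWithin] with z hz hz0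
  have hz0 : z ≠ 0 := hz0
  rw [← hz, sub_zero, smul_eq_mul, inv_mul_cancel_left₀ (pow_ne_zero n hz0)]

theorem polePart_spec {f : ℂ → ℂ} (hf : MeromorphicAt f 0) :
    ∃ p : ℂ[X], ∃ g : ℂ → ℂ, polePart f = (fun z => p.eval z⁻¹) ∧ IsLaurentSplit f p g := by
  have h := exists_isLaurentSplit hf
  obtain ⟨g, hg⟩ := h.choose_spec
  exact ⟨h.choose, g, by rw [polePart, dif_pos h], hg⟩

/-- A nonconstant polynomial in `1/z` is unbounded near `0`, an analytic function is not. This is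
the uniqueness of pole parts, needed because `polePart` is defined by a choice. -/
theorem eq_zero_of_eval_inv_eq_analytic {p : ℂ[X]} {g : ℂ → ℂ} (h0 : p.coeff 0 = 0)
    (hg : AnalyticAt ℂ g 0) (h : ∀ᶠ z in 𝓝[≠] (0 : ℂ), p.eval z⁻¹ = g z) : p = 0 := by
  by_contra hp
  have hdeg : 0 < p.degree := by
    by_contra hd
    have := Polynomial.eq_C_of_degree_le_zero (not_lt.1 hd)
    rw [h0, map_zero] at this
    exact hp this
  have h1 := p.tendsto_norm_atTop hdeg
    (tendsto_norm_inv_nhdsNE_zero_atTop : Tendsto (fun z : ℂ => ‖z⁻¹‖) (𝓝[≠] 0) atTop)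
  have h2 : Tendsto (fun z => ‖g z‖) (𝓝[≠] (0 : ℂ)) (𝓝 ‖g 0‖) :=
    (hg.continuousAt.norm.tendsto).mono_left nhdsWithin_le_nhds
  exact not_tendsto_nhds_of_tendsto_atTop h1 _ (h2.congr' (h.mono fun z hz => by simp only [hz]))

theorem meromorphicAt_eval_inv (p : ℂ[X]) : MeromorphicAt (fun z : ℂ => p.eval z⁻¹) 0 := by
  induction p using Polynomial.induction_on' with
  | add p q hp hq =>
    simp only [Polynomial.eval_add]
    exact hp.add hq
  | monomial n a =>
    simp only [Polynomial.eval_monomial]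
    exact (MeromorphicAt.const a 0).mul ((MeromorphicAt.id (0 : ℂ)).inv.pow n)

theorem meromorphicAt_polePart {f : ℂ → ℂ} (hf : MeromorphicAt f 0) :
    MeromorphicAt (polePart f) 0 := by
  obtain ⟨p, g, h, -⟩ := polePart_spec hf
  rw [h]
  exact meromorphicAt_eval_inv p

/-! ### The Birkhoff factorisation of a family of meromorphic functions -/

section Birkhoff

variable {X : Type*} {Φ : List X → ℂ → ℂ}

theorem birkhoffMinus_cons (a : X) (w : List X) :
    birkhoffMinus Φ (a :: w) = -polePart (birkhoffPrep Φ (a :: w)) := by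
  rw [birkhoffMinus]
  rfl

theorem meromorphicAt_birkhoffMinus (hΦ : ∀ w, MeromorphicAt (Φ w) 0) (w : List X) :
    MeromorphicAt (birkhoffMinus Φ w) 0 ∧ MeromorphicAt (birkhoffPrep Φ w) 0 := by
  induction hn : w.length using Nat.strong_induction_on generalizing w with
  | _ n ih =>
    have hprep : MeromorphicAt (birkhoffPrep Φ w) 0 := by
      refine (hΦ w).add (MeromorphicAt.fun_sum fun i _ => ?_)
      refine (ih _ ?_ _ rfl).1.mul (hΦ _)
      simp; omega
    refine ⟨?_, hprep⟩
    cases w with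
    | nil => rw [birkhoffMinus]; exact MeromorphicAt.const 1 0
    | cons a w => rw [birkhoffMinus_cons]; exact (meromorphicAt_polePart hprep).neg

/-- The subtracted pole part is the summand with full prefix, and `Φ w` is the summand with empty
prefix. In this form `Φ₊` is the convolution of `Φ₋` and `Φ`. -/
theorem birkhoffPlus_eq (h1 : ∀ᶠ z in 𝓝[≠] (0 : ℂ), Φ [] z = 1) (w : List X) :
    ∀ᶠ z in 𝓝[≠] (0 : ℂ), birkhoffPlus Φ w z =
      ∑ i ∈ Finset.range (w.length + 1), birkhoffMinus Φ (w.take i) z * Φ (w.drop i) z := by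
  filter_upwards [h1] with z hz
  cases w with
  | nil => simp [birkhoffPlus, birkhoffMinus, hz]
  | cons a w =>
    rw [birkhoffPlus, Finset.sum_range_succ, List.length_cons, Finset.sum_range_succ',
      ← List.length_cons, Pi.sub_apply]
    have h2 : birkhoffMinus Φ (a :: w) z = -polePart (birkhoffPrep Φ (a :: w)) z := by
      rw [birkhoffMinus_cons]; rfl
    have h3 : birkhoffMinus Φ [] z = 1 := by rw [birkhoffMinus]; rfl
    rw [List.take_length, List.drop_length, h2, hz, mul_one, List.take_zero, List.drop_zero, h3,
      one_mul, ← sub_eq_add_neg, birkhoffPrep, Finset.sum_range, add_comm (Φ (a :: w) z)]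
    rfl

theorem birkhoffPlus_analytic (hΦ : ∀ w, MeromorphicAt (Φ w) 0) (w : List X) :
    ∃ g : ℂ → ℂ, AnalyticAt ℂ g 0 ∧ ∀ᶠ z in 𝓝[≠] (0 : ℂ), birkhoffPlus Φ w z = g z := by
  cases w with
  | nil => exact ⟨1, analyticAt_const, Eventually.of_forall fun z => by rw [birkhoffPlus]⟩
  | cons a w =>
    obtain ⟨p, g, h, hs⟩ := polePart_spec (meromorphicAt_birkhoffMinus hΦ (a :: w)).2
    refine ⟨g, hs.2.1, hs.2.2.mono fun z hz => ?_⟩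
    rw [birkhoffPlus, Pi.sub_apply, hz, h]
    ring

theorem birkhoffMinus_pole (hΦ : ∀ w, MeromorphicAt (Φ w) 0) (w : List X) (hw : w ≠ []) :
    ∃ p : ℂ[X], p.coeff 0 = 0 ∧ birkhoffMinus Φ w = fun z => p.eval z⁻¹ := by
  cases w with
  | nil => exact absurd rfl hw
  | cons a w =>
    obtain ⟨p, g, h, hs⟩ := polePart_spec (meromorphicAt_birkhoffMinus hΦ (a :: w)).2
    refine ⟨-p, by simp [hs.1], ?_⟩
    rw [birkhoffMinus_cons, h]
    ext z
    simp

end Birkhoff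

/-! ### Germs at the origin -/

/-- Germs at `0` of functions defined on a punctured neighbourhood. -/
abbrev PuncturedGerm : Type := Germ (𝓝[≠] (0 : ℂ)) ℂ

instance : IsScalarTower ℂ PuncturedGerm PuncturedGerm :=
  ⟨fun c x y => Germ.inductionOn₂ x y fun f g => congrArg _ (smul_mul_assoc c f g)⟩

instance : SMulCommClass ℂ PuncturedGerm PuncturedGerm :=
  ⟨fun c x y => Germ.inductionOn₂ x y fun f g => congrArg _ (mul_smul_comm c f g).symm⟩

/-- The germs of holomorphic functions. -/
def analyticGerms : Submodule ℂ PuncturedGerm where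
  carrier := {a | ∃ g : ℂ → ℂ, AnalyticAt ℂ g 0 ∧ a = (g : PuncturedGerm)}
  zero_mem' := ⟨0, analyticAt_const, rfl⟩
  add_mem' := by
    rintro _ _ ⟨g, hg, rfl⟩ ⟨h, hh, rfl⟩
    exact ⟨g + h, hg.add hh, rfl⟩
  smul_mem' := by
    rintro c _ ⟨g, hg, rfl⟩
    exact ⟨c • g, analyticAt_const.smul hg, rfl⟩

/-- The germs of polynomials in `1/z` without constant term. -/
def poleGerms : Submodule ℂ PuncturedGerm where
  carrier := {a | ∃ p : ℂ[X], p.coeff 0 = 0 ∧ a = ((fun z => p.eval z⁻¹ : ℂ → ℂ) : PuncturedGerm)}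
  zero_mem' := ⟨0, by simp, by simp; rfl⟩
  add_mem' := by
    rintro _ _ ⟨p, hp, rfl⟩ ⟨q, hq, rfl⟩
    exact ⟨p + q, by simp [hp, hq], by simp only [Polynomial.eval_add]; rfl⟩
  smul_mem' := by
    rintro c _ ⟨p, hp, rfl⟩
    exact ⟨c • p, by simp [hp], by simp only [Polynomial.eval_smul]; rfl⟩

theorem ev_germ {X : Type*} (Φ : List X → ℂ → ℂ) (p : List X →₀ ℂ) :
    ev (fun w => (Φ w : PuncturedGerm)) p = ((fun z => ev (fun w => Φ w z) p : ℂ → ℂ) :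
      PuncturedGerm) := by
  induction p using Finsupp.induction_linear with
  | zero => simp; rfl
  | add p q hp hq => simp only [map_add, hp, hq]; rfl
  | single w x => simp only [ev_single]; rfl

theorem germ_sum {ι : Type*} (s : Finset ι) (f : ι → ℂ → ℂ) :
    ((fun z => ∑ i ∈ s, f i z : ℂ → ℂ) : PuncturedGerm) = ∑ i ∈ s, (f i : PuncturedGerm) := by
  classical
  induction s using Finset.induction_on with
  | empty => simp; rfl
  | insert i s hi ih =>
    simp only [Finset.sum_insert hi]
    rw [← ih]; rfl

theorem eq_zero_of_mem_analyticGerms_of_mem_poleGerms {a : PuncturedGerm}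
    (h : a ∈ analyticGerms) (h' : a ∈ poleGerms) : a = 0 := by
  obtain ⟨g, hg, rfl⟩ := h
  obtain ⟨p, hp, h⟩ := h'
  rw [h, eq_zero_of_eval_inv_eq_analytic hp hg ((Germ.coe_eq.1 h).mono fun z hz => hz.symm)]
  simp; rfl

theorem birkhoffPlus_germ {X : Type*} {Φ : List X → ℂ → ℂ}
    (h1 : ∀ᶠ z in 𝓝[≠] (0 : ℂ), Φ [] z = 1) (w : List X) : (birkhoffPlus Φ w : PuncturedGerm) =
      cutSum (fun u v => (birkhoffMinus Φ u : PuncturedGerm) * (Φ v : PuncturedGerm)) w := by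
  rw [Germ.coe_eq.2 (birkhoffPlus_eq h1 w), germ_sum]
  rfl

/-- The component `Φ₊` of the Birkhoff factorisation of a character is a character. -/
theorem birkhoffPlus_mul {X : Type*} {Φ : List X → ℂ → ℂ} (hΦ : ∀ w, MeromorphicAt (Φ w) 0)
    (h1 : ∀ᶠ z in 𝓝[≠] (0 : ℂ), Φ [] z = 1) {op : X → X → X} {t : ℂ}
    (hmul : ∀ u w, ∀ᶠ z in 𝓝[≠] (0 : ℂ),
      ev (fun y => Φ y z) (qsh op t u w) = Φ u z * Φ w z) (u w : List X) :
    ∀ᶠ z in 𝓝[≠] (0 : ℂ), ev (fun y => birkhoffPlus Φ y z) (qsh op t u w) =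
      birkhoffPlus Φ u z * birkhoffPlus Φ w z := by
  apply Germ.coe_eq.1
  rw [← ev_germ]
  refine birkhoff_mul (K := PuncturedGerm) (Ap := analyticGerms) (Am := poleGerms) ?_ ?_
    (fun a => eq_zero_of_mem_analyticGerms_of_mem_poleGerms)
    (Φ := fun w => (Φ w : PuncturedGerm)) (Φm := fun w => (birkhoffMinus Φ w : PuncturedGerm))
    (Germ.coe_eq.2 h1) ?_ (birkhoffPlus_germ h1) ?_ ?_ ?_ u w
  · rintro _ ⟨g, hg, rfl⟩ _ ⟨h, hh, rfl⟩
    exact ⟨g * h, hg.mul hh, rfl⟩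
  · rintro _ ⟨p, hp, rfl⟩ _ ⟨q, hq, rfl⟩
    exact ⟨p * q, by simp [Polynomial.mul_coeff_zero, hp], by
      simp only [Polynomial.eval_mul]; rfl⟩
  · simp only [birkhoffMinus]; rfl
  · intro w
    obtain ⟨g, hg, h⟩ := birkhoffPlus_analytic hΦ w
    exact ⟨g, hg, Germ.coe_eq.2 h⟩
  · intro w hw
    obtain ⟨p, hp, h⟩ := birkhoffMinus_pole hΦ w hw
    exact ⟨p, hp, by rw [h]⟩
  · intro u w
    rw [ev_germ]
    exact Germ.coe_eq.2 (hmul u w)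

/-! ### Uniqueness of finite parts -/

/-- Otherwise `exp (a * log (1 + 1/m)) = 1` for all `m ≥ 1`. For `m > ‖a‖` the argument is nonzero
of norm less than `1`, so it is no multiple of `2πi`. -/
theorem exists_natCast_cpow_ne_one {a : ℂ} (ha : a ≠ 0) : ∃ m : ℕ, 1 ≤ m ∧ (m : ℂ) ^ a ≠ 1 := by
  by_contra! h
  obtain ⟨m, hm⟩ := exists_nat_gt ‖a‖
  have hm0 : (0 : ℝ) < m := (norm_nonneg a).trans_lt hm
  have hm1 : 1 ≤ m := by exact_mod_cast hm0
  set t : ℝ := Real.log (m + 1) - Real.log m with ht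
  have htpos : 0 < t := sub_pos.2 (Real.log_lt_log hm0 (by linarith))
  have htle : t ≤ 1 / m := by
    rw [ht, ← Real.log_div (by positivity) (by positivity)]
    refine (Real.log_le_sub_one_of_pos (by positivity)).trans (le_of_eq ?_)
    field_simp
    ring
  have h1 : Complex.exp ((t : ℂ) * a) = 1 := by
    have e1 := h m hm1
    have e2 := h (m + 1) (by omega)
    rw [Complex.cpow_def_of_ne_zero (by exact_mod_cast hm0.ne'), ← Complex.natCast_log] at e1
    rw [Complex.cpow_def_of_ne_zero (by exact_mod_cast m.succ_ne_zero), ← Complex.natCast_log] at e2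
    rw [ht]
    rw [Nat.cast_succ] at e2
    rw [Complex.ofReal_sub, sub_mul, Complex.exp_sub, e1, e2, div_one]
  obtain ⟨n, hn⟩ := Complex.exp_eq_one_iff.1 h1
  have h2 : ‖(t : ℂ) * a‖ < 1 := by
    rw [norm_mul, Complex.norm_real, Real.norm_of_nonneg htpos.le]
    calc t * ‖a‖ ≤ 1 / m * ‖a‖ := by gcongr
      _ < 1 / m * m := by gcongr
      _ = 1 := by field_simp
  rcases eq_or_ne n 0 with rfl | hn0
  · simp [ha, htpos.ne'] at hn
  · rw [hn, norm_mul, Complex.norm_intCast] at h2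
    have h3 : (1 : ℝ) ≤ |(n : ℝ)| := by exact_mod_cast Int.one_le_abs hn0
    have h4 : (6 : ℝ) ≤ ‖2 * (Real.pi : ℂ) * Complex.I‖ := by
      rw [norm_mul, norm_mul, Complex.norm_I, Complex.norm_real,
        Real.norm_of_nonneg Real.pi_pos.le]
      simp
      linarith [Real.pi_gt_three]
    nlinarith

-- A translation keeps the leading coefficient, so the coefficient in that degree is `1 - x` times
-- it.
open Polynomial in
theorem comp_X_add_C_sub_ne_zero {P : ℂ[X]} (hP : P ≠ 0) (h : ℂ) {x : ℂ} (hx : x ≠ 1) :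
    P.comp (X + C h) - C x * P ≠ 0 := by
  intro h0
  have h1 := congrArg (fun Q : ℂ[X] => Q.coeff P.natDegree) h0
  have h2 : (P.comp (X + C h)).coeff P.natDegree = P.leadingCoeff := by
    have := Polynomial.leadingCoeff_comp (p := P) (q := X + C h) (by simp)
    rw [Polynomial.leadingCoeff, Polynomial.natDegree_comp] at this
    simpa using this
  simp only [coeff_sub, h2, coeff_C_mul, coeff_natDegree, coeff_zero] at h1
  have h3 : (1 - x) * P.leadingCoeff = 0 := by linear_combination h1
  rcases mul_eq_zero.1 h3 with h4 | h4
  · exact hx (sub_eq_zero.1 h4).symm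
  · exact hP (leadingCoeff_eq_zero.1 h4)

theorem tendsto_log_natCast_norm :
    Tendsto (fun N : ℕ => ‖((Real.log N : ℝ) : ℂ)‖) atTop atTop := by
  refine (tendsto_norm_atTop_atTop.comp
    (Real.tendsto_log_atTop.comp tendsto_natCast_atTop_atTop)).congr fun N => ?_
  rw [Complex.norm_real]
  rfl

open Polynomial in
theorem eq_zero_of_tendsto_eval_log {P : ℂ[X]}
    (h : Tendsto (fun N : ℕ => P.eval ((Real.log N : ℝ) : ℂ)) atTop (𝓝 0)) : P = 0 := by
  rcases lt_or_ge 0 P.degree with hd | hd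
  · exact absurd h.norm
      (not_tendsto_nhds_of_tendsto_atTop (P.tendsto_norm_atTop hd tendsto_log_natCast_norm) _)
  · rw [eq_C_of_degree_le_zero hd] at h ⊢
    simp only [eval_C] at h
    rw [tendsto_nhds_unique tendsto_const_nhds h, C_0]

-- The operator `g(N) ↦ g(m N) - m ^ a g(N)` preserves sums of this type and convergence to `0`.
-- With `m ^ a ≠ 1` it lowers the degree of `P a`, or kills `P a` if constant, raises no other
-- degree, and does not annihilate a nonzero `P 0`. Iterating removes all exponents `a ≠ 0` and
-- leaves a polynomial in `log N` tending to `0`. Oscillating powers thus need no separate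
-- treatment.
open Polynomial in
theorem coeff_zero_eq_zero_of_tendsto (S : Finset ℂ) (P : ℂ → ℂ[X])
    (h : Tendsto (fun N : ℕ => ∑ a ∈ S, (N : ℂ) ^ a * (P a).eval ((Real.log N : ℝ) : ℂ))
      atTop (𝓝 0)) (h0 : (0 : ℂ) ∈ S) : P 0 = 0 := by
  classical
  induction hn : ∑ a ∈ S.erase 0, (if P a = 0 then 0 else (P a).natDegree + 1)
    using Nat.strong_induction_on generalizing P with
  | _ n ih =>
    by_cases hz : ∀ a ∈ S.erase 0, P a = 0
    · refine eq_zero_of_tendsto_eval_log (h.congr fun N => ?_)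
      rw [← Finset.add_sum_erase _ _ h0, Finset.sum_eq_zero fun a ha => by rw [hz a ha]; simp]
      simp
    · push Not at hz
      obtain ⟨a, ha, hPa⟩ := hz
      obtain ⟨m, hm1, hma⟩ := exists_natCast_cpow_ne_one (Finset.ne_of_mem_erase ha)
      have hmpos : 0 < m := hm1
      have hmC : (m : ℂ) ≠ 0 := by exact_mod_cast hmpos.ne'
      set l : ℂ := ((Real.log m : ℝ) : ℂ) with hl
      -- The coefficients after applying the operator: replacing `N` by `m N` multiplies `N ^ b` by
      -- `m ^ b` and shifts `log N` by `log m`.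
      set P' : ℂ → ℂ[X] := fun b =>
        C ((m : ℂ) ^ b) * (P b).comp (X + C l) - C ((m : ℂ) ^ a) * P b with hP'
      have key : P' 0 = 0 := by
        refine ih _ ?_ P' ?_ rfl
        · rw [← hn]
          have hz' : ∀ b, P b = 0 → P' b = 0 := fun b hb => by simp [hP', hb]
          have hdeg : ∀ b, (P' b).natDegree ≤ (P b).natDegree := by
            intro b
            refine (natDegree_sub_le _ _).trans (max_le ?_ (natDegree_C_mul_le _ _))
            refine (natDegree_C_mul_le _ _).trans (natDegree_comp_le.trans ?_)
            simp
          refine Finset.sum_lt_sum (fun b _ => ?_) ⟨a, ha, ?_⟩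
          · by_cases hb : P b = 0
            · simp [hb, hz' b hb]
            · rw [if_neg hb]
              split_ifs
              · omega
              · have := hdeg b; omega
          · rw [if_neg hPa]
            split_ifs with hc
            · omega
            · have e1 : P' a = C ((m : ℂ) ^ a) * ((P a).comp (X + C l) - P a) := by
                simp only [hP']; ring
              have e2 : (P a).comp (X + C l) - P a ≠ 0 := by
                rintro e; rw [e1, e, mul_zero] at hc; exact hc rfl
              have hdc : ((P a).comp (X + C l)).natDegree = (P a).natDegree := by
                rw [natDegree_comp]; simp
              have e3 : ((P a).comp (X + C l) - P a).degree < ((P a).comp (X + C l)).degree := by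
                have hne : (P a).comp (X + C l) ≠ 0 := by
                  intro e
                  rw [comp_eq_zero_iff] at e
                  rcases e with e | ⟨-, e⟩
                  · exact hPa e
                  · have := congrArg (fun Q : ℂ[X] => Q.natDegree) e
                    simp at this
                refine degree_sub_lt_left ?_ hne ?_
                · rw [degree_eq_natDegree hne, degree_eq_natDegree hPa, hdc]
                · rw [leadingCoeff_comp (by simp)]
                  simp
              have e4 := natDegree_lt_natDegree e2 e3
              rw [hdc] at e4
              rw [e1]
              have := natDegree_C_mul_le ((m : ℂ) ^ a) ((P a).comp (X + C l) - P a)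
              omega
        · have h1 : Tendsto (fun N : ℕ => m * N) atTop atTop :=
            tendsto_id.const_mul_atTop' hmpos
          have h2 := (h.comp h1).sub (h.const_mul ((m : ℂ) ^ a))
          rw [mul_zero, sub_zero] at h2
          refine h2.congr' ?_
          filter_upwards [eventually_ge_atTop 1] with N hN
          simp only [Function.comp]
          rw [Finset.mul_sum, ← Finset.sum_sub_distrib]
          refine Finset.sum_congr rfl fun b _ => ?_
          have hNpos : (0 : ℝ) < N := by exact_mod_cast hN
          have hmpos' : (0 : ℝ) < m := by exact_mod_cast hmpos
          simp only [hP', eval_sub, eval_mul, eval_C, eval_comp, eval_add, eval_X]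
          rw [Nat.cast_mul, Nat.cast_mul, Complex.natCast_mul_natCast_cpow,
            Real.log_mul hmpos'.ne' hNpos.ne', hl]
          push_cast
          rw [add_comm (Complex.log m)]
          ring
      by_contra hP0
      refine comp_X_add_C_sub_ne_zero hP0 l hma ?_
      simpa [hP'] using key

theorem HasFinitePart.add {g h : ℕ → ℂ} {c d : ℂ} (hg : HasFinitePart g c)
    (hh : HasFinitePart h d) : HasFinitePart (fun N => g N + h N) (c + d) := by
  classical
  obtain ⟨E, b, h0, ht⟩ := hg
  obtain ⟨E', b', h0', ht'⟩ := hh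
  refine ⟨E ∪ E', fun p => (if p ∈ E then b p else 0) + (if p ∈ E' then b' p else 0),
    by simp [h0, h0'], ?_⟩
  have := ht.add ht'
  rw [add_zero] at this
  refine this.congr fun N => ?_
  simp only [add_mul, Finset.sum_add_distrib, ite_mul, zero_mul]
  rw [← Finset.sum_filter, ← Finset.sum_filter, Finset.filter_mem_eq_inter,
    Finset.filter_mem_eq_inter, Finset.union_inter_cancel_left, Finset.union_inter_cancel_right]
  ring

theorem HasFinitePart.const_mul {g : ℕ → ℂ} {c : ℂ} (hg : HasFinitePart g c) (x : ℂ) :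
    HasFinitePart (fun N => x * g N) (x * c) := by
  obtain ⟨E, b, h0, ht⟩ := hg
  refine ⟨E, fun p => x * b p, h0, ?_⟩
  have := ht.const_mul x
  rw [mul_zero] at this
  refine this.congr fun N => ?_
  simp only [mul_assoc, ← Finset.mul_sum]
  ring

theorem HasFinitePart.congr {g h : ℕ → ℂ} {c : ℂ} (hg : HasFinitePart g c)
    (hgh : ∀ᶠ N in atTop, g N = h N) : HasFinitePart h c := by
  obtain ⟨E, b, h0, ht⟩ := hg
  exact ⟨E, b, h0, ht.congr' (hgh.mono fun N hN => by simp only [hN])⟩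

theorem hasFinitePart_of_tendsto {g : ℕ → ℂ} {c : ℂ} (h : Tendsto g atTop (𝓝 c)) :
    HasFinitePart g c := by
  refine ⟨∅, 0, by simp, ?_⟩
  simpa using h.sub_const c

-- Group the terms by exponent. The polynomial in `log N` attached to the exponent `0` has constant
-- term `c`, because `(0, 0)` is excluded from the expansion, and this polynomial vanishes.
open Polynomial in
theorem HasFinitePart.eq_zero {c : ℂ} (h : HasFinitePart (fun _ => 0) c) : c = 0 := by
  classical
  obtain ⟨E, b, h0, ht⟩ := h
  set S : Finset ℂ := insert 0 (E.image Prod.fst) with hS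
  set P : ℂ → ℂ[X] := fun a => (if a = 0 then C c else 0) +
    ∑ p ∈ E with p.1 = a, C (b p) * X ^ p.2 with hP
  have h1 : P 0 = 0 := by
    refine coeff_zero_eq_zero_of_tendsto S P ?_ (Finset.mem_insert_self _ _)
    have := ht.neg
    rw [neg_zero] at this
    refine this.congr fun N => ?_
    simp only [hP, eval_add, mul_add, Finset.sum_add_distrib, eval_finsetSum]
    have e1 : ∑ a ∈ S, (N : ℂ) ^ a * (if a = 0 then C c else 0 : ℂ[X]).eval
        ((Real.log N : ℝ) : ℂ) = c := by
      rw [Finset.sum_eq_single 0]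
      · simp
      · intro a _ ha; simp [ha]
      · intro h; exact absurd (Finset.mem_insert_self _ _) h
    have e2 : ∑ p ∈ E, b p * ((N : ℂ) ^ p.1 * ((Real.log N : ℝ) : ℂ) ^ p.2) =
        ∑ a ∈ S, (N : ℂ) ^ a * ∑ p ∈ E with p.1 = a,
          (C (b p) * X ^ p.2 : ℂ[X]).eval ((Real.log N : ℝ) : ℂ) := by
      rw [← Finset.sum_fiberwise_of_maps_to (g := Prod.fst) (t := S)]
      · refine Finset.sum_congr rfl fun a _ => ?_
        rw [Finset.mul_sum]
        refine Finset.sum_congr rfl fun p hp => ?_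
        rw [← (Finset.mem_filter.1 hp).2]
        simp
        ring
      · intro p hp
        exact Finset.mem_insert_of_mem (Finset.mem_image_of_mem _ hp)
    rw [e1, e2]
    ring
  have h2 := congrArg (fun Q : ℂ[X] => Q.coeff 0) h1
  simp only [hP, if_true, coeff_add, coeff_C_zero, finsetSum_coeff, coeff_zero] at h2
  rw [Finset.sum_eq_zero, add_zero] at h2
  · exact h2
  · rintro ⟨a, k⟩ hp
    obtain ⟨hp, rfl⟩ := Finset.mem_filter.1 hp
    rcases k with _ | k
    · exact absurd hp h0
    · simp

theorem HasFinitePart.unique {g : ℕ → ℂ} {c d : ℂ} (h : HasFinitePart g c)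
    (h' : HasFinitePart g d) : c = d := by
  have := (h.add (h'.const_mul (-1))).congr (h := fun _ => 0)
    (Eventually.of_forall fun N => by ring)
  linear_combination this.eq_zero

theorem HasFinitePart.finitePart_eq {g : ℕ → ℂ} {c : ℂ} (h : HasFinitePart g c) :
    finitePart g = c := by
  have h' : ∃ c, HasFinitePart g c := ⟨c, h⟩
  rw [finitePart, dif_pos h']
  exact h'.choose_spec.unique h

/-! ### Uniform Taylor expansion of powers -/

/-- The binomial coefficient `binom(b, j)`, a polynomial in `b`. -/
def bin : ℕ → ℂ → ℂ
  | 0, _ => 1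
  | j + 1, b => b / (j + 1) * bin j (b - 1)

/-- The derivative of `bin j b * x ^ (b - j)` is thereby `b` times the corresponding term for the
exponent `b - 1`. -/
theorem bin_mul_sub (j : ℕ) (b : ℂ) : bin j b * (b - j) = b * bin j (b - 1) := by
  induction j generalizing b with
  | zero => simp [bin]
  | succ j ih =>
    have h := ih (b - 1)
    rw [bin, bin]
    push_cast
    linear_combination b / (j + 1) * h

theorem differentiable_bin (j : ℕ) : Differentiable ℂ (bin j) := by
  induction j with
  | zero => exact differentiable_const 1
  | succ j ih =>
    have : bin (j + 1) = fun b => b / (j + 1) * bin j (b - 1) := rfl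
    rw [this]
    exact (differentiable_id.div_const _).mul (ih.comp (differentiable_id.sub_const 1))

theorem hasDerivAt_one_add_cpow (b : ℂ) {t : ℝ} (ht : 0 ≤ t) :
    HasDerivAt (fun t : ℝ => (1 + (t : ℂ)) ^ b) (b * (1 + (t : ℂ)) ^ (b - 1)) t := by
  have h : HasDerivAt (fun z : ℂ => 1 + z) 1 (t : ℂ) := (hasDerivAt_id _).const_add 1
  have h2 := h.cpow_const (c := b) (Or.inl (by simp; linarith))
  simpa using h2.comp_ofReal

theorem norm_one_add_cpow_le {b : ℂ} {B t T : ℝ} (hb : ‖b‖ ≤ B) (ht : 0 ≤ t) (htT : t ≤ T) :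
    ‖(1 + (t : ℂ)) ^ b‖ ≤ (1 + T) ^ B := by
  have h1 : (1 + (t : ℂ)) = ((1 + t : ℝ) : ℂ) := by push_cast; rfl
  rw [h1, Complex.norm_cpow_eq_rpow_re_of_pos (by linarith)]
  calc (1 + t) ^ b.re ≤ (1 + t) ^ B :=
        Real.rpow_le_rpow_of_exponent_le (by linarith) ((Complex.re_le_norm b).trans hb)
    _ ≤ (1 + T) ^ B :=
        Real.rpow_le_rpow (by linarith) (by linarith) ((norm_nonneg b).trans hb)

/-- The remainder of order `L + 1` vanishes at `t = 0`, and its derivative is `b` times the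
remainder of order `L` for `b - 1`; hence the induction with `B + 1`. Uniformity in `b` is
essential, as the exponents will move with `z`. -/
theorem exists_norm_one_add_cpow_sub_le (L : ℕ) (B T : ℝ) : ∃ C : ℝ, 0 ≤ C ∧ ∀ b : ℂ, ‖b‖ ≤ B →
    ∀ t : ℝ, 0 ≤ t → t ≤ T →
      ‖(1 + (t : ℂ)) ^ b - ∑ j ∈ Finset.range L, bin j b * (t : ℂ) ^ j‖ ≤ C * t ^ L := by
  induction L generalizing B with
  | zero =>
    refine ⟨|(1 + T) ^ B|, abs_nonneg _, fun b hb t ht htT => ?_⟩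
    simpa using (norm_one_add_cpow_le hb ht htT).trans (le_abs_self _)
  | succ L ih =>
    obtain ⟨C, hC, h⟩ := ih (B + 1)
    refine ⟨|B| * C, by positivity, fun b hb t ht htT => ?_⟩
    have hb1 : ‖b - 1‖ ≤ B + 1 := (norm_sub_le _ _).trans (by simpa using hb)
    have hd : ∀ x ∈ Set.Icc (0 : ℝ) t, HasDerivWithinAt
        (fun t : ℝ => (1 + (t : ℂ)) ^ b - ∑ j ∈ Finset.range (L + 1), bin j b * (t : ℂ) ^ j)
        (b * ((1 + (x : ℂ)) ^ (b - 1) - ∑ j ∈ Finset.range L, bin j (b - 1) * (x : ℂ) ^ j))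
        (Set.Icc 0 t) x := by
      intro x hx
      refine HasDerivAt.hasDerivWithinAt ?_
      rw [mul_sub]
      refine (hasDerivAt_one_add_cpow b hx.1).sub ?_
      have hs : ∀ j ∈ Finset.range (L + 1), HasDerivAt (fun t : ℝ => bin j b * (t : ℂ) ^ j)
          (bin j b * (j * (x : ℂ) ^ (j - 1))) x := by
        intro j _
        exact ((hasDerivAt_pow j (x : ℂ)).comp_ofReal).const_mul _
      convert! HasDerivAt.fun_sum hs using 1
      rw [Finset.sum_range_succ', Finset.mul_sum]
      simp only [Nat.cast_zero, zero_mul, mul_zero, add_zero]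
      refine Finset.sum_congr rfl fun j _ => ?_
      have hj : ((j : ℂ) + 1) ≠ 0 := by exact_mod_cast j.succ_ne_zero
      rw [bin, Nat.add_sub_cancel]
      push_cast
      field_simp
    have hbd : ∀ x ∈ Set.Ico (0 : ℝ) t, ‖b * ((1 + (x : ℂ)) ^ (b - 1) -
        ∑ j ∈ Finset.range L, bin j (b - 1) * (x : ℂ) ^ j)‖ ≤ |B| * C * t ^ L := by
      intro x hx
      rw [norm_mul, mul_assoc]
      refine mul_le_mul (hb.trans (le_abs_self B)) ?_ (norm_nonneg _) (abs_nonneg _)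
      refine (h _ hb1 x hx.1 (hx.2.le.trans htT)).trans ?_
      exact mul_le_mul_of_nonneg_left (pow_le_pow_left₀ hx.1 hx.2.le _) hC
    have := norm_image_sub_le_of_norm_deriv_le_segment' hd hbd t ⟨ht, le_rfl⟩
    rw [Finset.sum_range_succ' (fun j => bin j b * ((0 : ℝ) : ℂ) ^ j)] at this
    simp only [Complex.ofReal_zero, add_zero, Complex.one_cpow, pow_succ, mul_zero,
      Finset.sum_const_zero, bin, pow_zero, mul_one, zero_add, sub_self, sub_zero] at this
    rw [pow_succ, ← mul_assoc]
    exact this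

/-! ### Families of sequences near the origin -/

/-- The sequences `u z`, for `z ≠ 0` close to `0`, are holomorphic in `z` and `O(n ^ a)`, up to a
pole at `z = 0`. -/
def Bdd (a : ℝ) (u : ℂ → ℕ → ℂ) : Prop :=
  ∃ (p : ℕ) (C : ℝ), 0 ≤ C ∧ ∀ᶠ z in 𝓝[≠] (0 : ℂ), ∀ n : ℕ, 1 ≤ n →
    DifferentiableAt ℂ (fun y => u y n) z ∧ ‖z‖ ^ p * ‖u z n‖ ≤ C * (n : ℝ) ^ a

theorem eventually_norm_lt {r : ℝ} (hr : 0 < r) : ∀ᶠ z in 𝓝[≠] (0 : ℂ), ‖z‖ < r := by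
  refine nhdsWithin_le_nhds ?_
  simpa [Metric.ball, dist_zero_right] using Metric.ball_mem_nhds (0 : ℂ) hr

theorem eventually_nhds_of_punctured {P : ℂ → Prop} (h : ∀ᶠ z in 𝓝[≠] (0 : ℂ), P z) :
    ∀ᶠ z in 𝓝[≠] (0 : ℂ), ∀ᶠ y in 𝓝 z, P y := by
  filter_upwards [eventually_eventually_nhdsWithin.2 h, self_mem_nhdsWithin] with z hz hz0
  rwa [(isOpen_compl_singleton (x := (0 : ℂ))).nhdsWithin_eq hz0] at hz

theorem Bdd.mono {a a' : ℝ} (h : a ≤ a') {u : ℂ → ℕ → ℂ} (hu : Bdd a u) : Bdd a' u := by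
  obtain ⟨p, C, hC, hu⟩ := hu
  refine ⟨p, C, hC, hu.mono fun z hz n hn => ⟨(hz n hn).1, (hz n hn).2.trans ?_⟩⟩
  exact mul_le_mul_of_nonneg_left
    (Real.rpow_le_rpow_of_exponent_le (by exact_mod_cast hn) h) hC

theorem Bdd.congr {a : ℝ} {u v : ℂ → ℕ → ℂ} (hu : Bdd a u)
    (h : ∀ᶠ z in 𝓝[≠] (0 : ℂ), ∀ n : ℕ, 1 ≤ n → u z n = v z n) : Bdd a v := by
  obtain ⟨p, C, hC, hu⟩ := hu
  refine ⟨p, C, hC, ?_⟩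
  filter_upwards [hu, h, eventually_nhds_of_punctured h] with z hz h1 h2 n hn
  refine ⟨(hz n hn).1.congr_of_eventuallyEq (h2.mono fun y hy => (hy n hn).symm), ?_⟩
  rw [← h1 n hn]
  exact (hz n hn).2

theorem Bdd.add {a : ℝ} {u v : ℂ → ℕ → ℂ} (hu : Bdd a u) (hv : Bdd a v) :
    Bdd a (fun z n => u z n + v z n) := by
  obtain ⟨p, C, hC, hu⟩ := hu
  obtain ⟨q, D, hD, hv⟩ := hv
  refine ⟨p + q, C + D, by positivity, ?_⟩
  filter_upwards [hu, hv, eventually_norm_lt one_pos] with z h1 h2 h3 n hn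
  refine ⟨(h1 n hn).1.add (h2 n hn).1, ?_⟩
  have e1 : ‖z‖ ^ q ≤ 1 := pow_le_one₀ (norm_nonneg _) h3.le
  have e2 : ‖z‖ ^ p ≤ 1 := pow_le_one₀ (norm_nonneg _) h3.le
  calc ‖z‖ ^ (p + q) * ‖u z n + v z n‖ ≤ ‖z‖ ^ (p + q) * (‖u z n‖ + ‖v z n‖) := by
        gcongr; exact norm_add_le _ _
    _ = ‖z‖ ^ q * (‖z‖ ^ p * ‖u z n‖) + ‖z‖ ^ p * (‖z‖ ^ q * ‖v z n‖) := by ring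
    _ ≤ 1 * (C * (n : ℝ) ^ a) + 1 * (D * (n : ℝ) ^ a) := by
        have := (h1 n hn).2
        have := (h2 n hn).2
        gcongr
    _ = (C + D) * (n : ℝ) ^ a := by ring

theorem Bdd.mul {a b : ℝ} {u v : ℂ → ℕ → ℂ} (hu : Bdd a u) (hv : Bdd b v) :
    Bdd (a + b) (fun z n => u z n * v z n) := by
  obtain ⟨p, C, hC, hu⟩ := hu
  obtain ⟨q, D, hD, hv⟩ := hv
  refine ⟨p + q, C * D, by positivity, ?_⟩
  filter_upwards [hu, hv] with z h1 h2 n hn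
  refine ⟨(h1 n hn).1.mul (h2 n hn).1, ?_⟩
  have hn' : (0 : ℝ) < n := by exact_mod_cast hn
  calc ‖z‖ ^ (p + q) * ‖u z n * v z n‖ = (‖z‖ ^ p * ‖u z n‖) * (‖z‖ ^ q * ‖v z n‖) := by
        rw [norm_mul]; ring
    _ ≤ (C * (n : ℝ) ^ a) * (D * (n : ℝ) ^ b) := by
        exact mul_le_mul (h1 n hn).2 (h2 n hn).2 (by positivity) (by positivity)
    _ = C * D * (n : ℝ) ^ (a + b) := by rw [Real.rpow_add hn']; ring

theorem bdd_of_meromorphicAt {c : ℂ → ℂ} (hc : MeromorphicAt c 0) : Bdd 0 (fun z _ => c z) := by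
  obtain ⟨p, hp⟩ := id hc
  refine ⟨p, ‖(0 - 0 : ℂ) ^ p • c 0‖ + 1, by positivity, ?_⟩
  have h1 : ∀ᶠ z in 𝓝[≠] (0 : ℂ), ‖(z - 0) ^ p • c z‖ < ‖(0 - 0 : ℂ) ^ p • c 0‖ + 1 :=
    nhdsWithin_le_nhds ((hp.continuousAt.norm).eventually_lt_const (lt_add_one _))
  filter_upwards [h1, hc.eventually_analyticAt] with z hz hz' n _
  refine ⟨hz'.differentiableAt, ?_⟩
  rw [Real.rpow_zero, mul_one]
  simpa using hz.le

theorem Bdd.mero_mul {a : ℝ} {c : ℂ → ℂ} (hc : MeromorphicAt c 0) {u : ℂ → ℕ → ℂ}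
    (hu : Bdd a u) : Bdd a (fun z n => c z * u z n) := by
  simpa using (bdd_of_meromorphicAt hc).mul hu

theorem bdd_zero (a : ℝ) : Bdd a 0 :=
  ⟨0, 0, le_rfl, Eventually.of_forall fun z n _ => ⟨differentiableAt_const 0, by simp⟩⟩

/-- The strict inequality leaves room for `β z` to move away from `β 0`. -/
theorem bdd_cpow {a : ℝ} {β : ℂ → ℂ} (hβ : AnalyticAt ℂ β 0) (h : (β 0).re < a) :
    Bdd a (fun z n => (n : ℂ) ^ β z) := by
  refine ⟨0, 1, zero_le_one, ?_⟩
  have h1 : ∀ᶠ z in 𝓝[≠] (0 : ℂ), (β z).re < a := nhdsWithin_le_nhds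
    ((Complex.continuous_re.continuousAt.comp hβ.continuousAt).eventually_lt_const h)
  have h2 : ∀ᶠ z in 𝓝[≠] (0 : ℂ), AnalyticAt ℂ β z :=
    nhdsWithin_le_nhds hβ.eventually_analyticAt
  filter_upwards [h1, h2] with z hz hz' n hn
  have hn' : (n : ℂ) ≠ 0 := by exact_mod_cast (by omega : n ≠ 0)
  refine ⟨hz'.differentiableAt.const_cpow (Or.inl hn'), ?_⟩
  rw [pow_zero, one_mul, one_mul, Complex.norm_natCast_cpow_of_pos (by omega)]
  exact Real.rpow_le_rpow_of_exponent_le (by exact_mod_cast hn) hz.le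

/-- An exponent `β(z)` which is admissible in the expansions. -/
def AdmExp (β : ℂ → ℂ) : Prop := AnalyticAt ℂ β 0 ∧ (deriv β 0).re < 0

theorem AdmExp.add {β γ : ℂ → ℂ} (hβ : AdmExp β) (hγ : AdmExp γ) :
    AdmExp (fun z => β z + γ z) := by
  refine ⟨hβ.1.add hγ.1, ?_⟩
  rw [deriv_fun_add hβ.1.differentiableAt hγ.1.differentiableAt, Complex.add_re]
  linarith [hβ.2, hγ.2]

theorem AdmExp.add_const {β : ℂ → ℂ} (hβ : AdmExp β) (c : ℂ) : AdmExp (fun z => β z + c) :=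
  ⟨hβ.1.add analyticAt_const, by rw [deriv_add_const]; exact hβ.2⟩

theorem AdmExp.sub_const {β : ℂ → ℂ} (hβ : AdmExp β) (c : ℂ) : AdmExp (fun z => β z - c) :=
  ⟨hβ.1.sub analyticAt_const, by rw [deriv_sub_const]; exact hβ.2⟩

/-- A nonzero derivative prevents `β` from vanishing identically, so its zero at `0`, if any, is
isolated. Consequently `n ^ β(z)` is not a constant sequence for `z ≠ 0` close to `0`. -/
theorem AdmExp.eventually_ne_zero {β : ℂ → ℂ} (hβ : AdmExp β) :
    ∀ᶠ z in 𝓝[≠] (0 : ℂ), β z ≠ 0 := by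
  refine hβ.1.eventually_eq_zero_or_eventually_ne_zero.resolve_left fun h => ?_
  have h2 : β =ᶠ[𝓝 0] fun _ => 0 := h
  have := hβ.2
  rw [h2.deriv_eq] at this
  simp at this

/-- Finite sums of terms `c(z) n ^ β(z)` with `c` meromorphic at `0` and `β` admissible. -/
def powSpan : Submodule ℂ (ℂ → ℕ → ℂ) :=
  Submodule.span ℂ {u | ∃ c β : ℂ → ℂ, MeromorphicAt c 0 ∧ AdmExp β ∧
    u = fun (z : ℂ) (n : ℕ) => c z * (n : ℂ) ^ β z}

theorem mem_powSpan {c β : ℂ → ℂ} (hc : MeromorphicAt c 0) (hβ : AdmExp β) :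
    (fun (z : ℂ) (n : ℕ) => c z * (n : ℂ) ^ β z) ∈ powSpan :=
  Submodule.subset_span ⟨c, β, hc, hβ, rfl⟩

theorem mero_mul_mem_powSpan {c : ℂ → ℂ} (hc : MeromorphicAt c 0) {v : ℂ → ℕ → ℂ}
    (hv : v ∈ powSpan) : (fun z n => c z * v z n) ∈ powSpan := by
  induction hv using Submodule.span_induction with
  | mem u h =>
    obtain ⟨d, β, hd, hβ, rfl⟩ := h
    simpa only [mul_assoc, Pi.mul_apply] using mem_powSpan (hc.mul hd) hβ
  | zero =>
    simp only [Pi.zero_apply, mul_zero]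
    exact powSpan.zero_mem
  | add u v _ _ hu hv =>
    have := powSpan.add_mem hu hv
    convert! this using 1
    ext z n
    exact mul_add _ _ _
  | smul x u _ hu =>
    have := powSpan.smul_mem x hu
    convert! this using 1
    ext z n
    simp only [Pi.smul_apply, smul_eq_mul]
    ring

/-- Exponents add and stay admissible. The restriction `1 ≤ n` is due to powers of `0`, for which
the exponent law can fail. -/
theorem exists_mul_mem_powSpan {u v : ℂ → ℕ → ℂ} (hu : u ∈ powSpan) (hv : v ∈ powSpan) :
    ∃ w ∈ powSpan, ∀ z n, 1 ≤ n → w z n = u z n * v z n := by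
  induction hu using Submodule.span_induction with
  | mem u h =>
    obtain ⟨c, β, hc, hβ, rfl⟩ := h
    induction hv using Submodule.span_induction with
    | mem v h =>
      obtain ⟨d, γ, hd, hγ, rfl⟩ := h
      refine ⟨_, mem_powSpan (hc.mul hd) (hβ.add hγ), fun z n hn => ?_⟩
      rw [Complex.cpow_add _ _ (by exact_mod_cast (by omega : n ≠ 0)), Pi.mul_apply]
      ring
    | zero => exact ⟨0, powSpan.zero_mem, by simp⟩
    | add u v _ _ hu hv =>
      obtain ⟨w, hw, h⟩ := hu
      obtain ⟨w', hw', h'⟩ := hv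
      refine ⟨w + w', powSpan.add_mem hw hw', fun z n hn => ?_⟩
      simp only [Pi.add_apply, h z n hn, h' z n hn, mul_add]
    | smul x u _ hu =>
      obtain ⟨w, hw, h⟩ := hu
      refine ⟨x • w, powSpan.smul_mem x hw, fun z n hn => ?_⟩
      simp only [Pi.smul_apply, smul_eq_mul, h z n hn]
      ring
  | zero => exact ⟨0, powSpan.zero_mem, by simp⟩
  | add u v _ _ hu hv =>
    obtain ⟨w, hw, h⟩ := hu
    obtain ⟨w', hw', h'⟩ := hv
    refine ⟨w + w', powSpan.add_mem hw hw', fun z n hn => ?_⟩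
    simp only [Pi.add_apply, h z n hn, h' z n hn, add_mul]
  | smul x u _ hu =>
    obtain ⟨w, hw, h⟩ := hu
    refine ⟨x • w, powSpan.smul_mem x hw, fun z n hn => ?_⟩
    simp only [Pi.smul_apply, smul_eq_mul, h z n hn]
    ring

theorem exists_bdd_of_mem_powSpan {v : ℂ → ℕ → ℂ} (hv : v ∈ powSpan) : ∃ a, Bdd a v := by
  induction hv using Submodule.span_induction with
  | mem u h =>
    obtain ⟨d, β, hd, hβ, rfl⟩ := h
    exact ⟨_, (bdd_cpow hβ.1 (lt_add_one _)).mero_mul hd⟩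
  | zero => exact ⟨0, bdd_zero 0⟩
  | add u v _ _ hu hv =>
    obtain ⟨a, ha⟩ := hu
    obtain ⟨b, hb⟩ := hv
    exact ⟨max a b, (ha.mono (le_max_left _ _)).add (hb.mono (le_max_right _ _))⟩
  | smul x u _ hu =>
    obtain ⟨a, ha⟩ := hu
    exact ⟨a, ha.mero_mul (MeromorphicAt.const x 0)⟩

theorem hasFinitePart_of_mem_powSpan {v : ℂ → ℕ → ℂ} (hv : v ∈ powSpan) :
    ∀ᶠ z in 𝓝[≠] (0 : ℂ), HasFinitePart (v z) 0 := by
  induction hv using Submodule.span_induction with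
  | mem u h =>
    obtain ⟨d, β, hd, hβ, rfl⟩ := h
    filter_upwards [hβ.eventually_ne_zero] with z hz
    refine ⟨{(β z, 0)}, fun _ => d z, by simpa using hz.symm, ?_⟩
    simp
  | zero =>
    refine Eventually.of_forall fun z => hasFinitePart_of_tendsto ?_
    exact tendsto_const_nhds
  | add u v _ _ hu hv =>
    filter_upwards [hu, hv] with z h1 h2
    have := h1.add h2
    rw [add_zero] at this
    exact this
  | smul x u _ hu =>
    filter_upwards [hu] with z h1
    have := h1.const_mul x
    rw [mul_zero] at this
    exact this

theorem Bdd.tendsto_zero {a : ℝ} (ha : a < 0) {u : ℂ → ℕ → ℂ} (hu : Bdd a u) :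
    ∀ᶠ z in 𝓝[≠] (0 : ℂ), Tendsto (u z) atTop (𝓝 0) := by
  obtain ⟨p, C, hC, hu⟩ := hu
  filter_upwards [hu, self_mem_nhdsWithin] with z hz hz0
  have hz0 : 0 < ‖z‖ ^ p := pow_pos (norm_pos_iff.2 hz0) p
  have h1 : Tendsto (fun n : ℕ => C * (n : ℝ) ^ a / ‖z‖ ^ p) atTop (𝓝 0) := by
    have := (((tendsto_rpow_neg_atTop (neg_pos.2 ha)).comp tendsto_natCast_atTop_atTop).const_mul
      C).div_const (‖z‖ ^ p)
    simpa using this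
  refine squeeze_zero_norm' ?_ h1
  filter_upwards [eventually_ge_atTop 1] with n hn
  rw [le_div_iff₀ hz0, mul_comm]
  exact (hz n hn).2

/-! ### Families with an asymptotic expansion -/

/-- The family `u` has an asymptotic expansion along admissible powers. -/
def Expandable (u : ℂ → ℕ → ℂ) : Prop :=
  ∀ M : ℝ, ∃ v ∈ powSpan, Bdd (-M) (fun z n => u z n - v z n)

theorem Expandable.congr {u v : ℂ → ℕ → ℂ} (hu : Expandable u)
    (h : ∀ᶠ z in 𝓝[≠] (0 : ℂ), ∀ n : ℕ, 1 ≤ n → u z n = v z n) : Expandable v := by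
  intro M
  obtain ⟨w, hw, hb⟩ := hu M
  exact ⟨w, hw, hb.congr (h.mono fun z hz n hn => by rw [hz n hn])⟩

theorem expandable_of_mem_powSpan {v : ℂ → ℕ → ℂ} (hv : v ∈ powSpan) : Expandable v := fun M =>
  ⟨v, hv, (bdd_zero _).congr (Eventually.of_forall fun z n _ => by simp)⟩

theorem Expandable.add {u v : ℂ → ℕ → ℂ} (hu : Expandable u) (hv : Expandable v) :
    Expandable (fun z n => u z n + v z n) := by
  intro M
  obtain ⟨w, hw, hb⟩ := hu M
  obtain ⟨w', hw', hb'⟩ := hv M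
  exact ⟨w + w', powSpan.add_mem hw hw', (hb.add hb').congr
    (Eventually.of_forall fun z n _ => by simp only [Pi.add_apply]; ring)⟩

theorem Expandable.mero_mul {c : ℂ → ℂ} (hc : MeromorphicAt c 0) {u : ℂ → ℕ → ℂ}
    (hu : Expandable u) : Expandable (fun z n => c z * u z n) := by
  intro M
  obtain ⟨w, hw, hb⟩ := hu M
  exact ⟨_, mero_mul_mem_powSpan hc hw, (hb.mero_mul hc).congr
    (Eventually.of_forall fun z n _ => by ring)⟩

theorem Expandable.exists_bdd {u : ℂ → ℕ → ℂ} (hu : Expandable u) : ∃ a, Bdd a u := by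
  obtain ⟨w, hw, hb⟩ := hu 0
  obtain ⟨a, ha⟩ := exists_bdd_of_mem_powSpan hw
  refine ⟨max a (-0), ((ha.mono (le_max_left _ _)).add (hb.mono (le_max_right _ _))).congr ?_⟩
  exact Eventually.of_forall fun z n _ => by ring

/-- Write `u v - u' v' = u (v - v') + (u - u') v'`. The expansion of `v` must be pushed far enough
to offset the growth of `u`, then that of `u` to offset the growth of `v'`. -/
theorem Expandable.mul {u v : ℂ → ℕ → ℂ} (hu : Expandable u) (hv : Expandable v) :
    Expandable (fun z n => u z n * v z n) := by
  intro M
  obtain ⟨a, ha⟩ := hu.exists_bdd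
  obtain ⟨v', hv', hbv⟩ := hv (M + a)
  obtain ⟨b, hb⟩ := exists_bdd_of_mem_powSpan hv'
  obtain ⟨u', hu', hbu⟩ := hu (M + b)
  obtain ⟨w, hw, h⟩ := exists_mul_mem_powSpan hu' hv'
  refine ⟨w, hw, (((ha.mul hbv).mono (by linarith)).add ((hbu.mul hb).mono (by linarith))).congr
    (Eventually.of_forall fun z n hn => ?_)⟩
  rw [h z n hn]
  ring

theorem expandable_zero : Expandable 0 := expandable_of_mem_powSpan powSpan.zero_mem

/-- The family `u` is the sum of `c(z)` and of an expandable family. -/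
def Good (u : ℂ → ℕ → ℂ) (c : ℂ → ℂ) : Prop :=
  MeromorphicAt c 0 ∧ Expandable (fun z n => u z n - c z)

theorem Good.congr {u v : ℂ → ℕ → ℂ} {c : ℂ → ℂ} (hu : Good u c)
    (h : ∀ᶠ z in 𝓝[≠] (0 : ℂ), ∀ n : ℕ, 1 ≤ n → u z n = v z n) : Good v c :=
  ⟨hu.1, hu.2.congr (h.mono fun z hz n hn => by rw [hz n hn])⟩

theorem Expandable.good {u : ℂ → ℕ → ℂ} (hu : Expandable u) : Good u 0 :=
  ⟨MeromorphicAt.const 0 0, by simpa using hu⟩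

theorem good_const {c : ℂ → ℂ} (hc : MeromorphicAt c 0) : Good (fun z _ => c z) c :=
  ⟨hc, by simp only [sub_self]; exact expandable_zero⟩

theorem Good.add {u v : ℂ → ℕ → ℂ} {c d : ℂ → ℂ} (hu : Good u c) (hv : Good v d) :
    Good (fun z n => u z n + v z n) (fun z => c z + d z) :=
  ⟨hu.1.add hv.1, (hu.2.add hv.2).congr (Eventually.of_forall fun z n _ => by ring)⟩

theorem Expandable.mul_good {u v : ℂ → ℕ → ℂ} {c : ℂ → ℂ} (hu : Expandable u) (hv : Good v c) :
    Expandable (fun z n => u z n * v z n) :=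
  ((hu.mul hv.2).add (hu.mero_mul hv.1)).congr (Eventually.of_forall fun z n _ => by ring)

theorem Good.mul {u v : ℂ → ℕ → ℂ} {c d : ℂ → ℂ} (hu : Good u c) (hv : Good v d) :
    Good (fun z n => u z n * v z n) (fun z => c z * d z) :=
  ⟨hu.1.mul hv.1, ((hu.2.mul_good hv).add (hv.2.mero_mul hu.1)).congr
    (Eventually.of_forall fun z n _ => by ring)⟩

theorem Good.hasFinitePart {u : ℂ → ℕ → ℂ} {c : ℂ → ℂ} (hu : Good u c) :
    ∀ᶠ z in 𝓝[≠] (0 : ℂ), HasFinitePart (u z) (c z) := by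
  obtain ⟨v, hv, hb⟩ := hu.2 1
  filter_upwards [hasFinitePart_of_mem_powSpan hv, hb.tendsto_zero (by norm_num)] with z h1 h2
  have h3 := (h1.add (hasFinitePart_of_tendsto h2)).add
    (hasFinitePart_of_tendsto (tendsto_const_nhds (x := c z)))
  simpa using h3

theorem Good.unique {u : ℂ → ℕ → ℂ} {c d : ℂ → ℂ} (hu : Good u c) (hu' : Good u d) :
    ∀ᶠ z in 𝓝[≠] (0 : ℂ), c z = d z := by
  filter_upwards [hu.hasFinitePart, hu'.hasFinitePart] with z h1 h2
  exact h1.unique h2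

/-! ### Summation of expandable families -/

theorem exists_punctured_ball {P : ℂ → Prop} (h : ∀ᶠ z in 𝓝[≠] (0 : ℂ), P z) :
    ∃ r > 0, ∀ z ∈ Metric.ball (0 : ℂ) r \ {0}, P z := by
  rw [eventually_nhdsWithin_iff, Metric.eventually_nhds_iff_ball] at h
  obtain ⟨r, hr, h⟩ := h
  exact ⟨r, hr, fun z hz => h z hz.1 hz.2⟩

theorem isOpen_puncturedBall (r : ℝ) : IsOpen (Metric.ball (0 : ℂ) r \ {0}) :=
  Metric.isOpen_ball.sdiff isClosed_singleton

theorem puncturedBall_mem {r : ℝ} (hr : 0 < r) :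
    Metric.ball (0 : ℂ) r \ {0} ∈ 𝓝[≠] (0 : ℂ) :=
  sdiff_mem_nhdsWithin_compl (Metric.ball_mem_nhds 0 hr) {0}

/-- Riemann's removable singularity theorem. -/
theorem meromorphicAt_of_bounded {f : ℂ → ℂ} {r C : ℝ} (hr : 0 < r)
    (hd : DifferentiableOn ℂ f (Metric.ball 0 r \ {0}))
    (hb : ∀ z ∈ Metric.ball (0 : ℂ) r \ {0}, ‖f z‖ ≤ C) : MeromorphicAt f 0 := by
  have h := Complex.differentiableOn_update_limUnder_of_bddAbove (Metric.ball_mem_nhds 0 hr) hd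
    ⟨C, by rintro _ ⟨z, hz, rfl⟩; exact hb z hz⟩
  refine MeromorphicAt.congr (h.analyticAt (Metric.ball_mem_nhds 0 hr)).meromorphicAt ?_
  filter_upwards [self_mem_nhdsWithin] with z hz
  exact Function.update_of_ne hz _ _

/-- Partial sums of a family of sequences. -/
def partialSum (u : ℂ → ℕ → ℂ) (z : ℂ) (N : ℕ) : ℂ := ∑ n ∈ Finset.Icc 1 N, u z n

/-- The partial sums of `u` have an expansion up to `O(N ^ (-M))`. -/
def SumExpands (M : ℝ) (u : ℂ → ℕ → ℂ) : Prop :=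
  ∃ c : ℂ → ℂ, MeromorphicAt c 0 ∧ ∃ v ∈ powSpan,
    Bdd (-M) (fun z N => partialSum u z N - c z - v z N)

theorem partialSum_eq_range (u : ℂ → ℕ → ℂ) (z : ℂ) (N : ℕ) :
    partialSum u z N = ∑ n ∈ Finset.range N, u z (n + 1) := by
  rw [partialSum, Finset.range_eq_Ico, Finset.sum_Ico_add' (fun n => u z n) 0 N 1]
  rfl

theorem SumExpands.congr {M : ℝ} {u v : ℂ → ℕ → ℂ} (hu : SumExpands M u)
    (h : ∀ᶠ z in 𝓝[≠] (0 : ℂ), ∀ n : ℕ, 1 ≤ n → u z n = v z n) : SumExpands M v := by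
  obtain ⟨c, hc, w, hw, hb⟩ := hu
  refine ⟨c, hc, w, hw, hb.congr (h.mono fun z hz N _ => ?_)⟩
  rw [partialSum, partialSum, Finset.sum_congr rfl fun n hn => hz n (Finset.mem_Icc.1 hn).1]

theorem SumExpands.add {M : ℝ} {u v : ℂ → ℕ → ℂ} (hu : SumExpands M u) (hv : SumExpands M v) :
    SumExpands M (fun z n => u z n + v z n) := by
  obtain ⟨c, hc, w, hw, hb⟩ := hu
  obtain ⟨c', hc', w', hw', hb'⟩ := hv
  refine ⟨_, hc.add hc', _, powSpan.add_mem hw hw', (hb.add hb').congr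
    (Eventually.of_forall fun z N _ => ?_)⟩
  simp only [partialSum, Finset.sum_add_distrib, Pi.add_apply]
  ring

theorem SumExpands.mero_mul {M : ℝ} {c : ℂ → ℂ} (hc : MeromorphicAt c 0) {u : ℂ → ℕ → ℂ}
    (hu : SumExpands M u) : SumExpands M (fun z n => c z * u z n) := by
  obtain ⟨d, hd, w, hw, hb⟩ := hu
  refine ⟨_, hc.mul hd, _, mero_mul_mem_powSpan hc hw, (hb.mero_mul hc).congr
    (Eventually.of_forall fun z N _ => ?_)⟩
  simp only [partialSum, ← Finset.mul_sum, Pi.mul_apply]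
  ring

theorem SumExpands.zero (M : ℝ) : SumExpands M 0 :=
  ⟨0, MeromorphicAt.const 0 0, 0, powSpan.zero_mem,
    (bdd_zero _).congr (Eventually.of_forall fun z N _ => by simp [partialSum])⟩

theorem SumExpands.sum {M : ℝ} {ι : Type*} (s : Finset ι) {u : ι → ℂ → ℕ → ℂ}
    (hu : ∀ i ∈ s, SumExpands M (u i)) : SumExpands M (fun z n => ∑ i ∈ s, u i z n) := by
  classical
  induction s using Finset.induction_on with
  | empty =>
    simp only [Finset.sum_empty]
    exact SumExpands.zero M
  | insert i s hi ih =>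
    simp only [Finset.sum_insert hi]
    exact (hu i (Finset.mem_insert_self _ _)).add
      (ih fun j hj => hu j (Finset.mem_insert_of_mem hj))

theorem SumExpands.sub {M : ℝ} {u v : ℂ → ℕ → ℂ} (hu : SumExpands M u) (hv : SumExpands M v) :
    SumExpands M (fun z n => u z n - v z n) :=
  (hu.add (hv.mero_mul (MeromorphicAt.const (-1) 0))).congr
    (Eventually.of_forall fun z n _ => by ring)

theorem summable_succ_rpow_neg_two : Summable fun n : ℕ => ((n : ℝ) + 1) ^ (-2 : ℝ) := by
  have := (Real.summable_nat_rpow (p := -2)).2 (by norm_num)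
  exact ((summable_nat_add_iff 1).2 this).congr fun n => by push_cast; rfl

/-- The partial sums of a rapidly decaying family converge rapidly. -/
theorem Bdd.sumExpands {M : ℝ} (hM : 0 ≤ M) {u : ℂ → ℕ → ℂ} (hu : Bdd (-M - 2) u) :
    SumExpands M u := by
  obtain ⟨p, C, hC, hu⟩ := hu
  obtain ⟨r, hr, h⟩ := exists_punctured_ball hu
  set U : Set ℂ := Metric.ball (0 : ℂ) r \ {0} with hU
  set b : ℕ → ℝ := fun n => C * ((n : ℝ) + 1) ^ (-2 : ℝ) with hb
  have hbs : Summable b := summable_succ_rpow_neg_two.mul_left C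
  set F : ℕ → ℂ → ℂ := fun n z => z ^ p * u z (n + 1) with hF
  have hFd : ∀ n, DifferentiableOn ℂ (F n) U := fun n z hz =>
    ((differentiableAt_id.pow p).mul (h z hz (n + 1) (by omega)).1).differentiableWithinAt
  have hFM : ∀ n, ∀ z ∈ U, ‖F n z‖ ≤ C * ((n : ℝ) + 1) ^ (-M - 2) := by
    intro n z hz
    have := (h z hz (n + 1) (by omega)).2
    rw [hF, norm_mul, norm_pow]
    push_cast at this
    exact this
  have hF2 : ∀ n, ∀ z ∈ U, ‖F n z‖ ≤ b n := by
    intro n z hz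
    refine (hFM n z hz).trans (mul_le_mul_of_nonneg_left ?_ hC)
    exact Real.rpow_le_rpow_of_exponent_le (by linarith [n.cast_nonneg (α := ℝ)]) (by linarith)
  have hFs : ∀ z ∈ U, Summable fun n => F n z := fun z hz =>
    Summable.of_norm_bounded hbs fun n => hF2 n z hz
  have hfd : DifferentiableOn ℂ (fun z => ∑' n, F n z) U :=
    Complex.differentiableOn_tsum_of_summable_norm hbs hFd (isOpen_puncturedBall r) hF2
  have hfm : MeromorphicAt (fun z => ∑' n, F n z) 0 :=
    meromorphicAt_of_bounded (C := ∑' n, b n) hr hfd fun z hz =>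
      tsum_of_norm_bounded hbs.hasSum fun n => hF2 n z hz
  set c : ℂ → ℂ := fun z => (z ^ p)⁻¹ * ∑' n, F n z with hc
  have hcm : MeromorphicAt c 0 := ((MeromorphicAt.id (0 : ℂ)).pow p).inv.mul hfm
  refine ⟨c, hcm, 0, powSpan.zero_mem, p, ∑' n, b n,
    tsum_nonneg fun n => by positivity, ?_⟩
  filter_upwards [puncturedBall_mem hr] with z hz N hN
  have hz0 : z ≠ 0 := hz.2
  constructor
  · have hcd : DifferentiableAt ℂ c z :=
      ((differentiableAt_id.pow p).inv (pow_ne_zero p hz0)).mul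
        (hfd.differentiableAt ((isOpen_puncturedBall r).mem_nhds hz))
    simp only [Pi.zero_apply, sub_zero]
    refine DifferentiableAt.sub ?_ hcd
    exact DifferentiableAt.fun_sum fun n hn => (h z hz n (Finset.mem_Icc.1 hn).1).1
  · have e1 : z ^ p * (partialSum u z N - c z - (0 : ℂ → ℕ → ℂ) z N) =
        -∑' n, F (n + N) z := by
      have e2 := (hFs z hz).sum_add_tsum_nat_add N
      have e3 : z ^ p * c z = ∑' n, F n z := by
        rw [hc, mul_inv_cancel_left₀ (pow_ne_zero p hz0)]
      rw [partialSum_eq_range, Pi.zero_apply, Pi.zero_apply, sub_zero, mul_sub, e3, ← e2,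
        Finset.mul_sum]
      ring
    have hN' : (1 : ℝ) ≤ N := by exact_mod_cast hN
    rw [← norm_pow, ← norm_mul, e1, norm_neg, ← tsum_mul_right]
    refine tsum_of_norm_bounded (hbs.mul_right _).hasSum fun n => ?_
    refine (hFM (n + N) z hz).trans ?_
    rw [hb, mul_assoc]
    refine mul_le_mul_of_nonneg_left ?_ hC
    have hn : (0 : ℝ) ≤ n := n.cast_nonneg
    push_cast
    -- The factor with exponent `-2` makes the tail summable, the factor with exponent `-M` gives
    -- its decay in `N`.
    rw [show -M - 2 = -2 + -M by ring, Real.rpow_add (by positivity)]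
    refine mul_le_mul ?_ ?_ (by positivity) (by positivity)
    · exact Real.rpow_le_rpow_of_nonpos (by positivity) (by linarith) (by norm_num)
    · exact Real.rpow_le_rpow_of_nonpos (by positivity) (by linarith) (by linarith)

theorem cpow_natCast_succ_eq {n : ℕ} (hn : 1 ≤ n) (b : ℂ) :
    ((n + 1 : ℕ) : ℂ) ^ b = (n : ℂ) ^ b * (1 + ((1 / (n : ℝ) : ℝ) : ℂ)) ^ b := by
  have hn' : (0 : ℝ) < n := by exact_mod_cast hn
  have h := Complex.mul_cpow_ofReal_nonneg hn'.le
    (show (0 : ℝ) ≤ 1 + 1 / (n : ℝ) by positivity) b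
  have e1 : (n : ℝ) * (1 + 1 / (n : ℝ)) = ((n + 1 : ℕ) : ℝ) := by
    push_cast
    field_simp
  rw [← Complex.ofReal_mul, e1] at h
  push_cast at h ⊢
  exact h

theorem cpow_sub_natCast {n : ℕ} (hn : 1 ≤ n) (b : ℂ) (j : ℕ) :
    (n : ℂ) ^ (b - j) = (n : ℂ) ^ b * ((1 / (n : ℝ) : ℝ) : ℂ) ^ j := by
  have hn' : (n : ℂ) ≠ 0 := by exact_mod_cast (by omega : n ≠ 0)
  rw [Complex.cpow_sub _ _ hn', Complex.cpow_natCast]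
  push_cast
  rw [one_div, inv_pow, div_eq_mul_inv]

/-- The remainder of the expansion of `(n + 1) ^ b` along the powers of `n`. -/
def powRem (b : ℂ → ℂ) (L : ℕ) (z : ℂ) (n : ℕ) : ℂ :=
  ((n + 1 : ℕ) : ℂ) ^ b z - ∑ j ∈ Finset.range L, bin j (b z) * (n : ℂ) ^ (b z - j)

theorem bdd_powRem {b : ℂ → ℂ} (hb : AnalyticAt ℂ b 0) (L : ℕ) {a : ℝ}
    (ha : (b 0).re - L < a) : Bdd a (powRem b L) := by
  obtain ⟨C, hC, h⟩ := exists_norm_one_add_cpow_sub_le L (‖b 0‖ + 1) 1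
  refine ⟨0, C, hC, ?_⟩
  have h1 : ∀ᶠ z in 𝓝[≠] (0 : ℂ), (b z).re < a + L := nhdsWithin_le_nhds
    ((Complex.continuous_re.continuousAt.comp hb.continuousAt).eventually_lt_const
      (by simp; linarith))
  have h2 : ∀ᶠ z in 𝓝[≠] (0 : ℂ), AnalyticAt ℂ b z :=
    nhdsWithin_le_nhds hb.eventually_analyticAt
  have h3 : ∀ᶠ z in 𝓝[≠] (0 : ℂ), ‖b z‖ < ‖b 0‖ + 1 := nhdsWithin_le_nhds
    (hb.continuousAt.norm.eventually_lt_const (lt_add_one _))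
  filter_upwards [h1, h2, h3] with z hz1 hz2 hz3 n hn
  have hn' : (n : ℂ) ≠ 0 := by exact_mod_cast (by omega : n ≠ 0)
  have hnpos : (0 : ℝ) < n := by exact_mod_cast hn
  have hn1 : (1 : ℝ) ≤ n := by exact_mod_cast hn
  constructor
  · refine DifferentiableAt.sub (hz2.differentiableAt.const_cpow
      (Or.inl (by exact_mod_cast n.succ_ne_zero))) ?_
    refine DifferentiableAt.fun_sum fun j _ => DifferentiableAt.mul
      ((differentiable_bin j).differentiableAt.comp z hz2.differentiableAt) ?_
    exact (hz2.differentiableAt.sub_const _).const_cpow (Or.inl hn')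
  · rw [pow_zero, one_mul, powRem, cpow_natCast_succ_eq hn]
    have e : ∑ j ∈ Finset.range L, bin j (b z) * (n : ℂ) ^ (b z - j) = (n : ℂ) ^ b z *
        ∑ j ∈ Finset.range L, bin j (b z) * ((1 / (n : ℝ) : ℝ) : ℂ) ^ j := by
      rw [Finset.mul_sum]
      refine Finset.sum_congr rfl fun j _ => ?_
      rw [cpow_sub_natCast hn]
      ring
    rw [e, ← mul_sub, norm_mul, Complex.norm_natCast_cpow_of_pos (by omega)]
    calc (n : ℝ) ^ (b z).re * ‖_‖ ≤ (n : ℝ) ^ (a + L) * (C * (1 / (n : ℝ)) ^ L) := by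
          refine mul_le_mul (Real.rpow_le_rpow_of_exponent_le hn1 hz1.le)
            (h _ hz3.le _ (by positivity) ?_) (norm_nonneg _) (by positivity)
          rw [div_le_one hnpos]
          exact hn1
      _ = C * (n : ℝ) ^ a := by
          rw [Real.rpow_add hnpos, Real.rpow_natCast, one_div, inv_pow]
          field_simp

/-- Sums of powers have asymptotic expansions. -/
theorem sumExpands_cpow {M : ℝ} (hM : 0 ≤ M) (k : ℕ) {β : ℂ → ℂ} (hβ : AdmExp β)
    (hk : (β 0).re < k - M - 2) : SumExpands M (fun z n => (n : ℂ) ^ β z) := by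
  induction k using Nat.strong_induction_on generalizing β with
  | _ k ih =>
    rcases k with _ | k
    · refine (bdd_cpow hβ.1 (a := -M - 2) ?_).sumExpands hM
      simp at hk
      linarith
    · set b : ℂ → ℂ := fun z => β z + 1 with hbdef
      have hb : AdmExp b := hβ.add_const 1
      have hbin : ∀ j, MeromorphicAt (fun z => bin j (b z)) 0 := fun j =>
        (((differentiable_bin j).analyticAt _).comp hb.1).meromorphicAt
      -- With `k + 2` terms the remainder has exponent `Re β(0) + 1 - (k + 2)`, which is below `-M -
      -- 2` by `hk`.
      have hrem : Bdd (-M - 2) (powRem b (k + 2)) := by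
        refine bdd_powRem hb.1 _ ?_
        simp only [hbdef, Complex.add_re, Complex.one_re]
        push_cast at hk ⊢
        linarith
      have hterm : ∀ j, (fun (z : ℂ) (n : ℕ) => bin (j + 1) (b z) *
          (n : ℂ) ^ (b z - (j + 1 : ℕ))) ∈ powSpan := fun j =>
        mem_powSpan (hbin _) (hb.sub_const _)
      have h1 : SumExpands M (fun z n => ((n + 1 : ℕ) : ℂ) ^ b z - (n : ℂ) ^ b z) := by
        -- The partial sums telescope to `(N + 1) ^ b - 1`; the first power is expanded along powers
        -- of `N`.
        refine ⟨fun _ => -1, MeromorphicAt.const _ _, (fun (z : ℂ) (n : ℕ) => (n : ℂ) ^ b z) +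
          ∑ j ∈ Finset.range (k + 1), fun (z : ℂ) (n : ℕ) => bin (j + 1) (b z) *
          (n : ℂ) ^ (b z - (j + 1 : ℕ)), powSpan.add_mem ?_ (powSpan.sum_mem fun j _ => hterm j),
          (hrem.mono (by linarith)).congr (Eventually.of_forall fun z N hN => ?_)⟩
        · simpa using mem_powSpan (MeromorphicAt.const 1 0) hb
        · rw [partialSum_eq_range,
            Finset.sum_range_sub (fun n => ((n + 1 : ℕ) : ℂ) ^ b z), powRem,
            Finset.sum_range_succ']
          simp [bin]
          ring
      have h2 : ∀ j, SumExpands M (fun (z : ℂ) (n : ℕ) => bin (j + 2) (b z) *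
          (n : ℂ) ^ (b z - (j + 2 : ℕ))) := by
        intro j
        refine (ih k (by omega) (hb.sub_const ((j + 2 : ℕ) : ℂ)) ?_).mero_mul (hbin _)
        simp only [hbdef, Complex.sub_re, Complex.add_re, Complex.one_re, Complex.natCast_re]
        push_cast at hk ⊢
        linarith [j.cast_nonneg (α := ℝ)]
      have h3 := (h1.sub (SumExpands.sum (Finset.range k) fun j _ => h2 j)).sub
        (hrem.sumExpands hM)
      -- Solving for the leading term `b(z) n ^ β(z)` requires division by `b(z)`. It is nonzero for
      -- `z ≠ 0` near `0`, and if `b 0 = 0` this is the source of a pole.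
      refine (h3.mero_mul hb.1.meromorphicAt.inv).congr ?_
      filter_upwards [hb.eventually_ne_zero] with z hz n hn
      rw [Pi.inv_apply, powRem, Finset.sum_range_succ', Finset.sum_range_succ']
      simp only [bin, Nat.cast_zero, sub_zero, zero_add, Nat.cast_one, one_mul]
      have e : b z - 1 = β z := by simp [hbdef]
      rw [e]
      field_simp
      ring

theorem sumExpands_of_mem_powSpan {M : ℝ} (hM : 0 ≤ M) {v : ℂ → ℕ → ℂ} (hv : v ∈ powSpan) :
    SumExpands M v := by
  induction hv using Submodule.span_induction with
  | mem u h =>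
    obtain ⟨c, β, hc, hβ, rfl⟩ := h
    obtain ⟨k, hk⟩ := exists_nat_gt ((β 0).re + M + 2)
    exact (sumExpands_cpow hM k hβ (by linarith)).mero_mul hc
  | zero => exact SumExpands.zero M
  | add u v _ _ hu hv => exact hu.add hv
  | smul x u _ hu => exact hu.mero_mul (MeromorphicAt.const x 0)

theorem Expandable.sumExpands {u : ℂ → ℕ → ℂ} (hu : Expandable u) {M : ℝ} (hM : 0 ≤ M) :
    SumExpands M u := by
  obtain ⟨v, hv, hb⟩ := hu (M + 2)
  refine ((sumExpands_of_mem_powSpan hM hv).add ((hb.mono ?_).sumExpands hM)).congr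
    (Eventually.of_forall fun z n _ => by ring)
  linarith

/-- The partial sums of an expandable family have an expansion. -/
theorem Expandable.exists_good_partialSum {u : ℂ → ℕ → ℂ} (hu : Expandable u) :
    ∃ c, Good (partialSum u) c := by
  have hfp : ∀ {M : ℝ}, 0 < M → ∀ {c : ℂ → ℂ} {v : ℂ → ℕ → ℂ}, v ∈ powSpan →
      Bdd (-M) (fun z N => partialSum u z N - c z - v z N) →
      ∀ᶠ z in 𝓝[≠] (0 : ℂ), HasFinitePart (partialSum u z) (c z) := by
    intro M hM c v hv hb
    filter_upwards [hasFinitePart_of_mem_powSpan hv, hb.tendsto_zero (by linarith)] with z h1 h2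
    have h3 := (h1.add (hasFinitePart_of_tendsto h2)).add
      (hasFinitePart_of_tendsto (tendsto_const_nhds (x := c z)))
    simpa using h3
  obtain ⟨c, hc, v, hv, hb⟩ := hu.sumExpands zero_le_one
  refine ⟨c, hc, fun M => ?_⟩
  -- The constant obtained for each precision could depend on it; being a finite part, it agrees
  -- with `c` near `0`.
  obtain ⟨c', hc', v', hv', hb'⟩ := hu.sumExpands (M := |M| + 1) (by positivity)
  refine ⟨v', hv', (hb'.mono (by linarith [le_abs_self M])).congr ?_⟩
  filter_upwards [hfp one_pos hv hb, hfp (by positivity) hv' hb'] with z h1 h2 N _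
  rw [h1.unique h2]

/-! ### The regularised nested sums -/

theorem Expandable.sum {ι : Type*} (s : Finset ι) {u : ι → ℂ → ℕ → ℂ}
    (hu : ∀ i ∈ s, Expandable (u i)) : Expandable (fun z n => ∑ i ∈ s, u i z n) := by
  classical
  induction s using Finset.induction_on with
  | empty =>
    simp only [Finset.sum_empty]
    exact expandable_zero
  | insert i s hi ih =>
    simp only [Finset.sum_insert hi]
    exact (hu i (Finset.mem_insert_self _ _)).add
      (ih fun j hj => hu j (Finset.mem_insert_of_mem hj))

/-- The sequences `n ↦ x z n` sampled from a family of functions. -/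
def sample (x : ℂ → ℝ → ℂ) (z : ℂ) (n : ℕ) : ℂ := x z n

section SimpleFamily

variable {W : Set ℂ} (hW : IsOpen W) (h0 : (0 : ℂ) ∈ W)
include hW h0

theorem exists_simple_remainder_bound {α : ℂ → ℂ} {f : ℂ → ℝ → ℂ}
    (hf : IsSimpleHolFamily W α f) : ∃ c : ℕ → ℂ → ℂ, (∀ j, AnalyticAt ℂ (c j) 0) ∧
      ∀ N : ℕ, ∃ (J : ℕ) (C : ℝ), 0 ≤ C ∧ ∀ᶠ z in 𝓝 (0 : ℂ), ∀ n : ℕ, 1 ≤ n →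
        ‖f z n - ∑ j ∈ Finset.range J, c j z * (n : ℂ) ^ (α z - j)‖ ≤ C * (n : ℝ) ^ (-(N : ℝ)) := by
  obtain ⟨c, hc, -, he⟩ := hf.expansion
  obtain ⟨r, hr, hrW⟩ := Metric.nhds_basis_closedBall.mem_iff.1 (hW.mem_nhds h0)
  refine ⟨c, fun j => (hc j).analyticAt (hW.mem_nhds h0), fun N => ?_⟩
  obtain ⟨J, hJ⟩ := he N _ (isCompact_closedBall 0 r) hrW
  obtain ⟨C, hC⟩ := hJ 0 0
  refine ⟨J, |C|, abs_nonneg C, ?_⟩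
  filter_upwards [Metric.closedBall_mem_nhds (0 : ℂ) hr] with z hz n hn
  have h := hC z hz n (by exact_mod_cast hn)
  simp only [iteratedDeriv_zero, Nat.cast_zero, sub_zero, Complex.ofReal_natCast] at h
  exact h.trans (mul_le_mul_of_nonneg_right (le_abs_self C) (by positivity))

theorem IsSimpleHolFamily.expandable {α : ℂ → ℂ} {f : ℂ → ℝ → ℂ}
    (hf : IsSimpleHolFamily W α f) (hα : (deriv α 0).re < 0) : Expandable (sample f) := by
  obtain ⟨c, hc, h⟩ := exists_simple_remainder_bound hW h0 hf
  have hα' : AdmExp α := ⟨hf.order_holomorphic.analyticAt (hW.mem_nhds h0), hα⟩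
  intro M
  obtain ⟨N, hN⟩ := exists_nat_ge M
  obtain ⟨J, C, hC, hb⟩ := h N
  refine ⟨∑ j ∈ Finset.range J, fun (z : ℂ) (n : ℕ) => c j z * (n : ℂ) ^ (α z - j),
    powSpan.sum_mem fun j _ => mem_powSpan (hc j).meromorphicAt (hα'.sub_const _), 0, C, hC, ?_⟩
  have hWn : ∀ᶠ z in 𝓝 (0 : ℂ), z ∈ W := hW.mem_nhds h0
  have hcn : ∀ᶠ z in 𝓝 (0 : ℂ), ∀ j ∈ Finset.range J, AnalyticAt ℂ (c j) z :=
    (Filter.eventually_all_finset _).2 fun j _ => (hc j).eventually_analyticAt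
  refine nhdsWithin_le_nhds ?_
  filter_upwards [hb, hWn, hcn, hα'.1.eventually_analyticAt] with z h1 h2 h3 h4 n hn
  have hn' : (n : ℂ) ≠ 0 := by exact_mod_cast (by omega : n ≠ 0)
  simp only [Finset.sum_apply, sample]
  refine ⟨?_, ?_⟩
  · have := (hf.holomorphic 0 n).differentiableAt (hW.mem_nhds h2)
    simp only [iteratedDeriv_zero] at this
    refine this.sub (DifferentiableAt.fun_sum fun j hj => (h3 j hj).differentiableAt.mul ?_)
    exact (h4.differentiableAt.sub_const _).const_cpow (Or.inl hn')
  · rw [pow_zero, one_mul]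
    refine (h1 n hn).trans (mul_le_mul_of_nonneg_left ?_ hC)
    exact Real.rpow_le_rpow_of_exponent_le (by exact_mod_cast hn) (by linarith)

theorem expandable_toFun (R : Regularisation W) (f : hurwitzAlgebra) :
    Expandable (sample (R.toFun f)) := by
  obtain ⟨n, α, g, hg, h⟩ := R.holomorphic f
  refine (Expandable.sum Finset.univ fun i _ =>
    (hg i).1.expandable hW h0 ((hg i).2 0 h0)).congr ?_
  have hWn : ∀ᶠ z in 𝓝[≠] (0 : ℂ), z ∈ W := nhdsWithin_le_nhds (hW.mem_nhds h0)
  filter_upwards [hWn] with z hz m _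
  simp only [sample, h z hz, Finset.sum_apply]

end SimpleFamily

/-- The truncated nested sums attached to a word of families of functions. -/
def famSum (κ : Nesting) (y : List (ℂ → ℝ → ℂ)) (z : ℂ) (N : ℕ) : ℂ :=
  truncSum κ (y.map fun x => x z) N

/-- The second assertion feeds the next summation. For strict inequalities the sum up to `n - 1` is
the sum up to `n` minus its last term, and that term is expandable. -/
theorem exists_good_famSum (κ : Nesting) (y : List (ℂ → ℝ → ℂ))
    (hy : ∀ x ∈ y, Expandable (sample x)) :
    (∃ c, Good (famSum κ y) c) ∧ ∃ c, Good (fun z n => famSum κ y z (κ.innerBound n)) c := by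
  induction y with
  | nil => exact ⟨⟨_, good_const (MeromorphicAt.const 1 0)⟩, ⟨_, good_const (MeromorphicAt.const 1 0)⟩⟩
  | cons x y ih =>
    simp only [List.mem_cons, forall_eq_or_imp] at hy
    obtain ⟨d, hd⟩ := (ih hy.2).2
    have hu := hy.1.mul_good hd
    obtain ⟨c, hc⟩ := hu.exists_good_partialSum
    have hgood : Good (famSum κ (x :: y)) c := hc
    refine ⟨⟨c, hgood⟩, ?_⟩
    cases κ with
    | weak => exact ⟨c, hgood⟩
    | strict =>
      have hneg := hu.mero_mul (MeromorphicAt.const (-1) 0)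
      refine ⟨_, (hgood.add hneg.good).congr (Eventually.of_forall fun z n hn => ?_)⟩
      obtain ⟨m, rfl⟩ : ∃ m, n = m + 1 := ⟨n - 1, by omega⟩
      simp only [famSum, List.map_cons, truncSum_cons_succ, sample, Nesting.innerBound,
        Nat.add_sub_cancel]
      ring

/-! ### Regularised words and their cut-off sums. -/

section RegWord

variable {W : Set ℂ} (R : Regularisation W) (κ : Nesting)

/-- The regularisation of a word, as a combination of words of families of functions. -/
def regWord (w : List hurwitzAlgebra) : List (ℂ → ℝ → ℂ) →₀ ℂ :=
  psiL (bullet κ.sign) expCoeff (mapL R.toFun (psi (bullet κ.sign) logCoeff w))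

theorem mapL_mapL {X Y Z : Type*} (f : X → Y) (g : Y → Z) (p : List X →₀ ℂ) :
    mapL g (mapL f p) = mapL (fun x => g (f x)) p := by
  induction p using Finsupp.induction_linear with
  | zero => simp
  | add p q hp hq => simp only [map_add, hp, hq]
  | single w x => simp only [mapL_single, List.map_map]; rfl

theorem regTensor_eq_psiL (w : List hurwitzAlgebra) (z : ℂ) :
    regTensor R κ w z = psiL (bullet κ.sign) expCoeff
      (mapL (fun f => R.toFun f z) (psi (bullet κ.sign) logCoeff w)) := by
  have h : (hoffmanExp κ.sign : List (ℝ → ℂ) → _) = psi (bullet κ.sign) expCoeff :=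
    funext fun w => hoffmanExp_eq_psi _ w
  rw [regTensor, h, hoffmanLog_eq_psi]
  rfl

/-- Evaluation at `z` respects `•`, so it may be postponed. The words of families involved then form
a finite set independent of `z`, and statements valid near `0` can be intersected over it. -/
theorem regTensor_eq_mapL (w : List hurwitzAlgebra) (z : ℂ) :
    regTensor R κ w z = mapL (fun x => x z) (regWord R κ w) := by
  rw [regTensor_eq_psiL, regWord, mapL_psiL (φ := fun x : ℂ → ℝ → ℂ => x z)
    (op := bullet κ.sign) (op' := bullet κ.sign) (fun a b => rfl), mapL_mapL]

/-- The truncated nested sums of the regularisation of a word. -/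
def regTruncSum (w : List hurwitzAlgebra) (z : ℂ) (N : ℕ) : ℂ :=
  ev (fun y => famSum κ y z N) (regWord R κ w)

theorem regTruncSum_eq (w : List hurwitzAlgebra) (z : ℂ) (N : ℕ) :
    regTruncSum R κ w z N = ev (fun y => truncSum κ y N) (psiL (bullet κ.sign) expCoeff
      (mapL (fun f => R.toFun f z) (psi (bullet κ.sign) logCoeff w))) := by
  rw [← regTensor_eq_psiL, regTensor_eq_mapL, ev_mapL]
  rfl

theorem regSum_eq (w : List hurwitzAlgebra) (z : ℂ) :
    regSum R κ w z = ev (fun y => finitePart (famSum κ y z)) (regWord R κ w) := by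
  rw [regSum, regTensor_eq_mapL]
  exact ev_mapL _ _ _

theorem Nesting.sign_ne_zero (κ : Nesting) : κ.sign ≠ 0 := by
  cases κ <;> simp [Nesting.sign]

theorem ev_regTruncSum (p : List hurwitzAlgebra →₀ ℂ) (z : ℂ) (N : ℕ) :
    ev (fun w => regTruncSum R κ w z N) p = ev (fun y => truncSum κ y N)
      (psiL (bullet κ.sign) expCoeff
        (mapL (fun f => R.toFun f z) (psiL (bullet κ.sign) logCoeff p))) := by
  induction p using Finsupp.induction_linear with
  | zero => simp
  | add p q hp hq => simp only [map_add, hp, hq]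
  | single w x => simp [regTruncSum_eq]

theorem ev_truncSum_qshL (p q : List (ℝ → ℂ) →₀ ℂ) (N : ℕ) :
    ev (fun y => truncSum κ y N) (qshL (bullet κ.sign) 1 p q) =
      ev (fun y => truncSum κ y N) p * ev (fun y => truncSum κ y N) q := by
  induction p using Finsupp.induction_linear with
  | zero => simp
  | add p p' hp hp' => simp only [map_add, LinearMap.add_apply, hp, hp', add_mul]
  | single u x =>
    induction q using Finsupp.induction_linear with
    | zero => simp
    | add q q' hq hq' => simp only [map_add, hq, hq', mul_add]
    | single w y =>
      rw [qshL_single, map_smul, truncSum_mul, ev_single, ev_single]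
      simp only [smul_eq_mul]
      ring

/-- The logarithm turns the quasi-shuffle into a shuffle, letterwise regularisation preserves it,
the exponential restores the quasi-shuffle, and truncated sums are characters for it. -/
theorem regTruncSum_mul (u w : List hurwitzAlgebra) (z : ℂ) (N : ℕ) :
    ev (fun y => regTruncSum R κ y z N) (qsh (bullet κ.sign) 1 u w) =
      regTruncSum R κ u z N * regTruncSum R κ w z N := by
  rw [ev_regTruncSum, psiL_log_qsh κ.sign_ne_zero, mapL_qshL (op' := bullet κ.sign) (Or.inl rfl),
    psiL_exp_qshL κ.sign_ne_zero, ev_truncSum_qshL, ← regTruncSum_eq, ← regTruncSum_eq]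

/-- At `z = 0`, the regularisation has no effect. -/
theorem regTruncSum_zero (w : List hurwitzAlgebra) (N : ℕ) :
    regTruncSum R κ w 0 N = truncSum κ (w.map (fun f : hurwitzAlgebra => (f : ℝ → ℂ))) N := by
  have h : (fun f => R.toFun f 0) = fun f : hurwitzAlgebra => (f : ℝ → ℂ) := funext R.map_zero
  rw [regTruncSum_eq, h, mapL_psi (φ := fun f : hurwitzAlgebra => (f : ℝ → ℂ))
    (op := bullet κ.sign) (op' := bullet κ.sign) (fun a b => rfl), psi_exp_log κ.sign_ne_zero, ev_single, one_smul]

theorem exists_of_mem_support_regWord {w : List hurwitzAlgebra} {y : List (ℂ → ℝ → ℂ)}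
    (hy : y ∈ (regWord R κ w).support) : ∃ v, Coarse (bullet κ.sign) w v ∧
      Coarse (bullet κ.sign) (v.map R.toFun) y := by
  classical
  rw [regWord, psiL, Finsupp.linearCombination_apply, Finsupp.sum] at hy
  obtain ⟨v', hv', hy⟩ := Finset.mem_biUnion.1 (Finsupp.support_finsetSum hy)
  obtain ⟨v, hv, rfl⟩ := Finset.mem_image.1 (Finsupp.mapDomain_support hv')
  exact ⟨v, coarse_of_mem_support_psi hv, coarse_of_mem_support_psi (Finsupp.support_smul hy)⟩

variable (hW : IsOpen W) (h0 : (0 : ℂ) ∈ W)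
include hW h0

theorem expandable_of_mem_support_regWord {w : List hurwitzAlgebra} {y : List (ℂ → ℝ → ℂ)}
    (hy : y ∈ (regWord R κ w).support) : ∀ x ∈ y, Expandable (sample x) := by
  obtain ⟨v, -, hv⟩ := exists_of_mem_support_regWord R κ hy
  refine hv.forall (P := fun x => Expandable (sample x)) (fun a b ha hb => ?_) ?_
  · exact (ha.mul hb).mero_mul (MeromorphicAt.const κ.sign 0)
  · intro x hx
    obtain ⟨f, -, rfl⟩ := List.mem_map.1 hx
    exact expandable_toFun hW h0 R f

omit hW h0 in
theorem Good.ev {X : Type*} (p : List X →₀ ℂ) {u : List X → ℂ → ℕ → ℂ} {c : List X → ℂ → ℂ}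
    (h : ∀ y ∈ p.support, Good (u y) (c y)) :
    Good (fun z N => ev (fun y => u y z N) p) (fun z => ev (fun y => c y z) p) := by
  classical
  simp only [ev_eq_sum]
  generalize p.support = s at h ⊢
  induction s using Finset.induction_on with
  | empty => simpa using good_const (MeromorphicAt.const (0 : ℂ) 0)
  | insert y s hi ih =>
    simp only [Finset.sum_insert hi]
    refine Good.add ?_ (ih fun j hj => h j (Finset.mem_insert_of_mem hj))
    exact (good_const (MeromorphicAt.const (p y) 0)).mul (h y (Finset.mem_insert_self _ _))

theorem eventually_exists_hasFinitePart (w : List hurwitzAlgebra) :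
    ∀ᶠ z in 𝓝[≠] (0 : ℂ), ∀ y ∈ (regWord R κ w).support, ∃ c, HasFinitePart (famSum κ y z) c := by
  refine (Filter.eventually_all_finset _).2 fun y hy => ?_
  obtain ⟨c, hc⟩ := (exists_good_famSum κ y (expandable_of_mem_support_regWord R κ hW h0 hy)).1
  exact hc.hasFinitePart.mono fun z hz => ⟨_, hz⟩

theorem good_regTruncSum (w : List hurwitzAlgebra) :
    Good (regTruncSum R κ w) (regSum R κ w) := by
  have h : ∀ y : List (ℂ → ℝ → ℂ), ∃ c, y ∈ (regWord R κ w).support → Good (famSum κ y) c := by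
    intro y
    by_cases hy : y ∈ (regWord R κ w).support
    · obtain ⟨c, hc⟩ := (exists_good_famSum κ y (expandable_of_mem_support_regWord R κ hW h0 hy)).1
      exact ⟨c, fun _ => hc⟩
    · exact ⟨0, fun h => absurd h hy⟩
  choose c hc using h
  have hg := Good.ev (regWord R κ w) fun y hy => hc y hy
  have he : ∀ᶠ z in 𝓝[≠] (0 : ℂ), ev (fun y => c y z) (regWord R κ w) = regSum R κ w z := by
    have : ∀ᶠ z in 𝓝[≠] (0 : ℂ), ∀ y ∈ (regWord R κ w).support,
        HasFinitePart (famSum κ y z) (c y z) :=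
      (Filter.eventually_all_finset _).2 fun y hy => (hc y hy).hasFinitePart
    filter_upwards [this] with z hz
    rw [regSum_eq, ev_eq_sum, ev_eq_sum]
    exact Finset.sum_congr rfl fun y hy => by rw [(hz y hy).finitePart_eq]
  refine ⟨hg.1.congr he, hg.2.congr ?_⟩
  filter_upwards [he] with z hz N _
  rw [hz]
  rfl

/-- Taking constant terms in the identity of truncated sums is legitimate because the product of two
`Good` families is `Good` with the product constant. -/
theorem regSum_mul (u w : List hurwitzAlgebra) : ∀ᶠ z in 𝓝[≠] (0 : ℂ),
    ev (fun y => regSum R κ y z) (qsh (bullet κ.sign) 1 u w) = regSum R κ u z * regSum R κ w z := by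
  refine Good.unique (Good.ev _ fun y _ => good_regTruncSum R κ hW h0 y) ?_
  simp only [regTruncSum_mul]
  exact (good_regTruncSum R κ hW h0 u).mul (good_regTruncSum R κ hW h0 w)

omit hW h0 in
theorem regSum_nil (z : ℂ) : regSum R κ [] z = 1 := by
  rw [regSum_eq, regWord, psi_nil, mapL_single, psiL_single, one_smul, List.map_nil, psi_nil,
    ev_single, one_smul]
  exact (hasFinitePart_of_tendsto tendsto_const_nhds).finitePart_eq

theorem tendsto_birkhoffPlus_regSum (w : List hurwitzAlgebra) :
    Tendsto (birkhoffPlus (regSum R κ) w) (𝓝[≠] (0 : ℂ)) (𝓝 (renormSum R κ w)) := by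
  obtain ⟨g, hg, h⟩ := birkhoffPlus_analytic (fun w => (good_regTruncSum R κ hW h0 w).1) w
  exact tendsto_nhds_limUnder
    ⟨g 0, (hg.continuousAt.tendsto.mono_left nhdsWithin_le_nhds).congr' (h.mono fun z hz => hz.symm)⟩

/-- Renormalised nested sums satisfy the quasi-shuffle relations. -/
theorem renormSum_mul (u w : List hurwitzAlgebra) :
    ev (renormSum R κ) (qsh (bullet κ.sign) 1 u w) = renormSum R κ u * renormSum R κ w := by
  have h1 : Tendsto (fun z => ev (fun y => birkhoffPlus (regSum R κ) y z)
      (qsh (bullet κ.sign) 1 u w)) (𝓝[≠] (0 : ℂ))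
      (𝓝 (ev (renormSum R κ) (qsh (bullet κ.sign) 1 u w))) := by
    simp only [ev_eq_sum]
    exact tendsto_finsetSum _ fun y _ => (tendsto_birkhoffPlus_regSum R κ hW h0 y).const_smul _
  refine tendsto_nhds_unique h1 (((tendsto_birkhoffPlus_regSum R κ hW h0 u).mul
    (tendsto_birkhoffPlus_regSum R κ hW h0 w)).congr' ?_)
  exact (birkhoffPlus_mul (fun w => (good_regTruncSum R κ hW h0 w).1)
    (Eventually.of_forall (regSum_nil R κ)) (regSum_mul R κ hW h0) u w).mono fun z hz => hz.symm

end RegWord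

/-! ### Homogeneity in the letters -/

section Scaled

variable {X Y : Type*}

/-- The letters of the second word are multiples of those of the first one, in the sense of the
relation `r`, and the total factor is the first argument. -/
inductive Scaled (r : ℂ → X → X → Prop) : ℂ → List X → List X → Prop
  | nil : Scaled r 1 [] []
  | cons {c d : ℂ} {a b : X} {u w : List X} : r c a b → Scaled r d u w →
      Scaled r (c * d) (a :: u) (b :: w)

/-- A function on words that is compatible with rescaling the letters. -/
def Homogeneous (r : ℂ → X → X → Prop) (ρ : List X → ℂ) : Prop :=
  ∀ ⦃c : ℂ⦄ ⦃u w : List X⦄, Scaled r c u w → ρ w = c * ρ u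

variable {r : ℂ → X → X → Prop}

theorem Scaled.length_eq {c : ℂ} {u w : List X} (h : Scaled r c u w) : w.length = u.length := by
  induction h with
  | nil => rfl
  | cons _ _ ih => simp [ih]

theorem Scaled.take_drop {c : ℂ} {u w : List X} (h : Scaled r c u w) (i : ℕ) :
    ∃ c₁ c₂, c = c₁ * c₂ ∧ Scaled r c₁ (u.take i) (w.take i) ∧
      Scaled r c₂ (u.drop i) (w.drop i) := by
  induction h generalizing i with
  | nil => exact ⟨1, 1, by simp, by simpa using .nil, by simpa using .nil⟩
  | cons hr hs ih =>
    cases i with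
    | zero => exact ⟨1, _, (one_mul _).symm, .nil, .cons hr hs⟩
    | succ i =>
      obtain ⟨c₁, c₂, h, h1, h2⟩ := ih i
      exact ⟨_, c₂, by rw [h, mul_assoc], .cons hr h1, h2⟩

theorem Scaled.refl (hr : ∀ a, r 1 a a) (w : List X) : Scaled r 1 w w := by
  induction w with
  | nil => exact .nil
  | cons a w ih => simpa using Scaled.cons (hr a) ih

theorem Scaled.map {r' : ℂ → Y → Y → Prop} {φ : X → Y} (hφ : ∀ c a b, r c a b → r' c (φ a) (φ b))
    {c : ℂ} {u w : List X} (h : Scaled r c u w) : Scaled r' c (u.map φ) (w.map φ) := by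
  induction h with
  | nil => exact .nil
  | cons hr _ ih => exact .cons (hφ _ _ _ hr) ih

theorem Scaled.foldl {op : X → X → X}
    (hop : ∀ c d a a' b b', r c a a' → r d b b' → r (c * d) (op a b) (op a' b')) {c d : ℂ}
    {a b : X} {u w : List X} (hab : r d a b) (h : Scaled r c u w) :
    r (d * c) (u.foldl op a) (w.foldl op b) := by
  induction h generalizing d a b with
  | nil => simpa using hab
  | cons hr _ ih =>
    rw [← mul_assoc]
    exact ih (hop _ _ _ _ _ _ hab hr)

theorem Homogeneous.cons {ρ : List X → ℂ} (hr : ∀ a, r 1 a a) (hρ : Homogeneous r ρ)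
    (a : X) : Homogeneous r fun w => ρ (a :: w) := fun c u w h => by
  simpa using hρ (.cons (hr a) h)

theorem Homogeneous.cons_left {ρ : List X → ℂ} (hr : ∀ a, r 1 a a)
    (hρ : Homogeneous r ρ) {c : ℂ} {a b : X} (h : r c a b) (w : List X) :
    ρ (b :: w) = c * ρ (a :: w) := by
  simpa using hρ (.cons h (.refl hr w))

/-- Cutting a word splits its total factor, and merging a block multiplies the factors of its
letters; each block word is thus rescaled by the same total factor. -/
theorem Homogeneous.ev_psi {ρ : List X → ℂ} (hr : ∀ a, r 1 a a)
    {op : X → X → X}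
    (hop : ∀ c d a a' b b', r c a a' → r d b b' → r (c * d) (op a b) (op a' b'))
    (hρ : Homogeneous r ρ) (k : ℕ → ℂ) : Homogeneous r fun w => ev ρ (psi op k w) := by
  intro c u w h
  induction hn : u.length using Nat.strong_induction_on generalizing c u w ρ with
  | _ n ih =>
    cases h with
    | nil => simp
    | @cons c d a b u w hab h =>
      simp only [psi_cons, map_sum, map_smul, ev_consL, h.length_eq, Finset.mul_sum]
      refine Finset.sum_congr rfl fun i _ => ?_
      obtain ⟨c₁, c₂, rfl, h1, h2⟩ := h.take_drop i
      simp only [hρ.cons_left hr (Scaled.foldl hop hab h1)]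
      have h3 := ih (u.drop i).length (by simp at hn ⊢; omega)
        (hρ.cons hr ((u.take i).foldl op a)) h2 rfl
      have h4 : ev (fun w => c * c₁ * ρ ((u.take i).foldl op a :: w)) (psi op k (w.drop i)) =
          c * c₁ * ev (fun w => ρ ((u.take i).foldl op a :: w)) (psi op k (w.drop i)) := by
        simp only [ev_eq_sum, smul_eq_mul, Finset.mul_sum]
        exact Finset.sum_congr rfl fun _ _ => by ring
      simp only at h3
      rw [h4, h3]
      simp only [smul_eq_mul]
      ring

theorem ev_psiL (op : X → X → X) (k : ℕ → ℂ) (ρ : List X → ℂ) (p : List X →₀ ℂ) :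
    ev ρ (psiL op k p) = ev (fun w => ev ρ (psi op k w)) p := by
  induction p using Finsupp.induction_linear with
  | zero => simp
  | add p q hp hq => simp only [map_add, hp, hq]
  | single w x => simp

end Scaled

/-- The two pole parts come from unrelated choices; uniqueness of the polynomial in `1/z` ties them
together. -/
theorem polePart_const_mul {f g : ℂ → ℂ} {c : ℂ} (hf : MeromorphicAt f 0)
    (h : ∀ᶠ z in 𝓝[≠] (0 : ℂ), g z = c * f z) : polePart g = c • polePart f := by
  have hg : MeromorphicAt g 0 :=
    ((MeromorphicAt.const c 0).mul hf).congr (h.mono fun z hz => hz.symm)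
  obtain ⟨p, a, hp, hp0, ha, hs⟩ := polePart_spec hf
  obtain ⟨q, b, hq, hq0, hb, hs'⟩ := polePart_spec hg
  have : q - Polynomial.C c * p = 0 := by
    refine eq_zero_of_eval_inv_eq_analytic (by simp [hp0, hq0])
      ((analyticAt_const (v := c)).mul ha |>.sub hb) ?_
    filter_upwards [h, hs, hs'] with z h1 h2 h3
    simp only [Polynomial.eval_sub, Polynomial.eval_mul, Polynomial.eval_C, Pi.sub_apply,
      Pi.mul_apply]
    rw [h3, h2] at h1
    linear_combination h1
  rw [hp, hq, sub_eq_zero.1 this]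
  ext z
  simp
theorem birkhoffPlus_scaled {X : Type*} {r : ℂ → X → X → Prop} {Φ : List X → ℂ → ℂ}
    (hΦ : ∀ w, MeromorphicAt (Φ w) 0)
    (h : ∀ c u w, Scaled r c u w → ∀ᶠ z in 𝓝[≠] (0 : ℂ), Φ w z = c * Φ u z) {c : ℂ} {u w : List X}
    (huw : Scaled r c u w) : ∀ᶠ z in 𝓝[≠] (0 : ℂ), birkhoffPlus Φ w z = c * birkhoffPlus Φ u z := by
  have key : ∀ (n : ℕ) (c : ℂ) (u w : List X), u.length = n → Scaled r c u w →
      (∀ᶠ z in 𝓝[≠] (0 : ℂ), birkhoffPrep Φ w z = c * birkhoffPrep Φ u z) ∧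
        birkhoffMinus Φ w = c • birkhoffMinus Φ u := by
    intro n
    induction n using Nat.strong_induction_on with
    | _ n ih =>
      intro c u w hn hs
      have h1 : ∀ᶠ z in 𝓝[≠] (0 : ℂ), birkhoffPrep Φ w z = c * birkhoffPrep Φ u z := by
        have h2 : ∀ i ∈ Finset.range (u.length - 1), ∀ᶠ z in 𝓝[≠] (0 : ℂ),
            birkhoffMinus Φ (w.take (i + 1)) z * Φ (w.drop (i + 1)) z =
              c * (birkhoffMinus Φ (u.take (i + 1)) z * Φ (u.drop (i + 1)) z) := by
          intro i hi
          rw [Finset.mem_range] at hi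
          obtain ⟨c₁, c₂, rfl, hs1, hs2⟩ := hs.take_drop (i + 1)
          filter_upwards [h _ _ _ hs2] with z hz
          rw [hz, (ih _ (by simp; omega) _ _ _ rfl hs1).2, Pi.smul_apply, smul_eq_mul]
          ring
        filter_upwards [h _ _ _ hs, (Filter.eventually_all_finset _).2 h2] with z hz hz2
        rw [birkhoffPrep, birkhoffPrep, Fin.sum_univ_eq_sum_range (fun i =>
          birkhoffMinus Φ (w.take (i + 1)) z * Φ (w.drop (i + 1)) z), Fin.sum_univ_eq_sum_range
          (fun i => birkhoffMinus Φ (u.take (i + 1)) z * Φ (u.drop (i + 1)) z), hs.length_eq,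
          Finset.sum_congr rfl hz2, hz, mul_add, Finset.mul_sum]
      refine ⟨h1, ?_⟩
      cases hs with
      | nil => simp
      | cons hr hs =>
        rw [birkhoffMinus_cons, birkhoffMinus_cons,
          polePart_const_mul (meromorphicAt_birkhoffMinus hΦ _).2 h1, smul_neg]
  cases huw with
  | nil => exact Eventually.of_forall fun z => by simp
  | @cons c d a b u w hr hs =>
    obtain ⟨h1, h2⟩ := key _ _ _ _ rfl (Scaled.cons hr hs)
    filter_upwards [h1] with z hz
    rw [birkhoffMinus_cons, birkhoffMinus_cons] at h2
    have h3 := congrFun h2 z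
    simp only [Pi.neg_apply, Pi.smul_apply, smul_eq_mul] at h3
    simp only [birkhoffPlus, Pi.sub_apply, hz]
    linear_combination h3

theorem homogeneous_truncSum (κ : Nesting) (N : ℕ) :
    Homogeneous (fun c (f g : ℝ → ℂ) => ∀ ξ : ℝ, 1 ≤ ξ → g ξ = c * f ξ)
      (fun w => truncSum κ w N) := by
  intro c u w h
  induction h generalizing N with
  | nil => simp [truncSum]
  | cons hr _ ih =>
    simp only [truncSum, Finset.mul_sum] at ih ⊢
    refine Finset.sum_congr rfl fun n hn => ?_
    rw [ih, hr n (by exact_mod_cast (Finset.mem_Icc.1 hn).1)]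
    ring

/-- Proportionality on `[1, +∞[`. -/
def TailScaled (c : ℂ) (f g : hurwitzAlgebra) : Prop :=
  ∀ ξ : ℝ, 1 ≤ ξ → (g : ℝ → ℂ) ξ = c * (f : ℝ → ℂ) ξ

theorem tailScaled_one (f : hurwitzAlgebra) : TailScaled 1 f f := fun _ _ => (one_mul _).symm

/-! ### Independence of representatives and stuffle relations. -/

section

variable {W : Set ℂ} (R : Regularisation W) (κ : Nesting)

theorem Regularisation.toFun_tailScaled {z : ℂ} (hz : z ∈ W) {c : ℂ} {f g : hurwitzAlgebra}
    (h : TailScaled c f g) (ξ : ℝ) (hξ : 1 ≤ ξ) : R.toFun g z ξ = c * R.toFun f z ξ := by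
  have := R.map_ideal (g - c • f) (fun ξ hξ => by simp [h ξ hξ]) z hz ξ hξ
  simpa [sub_eq_zero] using this

theorem homogeneous_regTruncSum {z : ℂ} (hz : z ∈ W) (N : ℕ) :
    Homogeneous TailScaled (fun w => regTruncSum R κ w z N) := by
  have h1 : Homogeneous (fun c (f g : ℝ → ℂ) => ∀ ξ : ℝ, 1 ≤ ξ → g ξ = c * f ξ)
      (fun w => ev (fun y => truncSum κ y N) (psi (bullet κ.sign) expCoeff w)) := by
    refine (homogeneous_truncSum κ N).ev_psi (fun f ξ _ => (one_mul _).symm) ?_ _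
    intro c d a a' b b' ha hb ξ hξ
    simp only [bullet, Pi.smul_apply, Pi.mul_apply, smul_eq_mul, ha ξ hξ, hb ξ hξ]
    ring
  have h2 : Homogeneous TailScaled (fun w => ev (fun y => truncSum κ y N)
      (psi (bullet κ.sign) expCoeff (w.map fun f => R.toFun f z))) := fun c u w h =>
    h1 (h.map fun c f g h => R.toFun_tailScaled hz h)
  have h3 := h2.ev_psi tailScaled_one (op := bullet κ.sign) (fun c d a a' b b' ha hb ξ hξ => by
    have e1 := ha ξ hξ
    have e2 := hb ξ hξ
    simp only [bullet, NonUnitalSubalgebra.coe_smul, NonUnitalSubalgebra.coe_mul, Pi.smul_apply,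
      Pi.mul_apply, smul_eq_mul, e1, e2]
    ring) logCoeff
  intro c u w h
  simp only [regTruncSum_eq, ev_psiL, ev_mapL]
  exact h3 h

variable (hW : IsOpen W) (h0 : (0 : ℂ) ∈ W)
include hW h0

/-- Proportional tails remain proportional at every `z ∈ W`, and nested sums only see integers `n ≥
1`. The factor `1` gives independence of representatives, the factor `ε` pulls the sign of `•` out
of a merged letter. -/
theorem homogeneous_renormSum : Homogeneous TailScaled (renormSum R κ) := by
  have h1 : ∀ c u w, Scaled TailScaled c u w →
      ∀ᶠ z in 𝓝[≠] (0 : ℂ), regSum R κ w z = c * regSum R κ u z := by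
    intro c u w h
    refine Good.unique (good_regTruncSum R κ hW h0 w)
      (((good_const (MeromorphicAt.const c 0)).mul (good_regTruncSum R κ hW h0 u)).congr ?_)
    have hz : ∀ᶠ z in 𝓝[≠] (0 : ℂ), z ∈ W := nhdsWithin_le_nhds (hW.mem_nhds h0)
    filter_upwards [hz] with z hz N _
    exact (homogeneous_regTruncSum R κ hz N h).symm
  intro c u w h
  refine tendsto_nhds_unique (tendsto_birkhoffPlus_regSum R κ hW h0 w)
    (((tendsto_birkhoffPlus_regSum R κ hW h0 u).const_mul c).congr' ?_)
  exact (birkhoffPlus_scaled (fun w => (good_regTruncSum R κ hW h0 w).1) h1 h).mono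
    fun z hz => hz.symm

omit hW h0 in
theorem IsHurwitzSymbol.bullet {v : ℝ} (hv : 0 ≤ v) {ε s t : ℂ} {f g h : hurwitzAlgebra}
    (hf : IsHurwitzSymbol v s f) (hg : IsHurwitzSymbol v t g) (hh : IsHurwitzSymbol v (s + t) h) :
    TailScaled ε h (bullet ε f g) := fun ξ hξ => by
  have : ((ξ + v : ℝ) : ℂ) ≠ 0 := by exact_mod_cast (by linarith : ξ + v ≠ 0)
  simp only [HurwitzRenorm.bullet, NonUnitalSubalgebra.coe_smul, NonUnitalSubalgebra.coe_mul,
    Pi.smul_apply, Pi.mul_apply, smul_eq_mul, hf ξ hξ, hg ξ hξ, hh ξ hξ]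
  rw [neg_add, Complex.cpow_add _ _ this]

-- A `•`-product of representatives agrees with `ε` times the representative of the sum only on `[1,
-- +∞[`. So the recursions of the two products match only after applying a functional homogeneous in
-- the tails.
omit hW h0 in
theorem ev_stuffleWord {v : ℝ} (hv : 0 ≤ v) {rep : ℂ → hurwitzAlgebra}
    (hrep : ∀ s, IsHurwitzSymbol v s (rep s)) (ε : ℂ) {ρ : List hurwitzAlgebra → ℂ}
    (hρ : Homogeneous TailScaled ρ) (u w : List ℂ) :
    ev (fun y => ρ (y.map rep)) (stuffleWord ε u w) =
      ev ρ (qsh (bullet ε) 1 (u.map rep) (w.map rep)) := by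
  induction u, w using stuffleWord.induct generalizing ρ with
  | case1 w => simp [stuffleWord, qsh_nil_left]
  | case2 a u => simp [stuffleWord, qsh_nil_right]
  | case3 a u b w h1 h2 h3 =>
    have h : stuffleWord ε (a :: u) (b :: w) = consL a (stuffleWord ε u (b :: w)) +
        consL b (stuffleWord ε (a :: u) w) + ε • consL (a + b) (stuffleWord ε u w) := by
      rw [stuffleWord]; rfl
    rw [h, List.map_cons, List.map_cons, qsh_cons_cons]
    simp only [map_add, map_smul, ev_consL, List.map_cons]
    have hc := fun a => hρ.cons tailScaled_one a
    have e1 := h1 (hc (rep a))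
    have e2 := h2 (hc (rep b))
    have e3 := h3 (hc (rep (a + b)))
    simp only [List.map_cons] at e1 e2 e3
    rw [e1, e2, e3]
    simp only [hρ.cons_left tailScaled_one ((hrep a).bullet hv (hrep b) (hrep (a + b)))]
    simp only [ev_eq_sum, smul_eq_mul, Finset.mul_sum, one_mul]
    congr 1
    exact Finset.sum_congr rfl fun _ _ => by ring

/-- Renormalised Hurwitz multiple zeta values satisfy the stuffle relations. -/
theorem renormZetaLin_stuffle {v : ℝ} (hv : 0 ≤ v)
    (hrep : ∀ s, IsHurwitzSymbol v s (hurwitzRep v s)) (P Q : List ℂ →₀ ℂ) :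
    renormZetaLin R κ v (stuffle κ.sign P Q) = renormZetaLin R κ v P * renormZetaLin R κ v Q := by
  have key : ∀ u w, renormZetaLin R κ v (stuffleWord κ.sign u w) =
      renormZeta R κ v u * renormZeta R κ v w := fun u w =>
    (ev_stuffleWord hv hrep κ.sign (homogeneous_renormSum R κ hW h0) u w).trans
      (renormSum_mul R κ hW h0 _ _)
  simp only [stuffle, Finsupp.sum, map_sum, map_smul, key]
  simp only [renormZetaLin, Finsupp.linearCombination_apply, Finsupp.sum, smul_eq_mul,
    Finset.sum_mul_sum]
  exact Finset.sum_congr rfl fun _ _ => Finset.sum_congr rfl fun _ _ => by ring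

theorem renormSum_eq_renormZeta {v : ℝ} (hrep : ∀ s, IsHurwitzSymbol v s (hurwitzRep v s))
    {s : List ℂ} {f : List hurwitzAlgebra}
    (hf : List.Forall₂ (fun (t : ℂ) (g : hurwitzAlgebra) => IsHurwitzSymbol v t g) s f) :
    renormSum R κ f = renormZeta R κ v s := by
  have : Scaled TailScaled 1 (s.map (hurwitzRep v)) f := by
    induction hf with
    | nil => exact .nil
    | @cons a b s f h _ ih =>
      rw [← mul_one (1 : ℂ)]
      exact .cons (fun ξ hξ => by rw [h ξ hξ, hrep a ξ hξ, one_mul]) ih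
  rw [renormZeta, homogeneous_renormSum R κ hW h0 this, one_mul]

end

/-! ### Positively supported functions -/

theorem IsPosSupported.of_subset {f : ℝ → ℂ} {s : Set ℝ} (hf : ContDiff ℝ ∞ f)
    (hs : tsupport f ⊆ s) (h : s ⊆ Set.Ioi 0) : IsPosSupported f := ⟨hf, hs.trans h⟩

theorem IsPosSupported.add {f g : ℝ → ℂ} (hf : IsPosSupported f) (hg : IsPosSupported g) :
    IsPosSupported (f + g) :=
  ⟨hf.1.add hg.1, (tsupport_add f g).trans (Set.union_subset hf.2 hg.2)⟩

theorem IsPosSupported.const_smul {f : ℝ → ℂ} (hf : IsPosSupported f) (c : ℂ) :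
    IsPosSupported (c • f) :=
  ⟨contDiff_const.smul hf.1, (tsupport_smul_subset_right (fun _ => c) f).trans hf.2⟩

theorem IsPosSupported.mul {f g : ℝ → ℂ} (hf : IsPosSupported f) (hg : IsPosSupported g) :
    IsPosSupported (f * g) :=
  ⟨hf.1.mul hg.1, tsupport_mul_subset_left.trans hf.2⟩

theorem isPosSupported_zero : IsPosSupported 0 := ⟨contDiff_const, by simp [tsupport]⟩

theorem isPosSupported_of_mem_posSymbols {f : ℝ → ℂ} (hf : f ∈ posSymbols) : IsPosSupported f := by
  induction hf using Submodule.span_induction with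
  | mem f h =>
    obtain ⟨α, h⟩ := h
    exact h.1
  | zero => exact isPosSupported_zero
  | add f g _ _ hf hg => exact hf.add hg
  | smul c f _ hf => exact hf.const_smul c

theorem isPosSupported_hurwitzAlgebra (f : hurwitzAlgebra) : IsPosSupported f := by
  obtain ⟨f, hf⟩ := f
  induction hf using NonUnitalAlgebra.adjoin_induction with
  | mem f h =>
    rcases h with h | h
    · exact isPosSupported_of_mem_posSymbols h.1
    · exact isPosSupported_of_mem_posSymbols h.1
  | zero => exact isPosSupported_zero
  | add f g _ _ hf hg => exact hf.add hg
  | mul f g _ _ hf hg => exact hf.mul hg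
  | smul c f _ hf => exact hf.const_smul c

/-! ### Hurwitz symbols -/

theorem hasDerivAt_ofReal_add_cpow (a : ℂ) {v x : ℝ} (h : 0 < x + v) :
    HasDerivAt (fun x : ℝ => ((x + v : ℝ) : ℂ) ^ a) (a * ((x + v : ℝ) : ℂ) ^ (a - 1)) x := by
  have h1 : HasDerivAt (fun z : ℂ => z + v) 1 (x : ℂ) := (hasDerivAt_id _).add_const _
  have h2 := (h1.cpow_const (c := a) (Or.inl (by simpa using h))).comp_ofReal
  simpa using h2

theorem contDiffAt_ofReal_add_cpow (a : ℂ) {v x : ℝ} (h : 0 < x + v) :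
    ContDiffAt ℝ ∞ (fun x : ℝ => ((x + v : ℝ) : ℂ) ^ a) x := by
  have h1 : ContDiffAt ℝ ∞ (fun x : ℝ => Complex.exp (((Real.log (x + v) : ℝ) : ℂ) * a)) x := by
    have h2 : ContDiffAt ℝ ∞ (fun x : ℝ => Real.log (x + v)) x :=
      (contDiffAt_id.add contDiffAt_const).log h.ne'
    exact (((Complex.ofRealCLM.contDiff.contDiffAt).comp x h2).mul contDiffAt_const).cexp
  refine h1.congr_of_eventuallyEq ?_
  filter_upwards [lt_mem_nhds (show -v < x by linarith)] with y hy
  have hy' : 0 < y + v := by linarith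
  rw [Complex.cpow_def_of_ne_zero (by exact_mod_cast hy'.ne'), Complex.ofReal_log hy'.le]

theorem contDiffAt_ofReal_cpow (a : ℂ) {x : ℝ} (h : 0 < x) :
    ContDiffAt ℝ ∞ (fun x : ℝ => (x : ℂ) ^ a) x := by
  simpa using contDiffAt_ofReal_add_cpow a (v := 0) (x := x) (by simpa using h)

/-- The remainder of order `L` in the expansion of `(x + v) ^ b` as `x → +∞`. -/
def hurwitzRem (v : ℝ) (L : ℕ) (b : ℂ) (x : ℝ) : ℂ :=
  ((x + v : ℝ) : ℂ) ^ b - ∑ j ∈ Finset.range L, bin j b * (v : ℂ) ^ j * (x : ℂ) ^ (b - j)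

/-- Differentiation lowers the exponent and keeps the shape of the remainder, so estimates of all
derivatives reduce to the estimate of the remainder itself. -/
theorem hasDerivAt_hurwitzRem {v : ℝ} (hv : 0 ≤ v) (L : ℕ) (b : ℂ) {x : ℝ} (hx : 0 < x) :
    HasDerivAt (hurwitzRem v L b) (b * hurwitzRem v L (b - 1) x) x := by
  have h := (hasDerivAt_ofReal_add_cpow b (v := v) (x := x) (by linarith)).sub
    (HasDerivAt.fun_sum (u := Finset.range L) fun j _ =>
      ((hasDerivAt_ofReal_add_cpow (b - j) (v := 0) (x := x) (by simpa using hx)).const_mul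
        (bin j b * (v : ℂ) ^ j)))
  simp only [add_zero] at h
  refine h.congr_deriv ?_
  rw [hurwitzRem, mul_sub, Finset.mul_sum]
  congr 1
  refine Finset.sum_congr rfl fun j _ => ?_
  rw [sub_right_comm b (j : ℂ) 1]
  linear_combination (v : ℂ) ^ j * (x : ℂ) ^ (b - 1 - j) * bin_mul_sub j b

theorem exists_norm_hurwitzRem_le {v : ℝ} (hv : 0 ≤ v) (L : ℕ) (b : ℂ) : ∃ C : ℝ, 0 ≤ C ∧
    ∀ x : ℝ, 1 ≤ x → ‖hurwitzRem v L b x‖ ≤ C * x ^ (b.re - L) := by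
  obtain ⟨C, hC, h⟩ := exists_norm_one_add_cpow_sub_le L ‖b‖ v
  refine ⟨C * v ^ L, by positivity, fun x hx => ?_⟩
  have hx0 : 0 < x := by linarith
  have hxc : (x : ℂ) ≠ 0 := by exact_mod_cast hx0.ne'
  have h1 : hurwitzRem v L b x = (x : ℂ) ^ b * ((1 + ((v / x : ℝ) : ℂ)) ^ b -
      ∑ j ∈ Finset.range L, bin j b * ((v / x : ℝ) : ℂ) ^ j) := by
    rw [hurwitzRem, mul_sub, Finset.mul_sum]
    congr 1
    · have : (1 + ((v / x : ℝ) : ℂ)) = ((1 + v / x : ℝ) : ℂ) := by push_cast; rfl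
      rw [this, ← Complex.mul_cpow_ofReal_nonneg hx0.le (by positivity), ← Complex.ofReal_mul]
      congr 2
      field_simp
    · refine Finset.sum_congr rfl fun j _ => ?_
      rw [Complex.cpow_sub _ _ hxc, Complex.cpow_natCast]
      push_cast
      rw [div_pow]
      ring
  rw [h1, norm_mul, Complex.norm_cpow_eq_rpow_re_of_pos hx0, Real.rpow_sub hx0, Real.rpow_natCast]
  calc x ^ b.re * _ ≤ x ^ b.re * (C * (v / x) ^ L) :=
        mul_le_mul_of_nonneg_left (h b le_rfl _ (by positivity) (div_le_self hv hx)) (by positivity)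
    _ = C * v ^ L * (x ^ b.re / x ^ L) := by rw [div_pow]; ring

theorem exists_norm_iteratedDeriv_le {v : ℝ} (hv : 0 ≤ v) {F : ℝ → ℂ} {c b : ℂ} {L : ℕ}
    (hF : ContDiffOn ℝ ∞ F (Set.Ioi 0)) (h : ∀ x : ℝ, 1 ≤ x → F x = c * hurwitzRem v L b x)
    (γ : ℕ) : ∃ C : ℝ, 0 ≤ C ∧ ∀ x : ℝ, 1 ≤ x → ‖iteratedDeriv γ F x‖ ≤ C * x ^ (b.re - γ - L) := by
  have key : ∃ d : ℂ, ∀ x : ℝ, 1 < x → iteratedDeriv γ F x = d * hurwitzRem v L (b - γ) x := by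
    induction γ with
    | zero => exact ⟨c, fun x hx => by simpa using h x hx.le⟩
    | succ γ ih =>
      obtain ⟨d, hd⟩ := ih
      refine ⟨d * (b - γ), fun x hx => ?_⟩
      have h1 : iteratedDeriv γ F =ᶠ[𝓝 x] fun x => d * hurwitzRem v L (b - γ) x :=
        (lt_mem_nhds hx).mono hd
      rw [iteratedDeriv_succ, h1.deriv_eq,
        ((hasDerivAt_hurwitzRem hv L (b - γ) (zero_lt_one.trans hx)).const_mul d).deriv]
      push_cast
      rw [sub_sub]
      ring
  obtain ⟨d, hd⟩ := key
  obtain ⟨C, hC, hb⟩ := exists_norm_hurwitzRem_le hv L (b - γ)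
  have h1 : ∀ x : ℝ, 1 < x → ‖iteratedDeriv γ F x‖ ≤ ‖d‖ * C * x ^ (b.re - γ - L) := by
    intro x hx
    rw [hd x hx, norm_mul, mul_assoc]
    refine mul_le_mul_of_nonneg_left ((hb x hx.le).trans_eq ?_) (norm_nonneg d)
    simp
  refine ⟨‖d‖ * C, by positivity, fun x hx => ?_⟩
  rcases hx.lt_or_eq with hx | rfl
  · exact h1 x hx
  -- `F` is known only on `[1, +∞[`, so its derivatives are computed for `x > 1`; the bound passes
  -- to the endpoint by continuity.
  · have h2 : ContinuousAt (iteratedDeriv γ F) 1 := by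
      have h3 := (hF.continuousOn_iteratedDerivWithin (m := γ) (by exact_mod_cast le_top)
        isOpen_Ioi.uniqueDiffOn).congr fun x hx =>
          (iteratedDerivWithin_of_isOpen (f := F) (n := γ) isOpen_Ioi hx).symm
      exact h3.continuousAt (Ioi_mem_nhds one_pos)
    have h3 : ContinuousAt (fun x : ℝ => ‖d‖ * C * x ^ (b.re - γ - L)) 1 :=
      continuousAt_const.mul (Real.continuousAt_rpow_const _ _ (Or.inl one_ne_zero))
    exact le_of_tendsto_of_tendsto (b := 𝓝[>] (1 : ℝ))
      (h2.norm.tendsto.mono_left nhdsWithin_le_nhds) (h3.tendsto.mono_left nhdsWithin_le_nhds)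
      (eventually_nhdsWithin_of_forall h1)

theorem rpow_le_const_mul_one_add_rpow (e : ℝ) {x : ℝ} (hx : 1 ≤ x) :
    x ^ e ≤ 2 ^ |e| * (1 + x) ^ e := by
  rcases le_or_gt 0 e with he | he
  · calc x ^ e ≤ (1 + x) ^ e := Real.rpow_le_rpow (by linarith) (by linarith) he
      _ ≤ 2 ^ |e| * (1 + x) ^ e := le_mul_of_one_le_left (by positivity)
        (Real.one_le_rpow one_le_two (abs_nonneg e))
  · rw [abs_of_neg he, Real.rpow_neg zero_le_two, ← Real.inv_rpow zero_le_two,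
      ← Real.mul_rpow (by norm_num) (by linarith)]
    exact Real.rpow_le_rpow_of_nonpos (by positivity) (by linarith) he.le

theorem hasExpansion_of_eq {v : ℝ} (hv : 0 ≤ v) {f : ℝ → ℂ} (hf : ContDiff ℝ ∞ f) {c b : ℂ}
    (h : ∀ ξ : ℝ, 1 ≤ ξ → f ξ = c * ((ξ + v : ℝ) : ℂ) ^ b) :
    HasExpansion b (fun j => c * (bin j b * (v : ℂ) ^ j)) f := by
  intro N γ
  obtain ⟨C, hC, hb⟩ := exists_norm_iteratedDeriv_le hv (c := c) (b := b) (L := N + 1)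
    (F := fun x : ℝ => f x - ∑ j ∈ Finset.range (N + 1), c * (bin j b * (v : ℂ) ^ j) *
      (x : ℂ) ^ (b - j))
    (fun x hx => (hf.contDiffAt.sub (ContDiffAt.sum fun j _ =>
      contDiffAt_const.mul (contDiffAt_ofReal_cpow _ hx))).contDiffWithinAt)
    (fun x hx => by
      rw [h x hx, hurwitzRem, mul_sub, Finset.mul_sum]
      simp only [mul_assoc]) γ
  refine ⟨C * 2 ^ |b.re - N - 1 - γ|, fun ξ hξ => (hb ξ hξ).trans ?_⟩
  have e : b.re - γ - (N + 1 : ℕ) = b.re - N - 1 - γ := by push_cast; ring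
  rw [e, mul_assoc]
  exact mul_le_mul_of_nonneg_left (rpow_le_const_mul_one_add_rpow _ hξ) hC

theorem hasOrder_of_eq {v : ℝ} (hv : 0 ≤ v) {f : ℝ → ℂ} (hf : IsPosSupported f) {c b : ℂ}
    (hc : c ≠ 0) (h : ∀ ξ : ℝ, 1 ≤ ξ → f ξ = c * ((ξ + v : ℝ) : ℂ) ^ b) : HasOrder f b :=
  ⟨hf, _, hasExpansion_of_eq hv hf.1 h, by simpa [bin] using hc⟩

/-- A positively supported smooth function equal to `(ξ + v) ^ b` for `ξ ≥ 1`. -/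
def cutoffPow (v : ℝ) (b : ℂ) (ξ : ℝ) : ℂ :=
  ((Real.smoothTransition (4 * ξ - 2) : ℝ) : ℂ) * ((ξ + v : ℝ) : ℂ) ^ b

theorem cutoffPow_eq (v : ℝ) (b : ℂ) {ξ : ℝ} (hξ : 1 ≤ ξ) :
    cutoffPow v b ξ = ((ξ + v : ℝ) : ℂ) ^ b := by
  rw [cutoffPow, Real.smoothTransition.one_of_one_le (by linarith), Complex.ofReal_one, one_mul]

theorem cutoffPow_eq_zero (v : ℝ) (b : ℂ) {ξ : ℝ} (hξ : ξ ≤ 1 / 2) : cutoffPow v b ξ = 0 := by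
  rw [cutoffPow, Real.smoothTransition.zero_of_nonpos (by linarith), Complex.ofReal_zero, zero_mul]

theorem isPosSupported_cutoffPow {v : ℝ} (hv : 0 ≤ v) (b : ℂ) : IsPosSupported (cutoffPow v b) := by
  refine .of_subset (s := Set.Ici (1 / 2)) (contDiff_iff_contDiffAt.2 fun x => ?_) ?_ ?_
  · rcases lt_or_ge 0 x with hx | hx
    · refine ContDiffAt.mul ?_ (contDiffAt_ofReal_add_cpow b (by linarith))
      exact (Complex.ofRealCLM.contDiff.comp (Real.smoothTransition.contDiff.comp
        ((contDiff_const.mul contDiff_id).sub contDiff_const))).contDiffAt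
    · refine (contDiffAt_const (c := (0 : ℂ))).congr_of_eventuallyEq ?_
      filter_upwards [gt_mem_nhds (show x < 1 / 2 by linarith)] with y hy
      exact cutoffPow_eq_zero v b hy.le
  · refine closure_minimal (fun x hx => ?_) isClosed_Ici
    by_contra h
    exact hx (cutoffPow_eq_zero v b (not_le.1 h).le)
  · intro x hx
    have : (1 / 2 : ℝ) ≤ x := hx
    exact lt_of_lt_of_le (by norm_num) this

/-- The classes `σ_s^v` are represented in the algebra. -/
theorem isHurwitzSymbol_hurwitzRep {v : ℝ} (hv : 0 ≤ v) (s : ℂ) :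
    IsHurwitzSymbol v s (hurwitzRep v s) := by
  have h : ∃ f : hurwitzAlgebra, IsHurwitzSymbol v s f := by
    have h1 : IsHurwitzSymbol v s (cutoffPow v (-s)) := fun ξ hξ => cutoffPow_eq v _ hξ
    refine ⟨⟨cutoffPow v (-s), NonUnitalAlgebra.subset_adjoin ℂ (Or.inr ⟨?_, v, s, hv, h1⟩)⟩, h1⟩
    exact Submodule.subset_span ⟨-s, isPosSupported_cutoffPow hv _, _,
      hasExpansion_of_eq hv (c := 1) (isPosSupported_cutoffPow hv _).1 fun ξ hξ => by
        rw [one_mul, h1 ξ hξ]⟩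
  rw [hurwitzRep, dif_pos h]
  exact h.choose_spec

/-! ### Words in the domain of convergence -/

/-- All the sums of nonempty prefixes of the list are less than `τ`. -/
def PrefixSumsLT : ℝ → List ℝ → Prop
  | _, [] => True
  | τ, e :: l => e < τ ∧ PrefixSumsLT (τ - e) l

/-- Merging two entries deletes one prefix sum and keeps the others. -/
theorem PrefixSumsLT.coarse {l l' : List ℝ} (h : Coarse (· + ·) l l') {τ : ℝ}
    (hl : PrefixSumsLT τ l) : PrefixSumsLT τ l' := by
  induction h generalizing τ with
  | nil => trivial
  | cons a h ih => exact ⟨hl.1, ih hl.2⟩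
  | merge a b h ih =>
    obtain ⟨h1, h2, h3⟩ := hl
    refine ih ⟨by linarith, ?_⟩
    rwa [sub_sub] at h3

theorem PrefixSumsLT.take {τ : ℝ} {l : List ℝ} (h : PrefixSumsLT τ l) (i : ℕ) :
    PrefixSumsLT τ (l.take i) := by
  induction l generalizing τ i with
  | nil => simpa
  | cons e l ih =>
    cases i with
    | zero => trivial
    | succ i => exact ⟨h.1, ih h.2 i⟩

/-- Finitely many strict inequalities, continuous in `δ`. The threshold must vary with `δ`, since
the induction subtracts the perturbed entries from it. -/
theorem PrefixSumsLT.eventually {l : List ℝ} {τ : ℝ → ℝ} (hτ : ContinuousAt τ 0)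
    (h : PrefixSumsLT (τ 0) l) : ∀ᶠ δ in 𝓝 (0 : ℝ), PrefixSumsLT (τ δ) (l.map (· + δ)) := by
  induction l generalizing τ with
  | nil => exact Eventually.of_forall fun _ => trivial
  | cons e l ih =>
    have he : ContinuousAt (fun δ : ℝ => e + δ) 0 := by fun_prop
    have h1 : ∀ᶠ δ in 𝓝 (0 : ℝ), e + δ < τ δ := he.eventually_lt hτ (by simpa using h.1)
    filter_upwards [h1, ih (τ := fun δ => τ δ - (e + δ)) (hτ.sub he) (by simpa using h.2)]
      with δ h1 h2
    exact ⟨h1, h2⟩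

theorem prefixSumsLT_ofFn {k : ℕ} {e : Fin k → ℝ} {τ : ℝ}
    (h : ∀ m : Fin k, ∑ i ∈ Finset.Iic m, e i < τ) : PrefixSumsLT τ (List.ofFn e) := by
  have hs : ∀ (k : ℕ) (e : Fin k → ℝ) (m : Fin k), ∑ i ∈ Finset.Iic m, e i =
      ∑ i, if i ≤ m then e i else 0 := fun k e m => by
    rw [← Finset.sum_filter]
    congr 1
    ext i
    simp
  induction k generalizing τ with
  | zero => simp [PrefixSumsLT]
  | succ k ih =>
    rw [List.ofFn_succ]
    refine ⟨?_, ih fun m => ?_⟩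
    · have := h 0
      rw [hs, Fin.sum_univ_succ] at this
      simpa using this
    · have := h m.succ
      rw [hs, Fin.sum_univ_succ] at this
      rw [hs]
      simp only [Fin.zero_le, if_true, Fin.succ_le_succ_iff] at this
      linarith

theorem Coarse.lift {X Y : Type*} {op : X → X → X} {op' : Y → Y → Y} {Q : X → Y → Prop}
    (hQ : ∀ a b x y, Q a x → Q b y → Q (op a b) (op' x y)) {w w' : List X} (h : Coarse op w w')
    {l : List Y} (hl : List.Forall₂ Q w l) :
    ∃ l', Coarse op' l l' ∧ List.Forall₂ Q w' l' := by
  induction h generalizing l with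
  | nil =>
    cases hl
    exact ⟨[], .nil, .nil⟩
  | cons a h ih =>
    obtain _ | ⟨h1, h2⟩ := hl
    obtain ⟨l', h3, h4⟩ := ih h2
    exact ⟨_, .cons _ h3, .cons h1 h4⟩
  | merge a b h ih =>
    obtain _ | ⟨h1, _ | ⟨h2, h3⟩⟩ := hl
    obtain ⟨l', h4, h5⟩ := ih (.cons (hQ _ _ _ _ h1 h2) h3)
    exact ⟨l', .merge _ _ h4, h5⟩

/-! ### Uniform bounds near `z = 0` -/

/-- The sequences `x z n` are holomorphic in `z` and `O(n ^ (e - 1))`, uniformly for `z` near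
`0`. -/
def UnifBound (x : ℂ → ℝ → ℂ) (e : ℝ) : Prop :=
  ∃ C : ℝ, 0 ≤ C ∧ ∀ᶠ z in 𝓝 (0 : ℂ), ∀ n : ℕ, 1 ≤ n →
    DifferentiableAt ℂ (fun y => x y n) z ∧ ‖x z n‖ ≤ C * (n : ℝ) ^ (e - 1)

/-- The product is even `O(n ^ (e + d - 2))`. The weaker bound makes the exponents add exactly as
the entries of a merged list do. -/
theorem UnifBound.bullet (ε : ℂ) {x y : ℂ → ℝ → ℂ} {e d : ℝ} (hx : UnifBound x e)
    (hy : UnifBound y d) : UnifBound (bullet ε x y) (e + d) := by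
  obtain ⟨C, hC, hx⟩ := hx
  obtain ⟨D, hD, hy⟩ := hy
  refine ⟨‖ε‖ * (C * D), by positivity, ?_⟩
  filter_upwards [hx, hy] with z h1 h2 n hn
  refine ⟨((h1 n hn).1.mul (h2 n hn).1).const_mul ε, ?_⟩
  have hn1 : (1 : ℝ) ≤ n := by exact_mod_cast hn
  simp only [HurwitzRenorm.bullet, Pi.smul_apply, Pi.mul_apply, smul_eq_mul, norm_mul]
  rw [mul_assoc]
  refine mul_le_mul_of_nonneg_left ?_ (norm_nonneg ε)
  calc ‖x z n‖ * ‖y z n‖ ≤ (C * (n : ℝ) ^ (e - 1)) * (D * (n : ℝ) ^ (d - 1)) :=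
        mul_le_mul (h1 n hn).2 (h2 n hn).2 (norm_nonneg _) (by positivity)
    _ = C * D * (n : ℝ) ^ (e - 1 + (d - 1)) := by
        rw [Real.rpow_add (by linarith)]; ring
    _ ≤ C * D * (n : ℝ) ^ (e + d - 1) := mul_le_mul_of_nonneg_left
        (Real.rpow_le_rpow_of_exponent_le hn1 (by linarith)) (by positivity)

theorem sum_rpow_sub_one_le {τ : ℝ} (hτ : 0 < τ) (N : ℕ) :
    ∑ n ∈ Finset.Icc 1 N, (n : ℝ) ^ (τ - 1) ≤ (1 + τ⁻¹) * (N : ℝ) ^ τ := by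
  have hN : (0 : ℝ) ≤ (N : ℝ) ^ τ := by positivity
  rcases le_or_gt 1 τ with h | h
  · calc ∑ n ∈ Finset.Icc 1 N, (n : ℝ) ^ (τ - 1) ≤ ∑ n ∈ Finset.Icc 1 N, (N : ℝ) ^ (τ - 1) :=
          Finset.sum_le_sum fun n hn => Real.rpow_le_rpow (by positivity)
            (by exact_mod_cast (Finset.mem_Icc.1 hn).2) (by linarith)
      _ = (N : ℝ) * (N : ℝ) ^ (τ - 1) := by simp
      _ = (N : ℝ) ^ τ := by
          rcases N.eq_zero_or_pos with rfl | hN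
          · simp [hτ.ne']
          · rw [← Real.rpow_one_add' (by positivity) (by linarith)]
            congr 1
            ring
      _ ≤ (1 + τ⁻¹) * (N : ℝ) ^ τ :=
          le_mul_of_one_le_left hN (by have := inv_pos.2 hτ; linarith)
  · have key : ∑ n ∈ Finset.Icc 1 N, (n : ℝ) ^ (τ - 1) ≤ τ⁻¹ * (N : ℝ) ^ τ := by
      clear hN
      induction N with
      | zero => simp [hτ.ne']
      | succ N ih =>
        rw [Finset.sum_Icc_succ_top (by omega)]
        have hM : (0 : ℝ) < ((N + 1 : ℕ) : ℝ) := by positivity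
        set M : ℝ := ((N + 1 : ℕ) : ℝ) with hMdef
        -- Bernoulli's inequality for exponents at most `1` gives `M ^ (τ - 1) ≤ τ⁻¹ (M ^ τ - (M -
        -- 1) ^ τ)`, which telescopes.
        have hb : (1 + -M⁻¹) ^ τ ≤ 1 + τ * -M⁻¹ :=
          rpow_one_add_le_one_add_mul_self
            (neg_le_neg (inv_le_one_of_one_le₀ (by rw [hMdef]; exact_mod_cast N.succ_pos)))
            hτ.le h.le
        have hN : (N : ℝ) = M * (1 + -M⁻¹) := by
          rw [mul_add, mul_neg, mul_inv_cancel₀ hM.ne', hMdef]; push_cast; ring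
        have h1 : (0 : ℝ) ≤ 1 + -M⁻¹ := by
          have := N.cast_nonneg (α := ℝ)
          rw [hN] at this
          exact nonneg_of_mul_nonneg_right this hM
        have h2 : (N : ℝ) ^ τ ≤ M ^ τ - τ * M ^ (τ - 1) := by
          rw [hN, Real.mul_rpow hM.le h1]
          refine (mul_le_mul_of_nonneg_left hb (by positivity)).trans_eq ?_
          rw [Real.rpow_sub_one hM.ne']
          field_simp
          ring
        have h3 := mul_le_mul_of_nonneg_left h2 (inv_pos.2 hτ).le
        rw [mul_sub, inv_mul_cancel_left₀ hτ.ne'] at h3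
        linarith
    exact key.trans (mul_le_mul_of_nonneg_right (by linarith) hN)

theorem Nesting.innerBound_le (κ : Nesting) (n : ℕ) : κ.innerBound n ≤ n := by
  cases κ <;> simp [Nesting.innerBound]

theorem differentiableAt_famSum (κ : Nesting) {y : List (ℂ → ℝ → ℂ)} {z : ℂ}
    (h : ∀ x ∈ y, ∀ n : ℕ, 1 ≤ n → DifferentiableAt ℂ (fun y => x y n) z) (N : ℕ) :
    DifferentiableAt ℂ (fun z => famSum κ y z N) z := by
  induction y generalizing N with
  | nil => exact differentiableAt_const 1
  | cons x y ih =>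
    simp only [List.mem_cons, forall_eq_or_imp] at h
    exact DifferentiableAt.fun_sum fun n hn =>
      (h.1 n (Finset.mem_Icc.1 hn).1).mul (ih h.2 (κ.innerBound n))

/-- The inner sum is `O(m ^ (τ - e))` with `τ - e > 0`; multiplied by the outer letter it is `O(m ^
(τ - 1))`, whose partial sums are `O(n ^ τ)`. Positivity of each threshold excludes logarithms. -/
theorem exists_famSum_le (κ : Nesting) {y : List (ℂ → ℝ → ℂ)} {l : List ℝ}
    (hy : List.Forall₂ UnifBound y l) {τ : ℝ} (hτ : 0 < τ) (hl : PrefixSumsLT τ l) :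
    ∃ C : ℝ, 0 ≤ C ∧ ∀ᶠ z in 𝓝 (0 : ℂ), ∀ n : ℕ, 1 ≤ n →
      ‖famSum κ y z (κ.innerBound n)‖ ≤ C * (n : ℝ) ^ τ := by
  induction hy generalizing τ with
  | nil =>
    refine ⟨1, zero_le_one, Eventually.of_forall fun z n hn => ?_⟩
    simpa [famSum, truncSum] using Real.one_le_rpow (by exact_mod_cast hn) hτ.le
  | @cons x e y l hx hy ih =>
    obtain ⟨C, hC, h1⟩ := hx
    obtain ⟨D, hD, h2⟩ := ih (sub_pos.2 hl.1) hl.2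
    have := inv_pos.2 hτ
    refine ⟨C * D * (1 + τ⁻¹), by positivity, ?_⟩
    filter_upwards [h1, h2] with z h1 h2 n hn
    calc ‖famSum κ (x :: y) z (κ.innerBound n)‖
        ≤ ∑ m ∈ Finset.Icc 1 (κ.innerBound n), C * D * (m : ℝ) ^ (τ - 1) := by
          rw [famSum, List.map_cons, truncSum]
          refine norm_sum_le_of_le _ fun m hm => ?_
          have hm1 := (Finset.mem_Icc.1 hm).1
          have hm0 : (0 : ℝ) < m := by exact_mod_cast hm1
          rw [norm_mul]
          refine (mul_le_mul (h1 m hm1).2 (h2 m hm1) (norm_nonneg _)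
            (by positivity)).trans_eq ?_
          rw [show τ - 1 = (e - 1) + (τ - e) by ring, Real.rpow_add hm0]
          ring
      _ ≤ C * D * ((1 + τ⁻¹) * ((κ.innerBound n : ℕ) : ℝ) ^ τ) := by
          rw [← Finset.mul_sum]
          exact mul_le_mul_of_nonneg_left (sum_rpow_sub_one_le hτ _) (by positivity)
      _ ≤ C * D * ((1 + τ⁻¹) * (n : ℝ) ^ τ) := by
          have h3 : ((κ.innerBound n : ℕ) : ℝ) ^ τ ≤ (n : ℝ) ^ τ :=
            Real.rpow_le_rpow (by positivity) (by exact_mod_cast κ.innerBound_le n) hτ.le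
          gcongr
      _ = C * D * (1 + τ⁻¹) * (n : ℝ) ^ τ := by ring

theorem UnifBound.eventually_differentiableAt {y : List (ℂ → ℝ → ℂ)} {l : List ℝ}
    (hy : List.Forall₂ UnifBound y l) : ∀ᶠ z in 𝓝 (0 : ℂ), ∀ x ∈ y, ∀ n : ℕ, 1 ≤ n →
      DifferentiableAt ℂ (fun y => x y n) z := by
  induction hy with
  | nil => simp
  | cons hx hy ih =>
    obtain ⟨C, hC, h1⟩ := hx
    filter_upwards [h1, ih] with z h1 h2
    simp only [List.mem_cons, forall_eq_or_imp]
    exact ⟨fun n hn => (h1 n hn).1, h2⟩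

/-- In the domain of convergence, truncated nested sums converge to a function of `z` that is
holomorphic near `0`. -/
theorem exists_tendsto_famSum (κ : Nesting) {y : List (ℂ → ℝ → ℂ)} {l : List ℝ}
    (hy : List.Forall₂ UnifBound y l) {η : ℝ} (hη : 0 < η) (hl : PrefixSumsLT (-η) l) :
    ∃ L : ℂ → ℂ, AnalyticAt ℂ L 0 ∧
      ∀ᶠ z in 𝓝 (0 : ℂ), Tendsto (famSum κ y z) atTop (𝓝 (L z)) := by
  obtain _ | @⟨x, e, y, l, hx, hy⟩ := hy
  · exact ⟨1, analyticAt_const, Eventually.of_forall fun z => tendsto_const_nhds⟩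
  · have hd := UnifBound.eventually_differentiableAt hy
    obtain ⟨C, hC, h1⟩ := hx
    -- With the threshold `-η - e > 0` the outermost summand is `O(n ^ (-1 - η))`, uniformly near `z
    -- = 0`.
    obtain ⟨D, hD, h2⟩ := exists_famSum_le κ hy (sub_pos.2 hl.1) hl.2
    obtain ⟨r, hr, hb⟩ := Metric.eventually_nhds_iff_ball.1 (h1.and (h2.and hd))
    set F : ℕ → ℂ → ℂ := fun n z =>
      x z ((n + 1 : ℕ) : ℝ) * famSum κ y z (κ.innerBound (n + 1)) with hF
    set u : ℕ → ℝ := fun n => C * D * ((n + 1 : ℕ) : ℝ) ^ (-1 - η) with hu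
    have hsum : Summable u :=
      (((Real.summable_nat_rpow (p := -1 - η)).2 (by linarith)).comp_injective
        (add_left_injective 1)).mul_left _
    have hle : ∀ n z, z ∈ Metric.ball (0 : ℂ) r → ‖F n z‖ ≤ u n := fun n z hz => by
      obtain ⟨h1, h2, -⟩ := hb z hz
      have hm0 : (0 : ℝ) < (n + 1 : ℕ) := by positivity
      rw [hF, norm_mul]
      refine (mul_le_mul (h1 _ (by omega)).2 (h2 _ (by omega)) (norm_nonneg _)
        (by positivity)).trans_eq ?_
      rw [hu]
      simp only
      rw [show -1 - η = (e - 1) + (-η - e) by ring, Real.rpow_add hm0]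
      ring
    refine ⟨fun z => ∑' n, F n z, ?_, ?_⟩
    · refine (Complex.differentiableOn_tsum_of_summable_norm hsum (fun n z hz => ?_)
        Metric.isOpen_ball hle).analyticAt (Metric.ball_mem_nhds 0 hr)
      exact (((hb z hz).1 _ (by omega)).1.mul
        (differentiableAt_famSum κ (hb z hz).2.2 _)).differentiableWithinAt
    · filter_upwards [Metric.ball_mem_nhds (0 : ℂ) hr] with z hz
      have hs : Summable fun n => F n z := hsum.of_norm_bounded fun n => hle n z hz
      refine hs.hasSum.tendsto_sum_nat.congr fun N => ?_
      rw [famSum, List.map_cons, truncSum, Finset.range_eq_Ico, Finset.sum_Ico_add'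
        (fun n : ℕ => x z (n : ℝ) * famSum κ y z (κ.innerBound n)) 0 N 1]
      rfl

/-! ### Renormalised values in the domain of convergence -/

theorem polePart_eq_zero {f g : ℂ → ℂ} (hg : AnalyticAt ℂ g 0)
    (h : ∀ᶠ z in 𝓝[≠] (0 : ℂ), f z = g z) : polePart f = 0 := by
  obtain ⟨p, a, hp, hp0, ha, hs⟩ :=
    polePart_spec (hg.meromorphicAt.congr (h.mono fun z hz => hz.symm))
  have := eq_zero_of_eval_inv_eq_analytic hp0 (hg.sub ha) (by
    filter_upwards [h, hs] with z h1 h2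
    rw [Pi.sub_apply, ← h1, h2]
    ring)
  rw [hp, this]
  ext z
  simp

/-- If `Φ` is holomorphic at `0` on all prefixes of a word, the Birkhoff factorisation of `Φ` is
trivial on this word. -/
theorem birkhoffPlus_eq_self {X : Type*} {Φ : List X → ℂ → ℂ} {w : List X} (hw : w ≠ [])
    (h : ∀ i, ∃ g : ℂ → ℂ, AnalyticAt ℂ g 0 ∧ ∀ᶠ z in 𝓝[≠] (0 : ℂ), Φ (w.take i) z = g z) :
    birkhoffPlus Φ w = Φ w := by
  have key : ∀ (n : ℕ) (w : List X), w.length = n → w ≠ [] →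
      (∀ i, ∃ g : ℂ → ℂ, AnalyticAt ℂ g 0 ∧ ∀ᶠ z in 𝓝[≠] (0 : ℂ), Φ (w.take i) z = g z) →
      birkhoffPrep Φ w = Φ w ∧ polePart (birkhoffPrep Φ w) = 0 := by
    intro n
    induction n using Nat.strong_induction_on with
    | _ n ih =>
      intro w hn hw h
      have h1 : birkhoffPrep Φ w = Φ w := by
        ext z
        rw [birkhoffPrep, Finset.sum_eq_zero fun i _ => ?_, add_zero]
        obtain ⟨a, w, rfl⟩ := List.exists_cons_of_ne_nil hw
        rw [List.take_succ_cons, birkhoffMinus_cons, ← List.take_succ_cons,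
          (ih _ ?_ ((a :: w).take (i + 1)) rfl (by simp) fun j => ?_).2]
        · simp
        · have := i.2
          simp only [List.length_cons] at this hn
          simp only [List.length_take, List.length_cons]
          omega
        · rw [List.take_take]
          exact h _
      refine ⟨h1, ?_⟩
      obtain ⟨g, hg, hz⟩ := h w.length
      rw [List.take_length] at hz
      rw [h1]
      exact polePart_eq_zero hg hz
  obtain ⟨h1, h2⟩ := key _ w rfl hw h
  obtain ⟨a, w, rfl⟩ := List.exists_cons_of_ne_nil hw
  rw [birkhoffPlus, h2, h1, sub_zero]

/-- `f` is proportional to `(ξ + v) ^ b` on `[1, +∞[` with `Re b + 1 + δ ≤ e`. -/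
def HurwitzBound (v δ : ℝ) (f : hurwitzAlgebra) (e : ℝ) : Prop :=
  ∃ c b : ℂ, c ≠ 0 ∧ (∀ ξ : ℝ, 1 ≤ ξ → (f : ℝ → ℂ) ξ = c * ((ξ + v : ℝ) : ℂ) ^ b) ∧
    b.re + 1 + δ ≤ e

theorem HurwitzBound.bullet {v δ : ℝ} (hv : 0 ≤ v) (hδ : 0 < δ) {ε : ℂ} (hε : ε ≠ 0)
    {f g : hurwitzAlgebra} {e d : ℝ} (hf : HurwitzBound v δ f e) (hg : HurwitzBound v δ g d) :
    HurwitzBound v δ (bullet ε f g) (e + d) := by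
  obtain ⟨c, b, hc, h1, h2⟩ := hf
  obtain ⟨c', b', hc', h1', h2'⟩ := hg
  refine ⟨ε * (c * c'), b + b', mul_ne_zero hε (mul_ne_zero hc hc'), fun ξ hξ => ?_, ?_⟩
  · have : ((ξ + v : ℝ) : ℂ) ≠ 0 := by exact_mod_cast (by linarith : ξ + v ≠ 0)
    simp only [HurwitzRenorm.bullet, NonUnitalSubalgebra.coe_smul, NonUnitalSubalgebra.coe_mul,
      Pi.smul_apply, Pi.mul_apply, smul_eq_mul, h1 ξ hξ, h1' ξ hξ]
    rw [Complex.cpow_add _ _ this]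
    ring
  · rw [Complex.add_re]
    linarith

section

variable {W : Set ℂ} (R : Regularisation W) (κ : Nesting) (hW : IsOpen W) (h0 : (0 : ℂ) ∈ W)
include hW h0

/-- A general regularisation could contain high orders that cancel at `z = 0`. The nonzero constant
`c` gives `f` the order `b`, so `R.simple` yields one family of order starting at `b`, and `δ > 0`
absorbs its variation. -/
theorem HurwitzBound.unifBound {v δ : ℝ} (hv : 0 ≤ v) (hδ : 0 < δ) {f : hurwitzAlgebra} {e : ℝ}
    (hf : HurwitzBound v δ f e) : UnifBound (R.toFun f) e := by
  obtain ⟨c, b, hc, h1, h2⟩ := hf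
  obtain ⟨α, hα, hα0, -⟩ := R.simple f b
    (hasOrder_of_eq hv (isPosSupported_hurwitzAlgebra f) hc h1)
  obtain ⟨a, ha, h⟩ := exists_simple_remainder_bound hW h0 hα
  -- This makes the remainder `O(n ^ (-N))` no larger than `n ^ (e - 1)`.
  obtain ⟨N, hN⟩ := exists_nat_ge (1 - e)
  obtain ⟨J, C, hC, hb⟩ := h N
  have hαa : AnalyticAt ℂ α 0 := hα.order_holomorphic.analyticAt (hW.mem_nhds h0)
  have hre : ∀ᶠ z in 𝓝 (0 : ℂ), (α z).re < e - 1 :=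
    (Complex.continuous_re.continuousAt.comp hαa.continuousAt).eventually_lt_const
      (show (α 0).re < e - 1 by rw [hα0]; linarith)
  have hcj : ∀ᶠ z in 𝓝 (0 : ℂ), ∀ j ∈ Finset.range J, ‖a j z‖ < ‖a j 0‖ + 1 :=
    (Filter.eventually_all_finset _).2 fun j _ =>
      (ha j).continuousAt.norm.eventually_lt_const (lt_add_one _)
  have hWn : ∀ᶠ z in 𝓝 (0 : ℂ), z ∈ W := hW.mem_nhds h0
  refine ⟨C + ∑ j ∈ Finset.range J, (‖a j 0‖ + 1), by positivity, ?_⟩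
  filter_upwards [hb, hre, hcj, hWn] with z hz1 hz2 hz3 hz4 n hn
  refine ⟨?_, ?_⟩
  · have := (hα.holomorphic 0 n).differentiableAt (hW.mem_nhds hz4)
    simpa only [iteratedDeriv_zero] using this
  · have hn1 : (1 : ℝ) ≤ n := by exact_mod_cast hn
    have hn0 : 0 < n := hn
    have e1 : (n : ℝ) ^ (-(N : ℝ)) ≤ (n : ℝ) ^ (e - 1) :=
      Real.rpow_le_rpow_of_exponent_le hn1 (by linarith)
    have e2 : ‖∑ j ∈ Finset.range J, a j z * (n : ℂ) ^ (α z - j)‖ ≤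
        (∑ j ∈ Finset.range J, (‖a j 0‖ + 1)) * (n : ℝ) ^ (e - 1) := by
      rw [Finset.sum_mul]
      refine norm_sum_le_of_le _ fun j hj => ?_
      rw [norm_mul, Complex.norm_natCast_cpow_of_pos hn0]
      refine mul_le_mul (hz3 j hj).le (Real.rpow_le_rpow_of_exponent_le hn1 ?_) (by positivity)
        (by positivity)
      have := j.cast_nonneg (α := ℝ)
      rw [Complex.sub_re, Complex.natCast_re]
      linarith
    calc ‖R.toFun f z n‖ = ‖(R.toFun f z n - ∑ j ∈ Finset.range J, a j z * (n : ℂ) ^ (α z - j)) +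
          ∑ j ∈ Finset.range J, a j z * (n : ℂ) ^ (α z - j)‖ := by rw [sub_add_cancel]
      _ ≤ C * (n : ℝ) ^ (e - 1) + (∑ j ∈ Finset.range J, (‖a j 0‖ + 1)) * (n : ℝ) ^ (e - 1) :=
          (norm_add_le _ _).trans (add_le_add
            ((hz1 n hn).trans (mul_le_mul_of_nonneg_left e1 hC)) e2)
      _ = _ := by ring

/-- Every word in `exp ∘ R̃ ∘ log` arises from `w` by merging letters twice, before and after
regularisation. The exponents follow along, so each such word satisfies the same prefix conditions
and converges uniformly. -/
theorem exists_analyticAt_regSum {v δ : ℝ} (hv : 0 ≤ v) (hδ : 0 < δ) {w : List hurwitzAlgebra}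
    {l : List ℝ} (hw : List.Forall₂ (HurwitzBound v δ) w l) {η : ℝ} (hη : 0 < η)
    (hl : PrefixSumsLT (-η) l) : ∃ L : ℂ → ℂ, AnalyticAt ℂ L 0 ∧ ∀ᶠ z in 𝓝 (0 : ℂ),
      regSum R κ w z = L z ∧ Tendsto (regTruncSum R κ w z) atTop (𝓝 (L z)) := by
  have h : ∀ y : List (ℂ → ℝ → ℂ), ∃ L : ℂ → ℂ, y ∈ (regWord R κ w).support →
      AnalyticAt ℂ L 0 ∧ ∀ᶠ z in 𝓝 (0 : ℂ), Tendsto (famSum κ y z) atTop (𝓝 (L z)) := by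
    intro y
    by_cases hy : y ∈ (regWord R κ w).support
    · obtain ⟨u, h1, h2⟩ := exists_of_mem_support_regWord R κ hy
      obtain ⟨l₁, h3, h4⟩ := h1.lift
        (fun a b x y ha hb => HurwitzBound.bullet hv hδ κ.sign_ne_zero ha hb) hw
      have h5 : List.Forall₂ UnifBound (u.map R.toFun) l₁ :=
        List.forall₂_map_left_iff.2 (h4.imp fun f e hf => hf.unifBound R hW h0 hv hδ)
      obtain ⟨l₂, h6, h7⟩ := h2.lift (fun a b x y ha hb => UnifBound.bullet κ.sign ha hb) h5
      obtain ⟨L, hL⟩ := exists_tendsto_famSum κ h7 hη ((hl.coarse h3).coarse h6)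
      exact ⟨L, fun _ => hL⟩
    · exact ⟨0, fun h => absurd h hy⟩
  choose L hL using h
  refine ⟨fun z => ∑ y ∈ (regWord R κ w).support, regWord R κ w y • L y z,
    Finset.analyticAt_fun_sum _ fun y hy => analyticAt_const.fun_smul (hL y hy).1, ?_⟩
  filter_upwards [(Filter.eventually_all_finset _).2 fun y hy => (hL y hy).2] with z hz
  refine ⟨?_, ?_⟩
  · rw [regSum_eq, ev_eq_sum]
    exact Finset.sum_congr rfl fun y hy => by
      rw [(hasFinitePart_of_tendsto (hz y hy)).finitePart_eq]
  · have : regTruncSum R κ w z = fun N => ∑ y ∈ (regWord R κ w).support,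
        regWord R κ w y • famSum κ y z N := rfl
    rw [this]
    exact tendsto_finsetSum _ fun y hy => (hz y hy).const_smul _

/-- In the domain of convergence, renormalised nested sums are limits of truncated ones. -/
theorem tendsto_truncSum_renormSum {v δ : ℝ} (hv : 0 ≤ v) (hδ : 0 < δ) {w : List hurwitzAlgebra}
    {l : List ℝ} (hw : List.Forall₂ (HurwitzBound v δ) w l) {η : ℝ} (hη : 0 < η)
    (hl : PrefixSumsLT (-η) l) :
    Tendsto (truncSum κ (w.map (fun f : hurwitzAlgebra => (f : ℝ → ℂ)))) atTop
      (𝓝 (renormSum R κ w)) := by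
  obtain ⟨L, hL, h⟩ := exists_analyticAt_regSum R κ hW h0 hv hδ hw hη hl
  have h1 : Tendsto (truncSum κ (w.map (fun f : hurwitzAlgebra => (f : ℝ → ℂ)))) atTop
      (𝓝 (L 0)) := by
    -- Convergence holds on a full neighbourhood, so it can be read at `z = 0`, where the
    -- regularisation has no effect.
    have := h.self_of_nhds.2
    rwa [show regTruncSum R κ w 0 = _ from funext (regTruncSum_zero R κ w)] at this
  have h2 : birkhoffPlus (regSum R κ) w =ᶠ[𝓝[≠] 0] L := by
    rcases eq_or_ne w [] with rfl | hne
    · filter_upwards [nhdsWithin_le_nhds h] with z hz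
      rw [← hz.1, regSum_nil, birkhoffPlus]
      rfl
    · rw [birkhoffPlus_eq_self hne fun i => ?_]
      · exact nhdsWithin_le_nhds (h.mono fun z hz => hz.1)
      · obtain ⟨g, hg, hz⟩ := exists_analyticAt_regSum R κ hW h0 hv hδ
          (List.forall₂_take i hw) hη (hl.take i)
        exact ⟨g, hg, nhdsWithin_le_nhds (hz.mono fun z hz => hz.1)⟩
  rwa [tendsto_nhds_unique (tendsto_birkhoffPlus_regSum R κ hW h0 w)
    ((hL.continuousAt.tendsto.mono_left nhdsWithin_le_nhds).congr' h2.symm)]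

end

/-! ### Nested sums as sums over tuples -/

/-- The index sets of the nested sums. -/
def Nesting.Tuple (κ : Nesting) {k : ℕ} (n : Fin k → ℕ) : Prop :=
  match κ with
  | .weak => (∀ i, 0 < n i) ∧ Antitone n
  | .strict => (∀ i, 0 < n i) ∧ StrictAnti n

theorem Nesting.tuple_iff (κ : Nesting) {k : ℕ} (n : Fin (k + 1) → ℕ) :
    κ.Tuple n ↔ 0 < n 0 ∧ κ.Tuple (Fin.tail n) ∧ ∀ i, Fin.tail n i ≤ κ.innerBound (n 0) := by
  cases κ with
  | weak =>
    simp only [Nesting.Tuple, Nesting.innerBound, Fin.tail]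
    refine ⟨fun h => ⟨h.1 0, ⟨fun i => h.1 _, fun i j hij => h.2 (Fin.succ_le_succ_iff.2 hij)⟩,
      fun i => h.2 (Fin.zero_le _)⟩, fun h => ⟨Fin.cases h.1 h.2.1.1, fun i j hij => ?_⟩⟩
    induction i using Fin.cases with
    | zero => exact Fin.cases (motive := fun j => n j ≤ n 0) le_rfl h.2.2 j
    | succ i =>
      induction j using Fin.cases with
      | zero => exact absurd hij (by simp)
      | succ j => exact h.2.1.2 (Fin.succ_le_succ_iff.1 hij)
  | strict =>
    simp only [Nesting.Tuple, Nesting.innerBound, Fin.tail]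
    refine ⟨fun h => ⟨h.1 0, ⟨fun i => h.1 _, fun i j hij => h.2 (Fin.succ_lt_succ_iff.2 hij)⟩,
      fun i => Nat.le_sub_one_of_lt (h.2 (Fin.succ_pos i))⟩,
      fun h => ⟨Fin.cases h.1 h.2.1.1, fun i j hij => ?_⟩⟩
    induction j using Fin.cases with
    | zero => exact absurd hij (Fin.not_lt_zero i)
    | succ j =>
      induction i using Fin.cases with
      | zero => have := h.2.2 j; have := h.1; omega
      | succ i => exact h.2.1.2 (Fin.succ_lt_succ_iff.1 hij)

open Classical in
theorem truncSum_ofFn (κ : Nesting) {k : ℕ} (g : Fin k → ℝ → ℂ) (N : ℕ) :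
    truncSum κ (List.ofFn g) N =
      ∑ n ∈ Fintype.piFinset (fun _ : Fin k => Finset.Icc 1 N) with κ.Tuple n,
        ∏ i, g i (n i) := by
  induction k generalizing N with
  | zero =>
    have h : κ.Tuple (fun i : Fin 0 => i.elim0 : Fin 0 → ℕ) := by
      cases κ <;> exact ⟨fun i => i.elim0, fun i => i.elim0⟩
    rw [Finset.filter_true_of_mem fun n _ => by rwa [Subsingleton.elim n]]
    simp [truncSum]
  | succ k ih =>
    rw [List.ofFn_succ, truncSum]
    simp only [ih, Finset.mul_sum]
    rw [Finset.sum_sigma']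
    refine Finset.sum_nbij' (fun p => Fin.cons p.1 p.2) (fun n => ⟨n 0, Fin.tail n⟩) ?_ ?_ ?_ ?_ ?_
    · rintro ⟨m, n⟩ h
      simp only [Finset.mem_sigma, Finset.mem_Icc, Finset.mem_filter, Fintype.mem_piFinset] at h
      obtain ⟨⟨h1, h2⟩, h3, h4⟩ := h
      have h5 := κ.innerBound_le m
      simp only [Finset.mem_filter, Fintype.mem_piFinset, Finset.mem_Icc, κ.tuple_iff,
        Fin.cons_zero, Fin.tail_cons]
      exact ⟨Fin.cases ⟨h1, h2⟩ fun i => by simpa using ⟨(h3 i).1, by have := (h3 i).2; omega⟩,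
        h1, h4, fun i => (h3 i).2⟩
    · intro n h
      simp only [Finset.mem_filter, Fintype.mem_piFinset, Finset.mem_Icc, κ.tuple_iff] at h
      simp only [Finset.mem_sigma, Finset.mem_Icc, Finset.mem_filter, Fintype.mem_piFinset]
      exact ⟨h.1 0, fun i => ⟨(h.1 i.succ).1, h.2.2.2 i⟩, h.2.2.1⟩
    · rintro ⟨m, n⟩ -
      simp
    · exact fun n _ => Fin.cons_self_tail n
    · rintro ⟨m, n⟩ -
      rw [Fin.prod_univ_succ]
      simp

/-- If the truncated nested sums of the absolute values are bounded and the truncated nested sums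
converge, the nested sum converges absolutely to the same limit. -/
theorem hasSum_of_tendsto_truncSum (κ : Nesting) {k : ℕ} {g : Fin k → ℝ → ℂ} {c : ℂ}
    (h : Tendsto (truncSum κ (List.ofFn g)) atTop (𝓝 c))
    (hB : ∃ B : ℝ, ∀ N, ‖truncSum κ (List.ofFn fun i ξ => ((‖g i ξ‖ : ℝ) : ℂ)) N‖ ≤ B) :
    HasSum (fun n : {n : Fin k → ℕ // κ.Tuple n} => ∏ i, g i (n.1 i)) c := by
  classical
  obtain ⟨B, hB⟩ := hB
  set S : ℕ → Finset {n : Fin k → ℕ // κ.Tuple n} := fun N =>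
    (Fintype.piFinset fun _ : Fin k => Finset.Icc 1 N).subtype κ.Tuple with hS
  have hsum : ∀ (g : Fin k → ℝ → ℂ) (N : ℕ), ∑ n ∈ S N, ∏ i, g i (n.1 i) =
      truncSum κ (List.ofFn g) N := fun g N => by
    rw [truncSum_ofFn]
    exact Finset.sum_subtype_eq_sum_filter (fun n : Fin k → ℕ => ∏ i, g i (n i))
  have hmono : Monotone S := fun N M hNM => by
    refine Finset.subtype_mono (Fintype.piFinset_subset _ _ fun _ => ?_)
    exact Finset.Icc_subset_Icc_right hNM
  have hpos : ∀ n : {n : Fin k → ℕ // κ.Tuple n}, ∀ i, 0 < n.1 i := fun n => by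
    obtain ⟨n, hn⟩ := n
    cases κ <;> exact hn.1
  have hmem : ∀ n, ∃ N, n ∈ S N := fun n => by
    refine ⟨∑ i, n.1 i, ?_⟩
    simp only [hS, Finset.mem_subtype, Fintype.mem_piFinset, Finset.mem_Icc]
    exact fun i => ⟨hpos n i, Finset.single_le_sum (fun _ _ => Nat.zero_le _) (Finset.mem_univ i)⟩
  have htop := tendsto_atTop_finset_of_monotone hmono hmem
  have hs : Summable fun n : {n : Fin k → ℕ // κ.Tuple n} => ‖∏ i, g i (n.1 i)‖ := by
    refine summable_of_sum_le (c := B) (fun _ => norm_nonneg _) fun u => ?_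
    obtain ⟨N, hN⟩ := (htop.eventually_ge_atTop u).exists
    refine (Finset.sum_le_sum_of_subset_of_nonneg hN fun _ _ _ => norm_nonneg _).trans ?_
    refine (le_abs_self _).trans ((Complex.norm_real _).symm.le.trans ?_)
    refine le_trans (le_of_eq ?_) (hB N)
    rw [← hsum]
    push_cast
    simp only [norm_prod, Complex.ofReal_prod]
  have h1 := hs.of_norm.hasSum
  have h2 : Tendsto (fun N => ∑ n ∈ S N, ∏ i, g i (n.1 i)) atTop (𝓝 c) := by
    simpa only [hsum] using h
  rwa [tendsto_nhds_unique h2 (h1.comp htop)]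

/-- Viewed as a family constant in `z`, the absolute values satisfy the same kind of bound;
convergence of their truncated sums then yields absolute convergence. -/
theorem unifBound_norm_cpow {v δ : ℝ} (hv : 0 ≤ v) (hδ : 0 ≤ δ) (s : ℂ) :
    UnifBound (fun _ ξ => ((‖((ξ + v : ℝ) : ℂ) ^ (-s)‖ : ℝ) : ℂ)) (1 - s.re + δ) := by
  refine ⟨(1 + v) ^ |(-s).re|, by positivity, Eventually.of_forall fun z n hn => ?_⟩
  refine ⟨differentiableAt_const _, ?_⟩
  have hn1 : (1 : ℝ) ≤ n := by exact_mod_cast hn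
  rw [Complex.norm_real, norm_norm, Complex.norm_cpow_eq_rpow_re_of_pos (by linarith)]
  have h1 : ((n : ℝ) + v) ^ (-s).re ≤ (1 + v) ^ |(-s).re| * (n : ℝ) ^ (-s).re := by
    rcases le_or_gt 0 (-s).re with h | h
    · rw [abs_of_nonneg h, ← Real.mul_rpow (by linarith) (by linarith)]
      exact Real.rpow_le_rpow (by linarith) (by nlinarith) h
    · calc ((n : ℝ) + v) ^ (-s).re ≤ (n : ℝ) ^ (-s).re :=
            Real.rpow_le_rpow_of_nonpos (by linarith) (by linarith) h.le
        _ ≤ _ := le_mul_of_one_le_left (by positivity)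
            (Real.one_le_rpow (by linarith) (abs_nonneg _))
  refine h1.trans (mul_le_mul_of_nonneg_left
    (Real.rpow_le_rpow_of_exponent_le hn1 ?_) (by positivity))
  rw [Complex.neg_re]
  linarith

theorem truncSum_congr (κ : Nesting) {u w : List (ℝ → ℂ)}
    (h : List.Forall₂ (fun f g : ℝ → ℂ => ∀ n : ℕ, 1 ≤ n → f n = g n) u w) (N : ℕ) :
    truncSum κ u N = truncSum κ w N := by
  induction h generalizing N with
  | nil => rfl
  | cons hfg _ ih =>
    rw [truncSum, truncSum]
    exact Finset.sum_congr rfl fun n hn => by rw [hfg n (Finset.mem_Icc.1 hn).1, ih]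

/-- Renormalised Hurwitz multiple zeta values in the domain of convergence. -/
theorem hasSum_renormZeta {W : Set ℂ} (hW : IsOpen W) (h0 : (0 : ℂ) ∈ W) (R : Regularisation W)
    (κ : Nesting) {v : ℝ} (hv : 0 ≤ v) {k : ℕ} {s : Fin k → ℂ}
    (hs : ∀ m : Fin k, ((m : ℕ) : ℝ) + 1 < (∑ i ∈ Finset.Iic m, s i).re) :
    HasSum (fun n : {n : Fin k → ℕ // κ.Tuple n} => ∏ i, (((n.1 i : ℝ) + v : ℝ) : ℂ) ^ (-s i))
      (renormZeta R κ v (List.ofFn s)) := by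
  have h1 : PrefixSumsLT 0 (List.ofFn fun i => 1 - (s i).re) := by
    refine prefixSumsLT_ofFn fun m => ?_
    have := hs m
    rw [Complex.re_sum] at this
    rw [Finset.sum_sub_distrib, Finset.sum_const, Fin.card_Iic, nsmul_eq_mul, mul_one]
    push_cast
    linarith
  -- One `δ` plays two roles: the room in each letter for the variation of its order, and the margin
  -- `η` in the convergence estimates.
  obtain ⟨δ, h2, hδ⟩ : ∃ δ : ℝ, PrefixSumsLT (-δ)
      ((List.ofFn fun i => 1 - (s i).re).map (· + δ)) ∧ 0 < δ :=
    ((PrefixSumsLT.eventually (τ := fun δ => -δ) continuous_neg.continuousAt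
      (by simpa using h1)).filter_mono nhdsWithin_le_nhds |>.and
        (self_mem_nhdsWithin (s := Set.Ioi (0 : ℝ)))).exists
  have h3 : (List.ofFn fun i => 1 - (s i).re).map (· + δ) =
      (List.ofFn s).map fun t => 1 - t.re + δ := by
    simp [List.map_ofFn, Function.comp_def]
  rw [h3] at h2
  have hrep := isHurwitzSymbol_hurwitzRep hv
  refine hasSum_of_tendsto_truncSum κ (g := fun i ξ => ((ξ + v : ℝ) : ℂ) ^ (-s i)) ?_ ?_
  · have h4 : List.Forall₂ (HurwitzBound v δ) ((List.ofFn s).map (hurwitzRep v))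
        ((List.ofFn s).map fun t => 1 - t.re + δ) := by
      rw [List.forall₂_map_left_iff, List.forall₂_map_right_iff, List.forall₂_same]
      intro t _
      refine ⟨1, -t, one_ne_zero, fun ξ hξ => by rw [one_mul, hrep t ξ hξ], ?_⟩
      rw [Complex.neg_re]
      linarith
    refine (tendsto_truncSum_renormSum R κ hW h0 hv hδ h4 hδ h2).congr fun N => ?_
    refine truncSum_congr κ ?_ N
    have h5 : (List.ofFn fun i => fun ξ : ℝ => ((ξ + v : ℝ) : ℂ) ^ (-s i)) =
        (List.ofFn s).map fun t => fun ξ : ℝ => ((ξ + v : ℝ) : ℂ) ^ (-t) := by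
      simp [List.map_ofFn, Function.comp_def]
    rw [h5, List.map_map, List.forall₂_map_left_iff, List.forall₂_map_right_iff, List.forall₂_same]
    exact fun t _ n hn => hrep t n (by exact_mod_cast hn)
  · have h4 : List.Forall₂ UnifBound ((List.ofFn s).map fun t => fun (_ : ℂ) (ξ : ℝ) =>
        ((‖((ξ + v : ℝ) : ℂ) ^ (-t)‖ : ℝ) : ℂ)) ((List.ofFn s).map fun t => 1 - t.re + δ) := by
      rw [List.forall₂_map_left_iff, List.forall₂_map_right_iff, List.forall₂_same]
      exact fun t _ => unifBound_norm_cpow hv hδ.le t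
    obtain ⟨L, -, hL⟩ := exists_tendsto_famSum κ h4 hδ h2
    obtain ⟨B, hB⟩ := (Metric.isBounded_range_of_tendsto _ hL.self_of_nhds).exists_norm_le
    refine ⟨B, fun N => ?_⟩
    have h5 := hB _ (Set.mem_range_self N)
    rwa [famSum, List.map_map, List.map_ofFn] at h5

end HurwitzRenorm

end

open HurwitzRenorm in
theorem mainTheorem4 (W : Set ℂ) (hW : IsOpen W) (h0 : (0 : ℂ) ∈ W) (R : Regularisation W)
    (v : ℝ) (hv : 0 ≤ v) :
    -- the renormalised values are well defined
    (∀ (κ : Nesting) (s : List ℂ) (f : List hurwitzAlgebra),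
      List.Forall₂ (fun (t : ℂ) (g : hurwitzAlgebra) => IsHurwitzSymbol v t g) s f →
        (∀ᶠ z in 𝓝[≠] (0 : ℂ), ∀ w ∈ (regTensor R κ f z).support,
          ∃ c, HasFinitePart (truncSum κ w) c) ∧
        MeromorphicAt (regSum R κ f) 0 ∧
        renormSum R κ f = renormZeta R κ v s) ∧
    -- stuffle relations
    (∀ P Q : List ℂ →₀ ℂ,
      renormZetaLin R .weak v (stuffle (-1) P Q) =
        renormZetaLin R .weak v P * renormZetaLin R .weak v Q) ∧
    (∀ P Q : List ℂ →₀ ℂ,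
      renormZetaLin R .strict v (stuffle 1 P Q) =
        renormZetaLin R .strict v P * renormZetaLin R .strict v Q) ∧
    -- values in the domain of convergence
    (∀ (k : ℕ) (s : Fin k → ℂ),
      (∀ m : Fin k, ((m : ℕ) : ℝ) + 1 < (∑ i ∈ Finset.Iic m, s i).re) →
        HasSum (fun n : {n : Fin k → ℕ // (∀ i, 0 < n i) ∧ Antitone n} =>
            ∏ i, (((n.1 i : ℝ) + v : ℝ) : ℂ) ^ (-s i))
          (renormZeta R .weak v (List.ofFn s)) ∧
        HasSum (fun n : {n : Fin k → ℕ // (∀ i, 0 < n i) ∧ StrictAnti n} =>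
            ∏ i, (((n.1 i : ℝ) + v : ℝ) : ℂ) ^ (-s i))
          (renormZeta R .strict v (List.ofFn s))) := by
  classical
  have hrep := isHurwitzSymbol_hurwitzRep hv
  refine ⟨fun κ s f hf => ⟨?_, (good_regTruncSum R κ hW h0 f).1,
      renormSum_eq_renormZeta R κ hW h0 hrep hf⟩,
    renormZetaLin_stuffle R .weak hW h0 hv hrep, renormZetaLin_stuffle R .strict hW h0 hv hrep,
    fun k s hs => ⟨hasSum_renormZeta hW h0 R .weak hv hs, hasSum_renormZeta hW h0 R .strict hv hs⟩⟩
  -- Each word occurring at `z` is the value at `z` of one of the finitely many words of families in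
  -- `regWord`.
  filter_upwards [eventually_exists_hasFinitePart R κ hW h0 f] with z hz w hw
  rw [regTensor_eq_mapL] at hw
  obtain ⟨y, hy, rfl⟩ := Finset.mem_image.1 (Finsupp.mapDomain_support hw)
  exact hz y hy
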